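/- Let $\pi\colon E\to M$ be a smooth bundle (only that $\pi$ is a surjective submersion is used) with $\dim M=m$ and $\dim E=m+n$, let $\eta$ be a volume form on $M$, and let $\mathcal L=L\,\eta$ be a second-order Lagrangian density, with $L\in C^\infty(J^2\pi)$. Let $\Lambda^m_2(J^1\pi)$ (resp. $\Lambda^m_1(J^1\pi)$) be the bundle of $m$-forms on $J^1\pi$ that vanish on any two vectors (resp. any vector) vertical over $M$. In coordinates $(x^i,u^\alpha)$ of $E$ adapted to $\pi$, write an element of $\Lambda^m_2(J^1\pi)$ as $p\,d^mx+p^i_\alpha\,du^\alpha\wedge d^{m-1}x_i+p^{ij}_\alpha\,du^\alpha_i\wedge d^{m-1}x_j$. Let $J^2\pi^\dagger\subset\Lambda^m_2(J^1\pi)$ be given by $p^{ij}_\alpha=p^{ji}_\alpha$, and write there $p^{ij}_\alpha=\frac1{n(ij)}p^{1_i+1_j}_\alpha$, where $n(ij)=1$ if $i=j$ and $n(ij)=2$ if $i\ne j$. Let $J^2\pi^\ddagger=J^2\pi^\dagger/\Lambda^m_1(J^1\pi)$, with coordinates $(x^i,u^\alpha,u^\alpha_i,p^i_\alpha,p^I_\alpha)$,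 $|I|=2$, and let $$\mathcal W=J^3\pi\times_{J^1\pi}J^2\pi^\dagger,\qquad \mathcal W_r=J^3\pi\times_{J^1\pi}J^2\pi^\ddagger .$$ In adapted coordinates let $\hat L$ be the function with $\mathcal L=\hat L\,d^mx$ (if $\eta=d^mx$ in these coordinates, $\hat L$ is $L$). Let $\Omega=-d\Theta$ on $\mathcal W$, where $\Theta$ is the pull-back of the tautological $m$-form of $J^2\pi^\dagger$. Let $\hat h\colon\mathcal W_r\to\mathcal W$ be the section of the quotient map given by $p=\hat L-p^i_\alpha u^\alpha_i-p^I_\alpha u^\alpha_I$, and put $\Omega_r=\hat h^*\Omega$. Let $\mathcal W_c\subset\mathcal W_r$ be the set of points where $i(X)\Omega_r$ vanishes for all vector fields $X$ vertical over $J^2\pi^\ddagger$. A solution over an open set $U\subset M$ is a smooth section $\psi$ of $\mathcal W_r\to M$ over $U$ that is holonomic (its component in $J^3\pi$ is the third prolongation $j^3\phi$ of a section $\phi$ of $\pi$) and satisfies $\psi^*i(X)\Omega_r=0$ for every vector field $X$ on $\mathcal W_r$. Then $\mathcal W_c$ is an embedded submanifold of $\mathcal W_r$ of codimension $nm(m+1)/2$,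 and there is a smooth bundle map $\mathcal{FL}\colon J^3\pi\to J^2\pi^\ddagger$ over $J^1\pi$ (the restricted Legendre map), given in all adapted coordinates by $$\mathcal{FL}^*p^i_\alpha=\frac{\partial\hat L}{\partial u^\alpha_i}-\sum_{j=1}^m\frac1{n(ij)}\frac{d}{dx^j}\Big(\frac{\partial\hat L}{\partial u^\alpha_{1_i+1_j}}\Big),\qquad \mathcal{FL}^*p^I_\alpha=\frac{\partial\hat L}{\partial u^\alpha_I}\quad(|I|=2),$$ with $d/dx^j$ the coordinate total derivative, such that the graph $\mathcal W_{\mathcal L}\subset\mathcal W_r$ of $\mathcal{FL}$ is contained in $\mathcal W_c$, is an embedded submanifold of codimension $nm$ in $\mathcal W_c$ (codimension $nm(m+1)/2+nm$ in $\mathcal W_r$), and every solution over every open set $U\subset M$ takes values in $\mathcal W_{\mathcal L}$. -/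

import Mathlib

open scoped Manifold ContDiff Topology

noncomputable section

namespace SecondOrderField

/-! ### Multi-indices and natural coordinate spaces -/

/-- Multi-indices `I` in `m` variables with `|I| ≤ k`; the multi-index `(I(1), …, I(m))` is the
multiset containing each `i` exactly `I(i)` times. Thus `1_i + 1_j` is `{i, j}` and `I + 1_i` is
`i ::ₘ I`. -/
abbrev MultiIndex (m k : ℕ) : Type := {I : Multiset (Fin m) // I.card ≤ k}

instance instFintypeMultiIndex (m k : ℕ) : Fintype (MultiIndex m k) :=
  Fintype.ofInjective
    (fun I => (⟨⟨I.1.card, Nat.lt_succ_of_le I.2⟩, ⟨I.1, rfl⟩⟩ :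
      Σ r : Fin (k + 1), Sym (Fin m) r.1))
    (by
      rintro ⟨I, hI⟩ ⟨J, hJ⟩ h
      have hc : I.card = J.card := by
        have h1 := congrArg (fun s => s.1.1) h
        simpa using h1
      have key : ∀ s t : (Σ r : Fin (k + 1), Sym (Fin m) r.1), s = t →
          (s.2 : Multiset (Fin m)) = (t.2 : Multiset (Fin m)) := by
        rintro s t rfl; rfl
      exact Subtype.ext (key _ _ h))

/-- The empty multi-index. -/
def MultiIndex.zero (m k : ℕ) : MultiIndex m k := ⟨0, by simp⟩

/-- The multi-index `1_i`. -/
def MultiIndex.single {m : ℕ} (k : ℕ) (i : Fin m) : MultiIndex m (k + 1) := ⟨{i}, by simp⟩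

/-- The multi-index `I + 1_i`. -/
def MultiIndex.cons {m k : ℕ} (i : Fin m) (I : MultiIndex m k) : MultiIndex m (k + 1) :=
  ⟨i ::ₘ I.1, by simpa using I.2⟩

/-- A multi-index of length at most `r` as one of length at most `k`, for `r ≤ k`. -/
def MultiIndex.castLE {m r k : ℕ} (h : r ≤ k) (I : MultiIndex m r) : MultiIndex m k :=
  ⟨I.1, I.2.trans h⟩

/-- A multi-index `I` with `|I| = 2`, seen among those with `|I| ≤ k + 2`. -/
def MultiIndex.ofTwo {m : ℕ} (k : ℕ) (I : Sym (Fin m) 2) : MultiIndex m (k + 2) :=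
  ⟨I.1, by rw [I.2]; omega⟩

/-- The multi-index `1_i + 1_j`, as a multi-index of length `2`. -/
def pairIndex {m : ℕ} (i j : Fin m) : Sym (Fin m) 2 := ⟨{i, j}, rfl⟩

/-- The number `n(ij)`. -/
def nfac {m : ℕ} (i j : Fin m) : ℝ := if i = j then 1 else 2

/-- Natural coordinates `(x^i, u_I^α)`, `0 ≤ |I| ≤ k`, on a `k`-th order jet bundle. -/
abbrev JetCoord (m n k : ℕ) : Type := (Fin m → ℝ) × (MultiIndex m k → Fin n → ℝ)

/-- The coordinate vector `∂/∂x^i`. -/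
def ddx {m : ℕ} (n k : ℕ) (i : Fin m) : JetCoord m n k := (Pi.single i 1, 0)

/-- The coordinate vector `∂/∂u_I^α`. -/
def ddu {m n k : ℕ} (I : MultiIndex m k) (α : Fin n) : JetCoord m n k :=
  (0, Pi.single I (Pi.single α 1))

/-- The coordinate covector `dx^i`. -/
def dx {m : ℕ} (n k : ℕ) (i : Fin m) : JetCoord m n k →L[ℝ] ℝ :=
  (ContinuousLinearMap.proj i).comp (ContinuousLinearMap.fst ℝ _ _)

/-- The coordinate covector `du_I^α`. -/
def du {m n k : ℕ} (I : MultiIndex m k) (α : Fin n) : JetCoord m n k →L[ℝ] ℝ :=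
  (ContinuousLinearMap.proj α).comp
    ((ContinuousLinearMap.proj (R := ℝ) (φ := fun _ : MultiIndex m k => Fin n → ℝ) I).comp
      (ContinuousLinearMap.snd ℝ _ _))

/-- The coordinate expression of the projection from `k`-jets to `r`-jets. -/
def coordProj {m n r k : ℕ} (h : r ≤ k) : JetCoord m n k →L[ℝ] JetCoord m n r :=
  (ContinuousLinearMap.fst ℝ _ _).prod
    ((ContinuousLinearMap.pi fun I : MultiIndex m r =>
      ContinuousLinearMap.proj (R := ℝ) (φ := fun _ : MultiIndex m k => Fin n → ℝ)
        (I.castLE h)).comp (ContinuousLinearMap.snd ℝ _ _))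

/-- The holonomic lift of `∂/∂x^j` at a `(k+1)`-jet:
`∂/∂x^j + ∑_{|I| ≤ k} u_{I+1_j}^α ∂/∂u_I^α`. -/
def holonomicLift {m n k : ℕ} (c : JetCoord m n (k + 1)) (j : Fin m) : JetCoord m n k :=
  (Pi.single j 1, fun I => c.2 (I.cons j))

/-- The coordinate total derivative `dF/dx^j`, a function of the `(k+1)`-jet coordinates, of a
function `F` of the `k`-jet coordinates. -/
def totalDeriv {m n k : ℕ} (j : Fin m) (F : JetCoord m n k → ℝ) (c : JetCoord m n (k + 1)) : ℝ :=
  fderiv ℝ F (coordProj (Nat.le_succ k) c) (holonomicLift c j)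

/-- The partial derivative `∂F/∂u_I^α`. -/
def partialU {m n k : ℕ} (I : MultiIndex m k) (α : Fin n) (F : JetCoord m n k → ℝ)
    (c : JetCoord m n k) : ℝ :=
  fderiv ℝ F c (ddu I α)

/-- The iterated partial derivative `∂_{i₁} ⋯ ∂_{i_r} f` for a list `[i₁, …, i_r]`. -/
def partials {m n : ℕ} (l : List (Fin m)) (f : (Fin m → ℝ) → (Fin n → ℝ)) :
    (Fin m → ℝ) → (Fin n → ℝ) :=
  l.foldr (fun i g y => fderiv ℝ g y (Pi.single i 1)) f

/-- The wedge product `ℓ₁ ∧ ⋯ ∧ ℓ_m` of `m` covectors,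
`(v₁, …, v_m) ↦ det (ℓ_a (v_b))`. -/
def wedge {m : ℕ} {V : Type*} [NormedAddCommGroup V] [NormedSpace ℝ V]
    (ℓ : Fin m → (V →L[ℝ] ℝ)) : V [⋀^Fin m]→L[ℝ] ℝ :=
  ContinuousAlternatingMap.compContinuousLinearMap
    { (Matrix.detRowAlternating : (Fin m → ℝ) [⋀^Fin m]→ₗ[ℝ] ℝ) with
      cont := by
        change Continuous fun A : Matrix (Fin m) (Fin m) ℝ => A.det
        exact continuous_id.matrix_det }
    (ContinuousLinearMap.pi ℓ)

/-- The coordinate expression, with respect to a coordinate map `c` with domain `S`, of a function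
`g` (it is extended by `0` outside of `c '' S`). -/
def coordExpr {Z V Y : Type*} [Zero Y] (S : Set Z) (c : Z → V) (g : Z → Y) : V → Y :=
  Function.extend (fun z : S => c z) (fun z : S => g z) 0

section Bundle

variable {m n : ℕ} {M E : Type*}
  [TopologicalSpace M] [ChartedSpace (Fin m → ℝ) M]
  [TopologicalSpace E] [ChartedSpace ((Fin m → ℝ) × (Fin n → ℝ)) E]

/-- A chart of `E` adapted to `π : E → M`: smooth charts of `E` and of `M`, the first with
coordinates `(x^i, u^α)` and the second with coordinates `(x^i)`, in which `π` is
`(x^i, u^α) ↦ (x^i)`. -/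
structure AdaptedChart (π : E → M) where
  total : OpenPartialHomeomorph E ((Fin m → ℝ) × (Fin n → ℝ))
  base : OpenPartialHomeomorph M (Fin m → ℝ)
  total_mem : total ∈ IsManifold.maximalAtlas 𝓘(ℝ, (Fin m → ℝ) × (Fin n → ℝ)) ∞ E
  base_mem : base ∈ IsManifold.maximalAtlas 𝓘(ℝ, Fin m → ℝ) ∞ M
  mapsTo : ∀ p ∈ total.source, π p ∈ base.source
  fst_eq : ∀ p ∈ total.source, (total p).1 = base (π p)

/-- `φ` restricts to a smooth section of `π` on a neighbourhood of `x`. -/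
def IsLocalSection (π : E → M) (φ : M → E) (x : M) : Prop :=
  ∃ V : Set M, IsOpen V ∧ x ∈ V ∧
    ContMDiffOn 𝓘(ℝ, Fin m → ℝ) 𝓘(ℝ, (Fin m → ℝ) × (Fin n → ℝ)) ∞ φ V ∧ ∀ y ∈ V, π (φ y) = y

/-- The coordinate expression `(φ^α(x^i))` of a section. -/
def AdaptedChart.expr {π : E → M} (e : AdaptedChart (m := m) (n := n) π) (φ : M → E) :
    (Fin m → ℝ) → (Fin n → ℝ) :=
  fun y => (e.total (φ (e.base.symm y))).2

/-- The coordinates `(x^i, ∂^{|I|}φ^α/∂x^I)` of the `k`-jet of `φ` at `x`. -/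
def AdaptedChart.sectionCoord {π : E → M} (e : AdaptedChart (m := m) (n := n) π) (k : ℕ)
    (φ : M → E) (x : M) : JetCoord m n k :=
  (e.base x, fun I => partials I.1.sort (e.expr φ) (e.base x))

/-! ### Jet bundles -/

/-- Local sections at `x` are identified when they agree at `x` together with all their partial
derivatives of order at most `k` in adapted coordinates. -/
def jetSetoid (π : E → M) (k : ℕ) (x : M) :
    Setoid {φ : M → E // IsLocalSection (m := m) (n := n) π φ x} where
  r φ χ := φ.1 x = χ.1 x ∧ ∀ e : AdaptedChart (m := m) (n := n) π, φ.1 x ∈ e.total.source →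
    ∀ l : List (Fin m), l.length ≤ k →
      partials l (e.expr φ.1) (e.base x) = partials l (e.expr χ.1) (e.base x)
  iseqv :=
    { refl := fun _ => ⟨rfl, fun _ _ _ _ => rfl⟩
      symm := fun h => ⟨h.1.symm, fun e he l hl => (h.2 e (h.1 ▸ he) l hl).symm⟩
      trans := fun h h' => ⟨h.1.trans h'.1, fun e he l hl =>
        (h.2 e he l hl).trans (h'.2 e (h.1 ▸ he) l hl)⟩ }

variable (m n) in
/-- The `k`-th order jet bundle `J^kπ`. -/
def JetBundle (π : E → M) (k : ℕ) : Type _ :=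
  Σ x : M, Quotient (jetSetoid (m := m) (n := n) π k x)

variable {π : E → M}

/-- The `k`-jet `j^k_xφ`. -/
def jet (k : ℕ) (φ : M → E) (x : M) (h : IsLocalSection (m := m) (n := n) π φ x) :
    JetBundle m n π k :=
  ⟨x, Quotient.mk _ ⟨φ, h⟩⟩

/-- The projection `π^k : J^kπ → E`, `j^k_xφ ↦ φ(x)`. -/
def JetBundle.toE {k : ℕ} (z : JetBundle m n π k) : E :=
  Quotient.lift (s := jetSetoid (m := m) (n := n) π k z.1) (fun φ => φ.1 z.1)
    (fun _ _ h => h.1) z.2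

/-- The projection `π^k_r : J^kπ → J^rπ`, `j^k_xφ ↦ j^r_xφ`. -/
def JetBundle.proj {k : ℕ} (r : ℕ) (h : r ≤ k) (z : JetBundle m n π k) : JetBundle m n π r :=
  ⟨z.1, Quotient.map (sa := jetSetoid (m := m) (n := n) π k z.1)
    (sb := jetSetoid (m := m) (n := n) π r z.1) id (fun _ _ h' => ⟨h'.1, fun e he l hl => h'.2 e he l (hl.trans h)⟩) z.2⟩

/-- The domain of the natural chart of `J^kπ` induced by `e`. -/
def AdaptedChart.jetSource (e : AdaptedChart (m := m) (n := n) π) (k : ℕ) :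
    Set (JetBundle m n π k) :=
  {z | z.toE ∈ e.total.source}

/-- The open set of coordinates onto which the natural chart of `J^kπ` maps its domain. -/
def AdaptedChart.jetTarget (e : AdaptedChart (m := m) (n := n) π) (k : ℕ) :
    Set (JetCoord m n k) :=
  {c | (c.1, c.2 (MultiIndex.zero m k)) ∈ e.total.target}

/-- The natural coordinates of a `k`-jet; on `e.jetSource k` they do not depend on the
representative. -/
def AdaptedChart.jetCoord (e : AdaptedChart (m := m) (n := n) π) (k : ℕ)
    (z : JetBundle m n π k) : JetCoord m n k :=
  e.sectionCoord k (Quotient.out z.2).1 z.1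

/-- The change of natural coordinates of `J^1π` from the chart `e` to the chart `e'`: the
coordinates in `e'` of the `1`-jet of the section which in the chart `e` is the affine map with the
given `1`-jet. -/
def AdaptedChart.transition (e e' : AdaptedChart (m := m) (n := n) π) (c : JetCoord m n 1) :
    JetCoord m n 1 :=
  e'.sectionCoord 1
    (fun x => e.total.symm (e.base x,
      c.2 (MultiIndex.zero m 1) + ∑ i, (e.base x i - c.1 i) • c.2 (MultiIndex.single 0 i)))
    (e.base.symm c.1)

/-! ### Multimomentum bundles -/

variable (m n) in
/-- Families of alternating `m`-forms on coordinate vectors of `J^1π`, indexed by the adapted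
charts. -/
abbrev FormFamily (π : E → M) : Type _ :=
  AdaptedChart (m := m) (n := n) π → (JetCoord m n 1) [⋀^Fin m]→L[ℝ] ℝ

instance instAddCommGroupFormFamily : AddCommGroup (FormFamily m n π) := Pi.addCommGroup

instance instModuleFormFamily : Module ℝ (FormFamily m n π) := Pi.module _ _ _

/-- The fibre over `u` of the extended `2`-symmetric multimomentum bundle `J^2π^†`. An `m`-form on
`T_u J^1π` is a family of alternating forms on coordinate vectors, one for each natural chart around
`u`, which are pulled back to each other by the tangent maps of the coordinate changes. The forms
considered vanish on any two vectors that are vertical over `M`, and their coordinates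
`p_α^{ij}`, the coefficients of `du_i^α ∧ d^{m-1}x_j`, are symmetric in `i` and `j`. The
coefficient of `du_I^α ∧ d^{m-1}x_j` is the value at `(∂_1, …, ∂/∂u_I^α, …, ∂_m)`, with
`∂/∂u_I^α` in place of `∂_j`. -/
def ExtendedFibre (u : JetBundle m n π 1) :
    Submodule ℝ (FormFamily m n π) where
  carrier := {ξ |
    (∀ e, u ∉ e.jetSource 1 → ξ e = 0) ∧
    (∀ e e', u ∈ e.jetSource 1 → u ∈ e'.jetSource 1 →
      ξ e = (ξ e').compContinuousLinearMap (fderiv ℝ (e.transition e') (e.jetCoord 1 u))) ∧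
    (∀ e, ∀ v : Fin m → JetCoord m n 1,
      (∃ a b, a ≠ b ∧ (v a).1 = 0 ∧ (v b).1 = 0) → ξ e v = 0) ∧
    (∀ e, ∀ i j : Fin m, ∀ α : Fin n,
      ξ e (Function.update (ddx n 1) j (ddu (MultiIndex.single 0 i) α)) =
        ξ e (Function.update (ddx n 1) i (ddu (MultiIndex.single 0 j) α)))}
  zero_mem' := by
    exact ⟨fun _ _ => rfl, fun _ _ _ _ => rfl, fun _ _ _ => rfl, fun _ _ _ _ => rfl⟩
  add_mem' := by
    rintro a b ⟨h1, h2, h3, h4⟩ ⟨k1, k2, k3, k4⟩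
    refine ⟨fun e he => ?_, fun e e' he he' => ?_, fun e v hv => ?_, fun e i j α => ?_⟩
    · simp [h1 e he, k1 e he]
    · rw [Pi.add_apply, h2 e e' he he', k2 e e' he he']
      ext; rfl
    · simp [h3 e v hv, k3 e v hv]
    · simp [h4 e i j α, k4 e i j α]
  smul_mem' := by
    rintro t a ⟨h1, h2, h3, h4⟩
    refine ⟨fun e he => ?_, fun e e' he he' => ?_, fun e v hv => ?_, fun e i j α => ?_⟩
    · simp [h1 e he]
    · rw [Pi.smul_apply, h2 e e' he he']
      ext; rfl
    · simp [h3 e v hv]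
    · simp [h4 e i j α]

/-- The fibre over `u` of the bundle `Λ_1^m(J^1π)` of `m`-forms that vanish on each vector that is
vertical over `M`. -/
def SemibasicFibre (u : JetBundle m n π 1) : Submodule ℝ (ExtendedFibre u) where
  carrier := {ξ | ∀ e, ∀ v : Fin m → JetCoord m n 1, (∃ a, (v a).1 = 0) → ξ.1 e v = 0}
  zero_mem' := fun _ _ _ => rfl
  add_mem' := fun {a b} ha hb e v hv => by simp [ha e v hv, hb e v hv]
  smul_mem' := fun t a ha e v hv => by simp [ha e v hv]

/-- The fibre over `u` of the restricted `2`-symmetric multimomentum bundle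
`J^2π^‡ = J^2π^† / Λ_1^m(J^1π)`. -/
abbrev RestrictedFibre (u : JetBundle m n π 1) : Type _ := ExtendedFibre u ⧸ SemibasicFibre u

variable (m n) in
/-- The restricted `2`-symmetric multimomentum bundle `J^2π^‡`. -/
def RestrictedMomentumBundle (π : E → M) : Type _ :=
  Σ u : JetBundle m n π 1, RestrictedFibre u

/-- The coefficient of `du_I^α ∧ d^{m-1}x_j`, `|I| ≤ 1`, on the fibre of `J^2π^‡`. -/
def AdaptedChart.momentum (e : AdaptedChart (m := m) (n := n) π) (u : JetBundle m n π 1)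
    (j : Fin m) (I : MultiIndex m 1) (α : Fin n) : RestrictedFibre u →ₗ[ℝ] ℝ :=
  (SemibasicFibre u).liftQ
    { toFun := fun ξ => ξ.1 e (Function.update (ddx n 1) j (ddu I α))
      map_add' := fun _ _ => rfl
      map_smul' := fun _ _ => rfl }
    (fun _ hh => hh e _ ⟨j, by simp [ddu]⟩)

/-- The coordinates `p_α^i` of `J^2π^‡`. -/
def AdaptedChart.momentumOne (e : AdaptedChart (m := m) (n := n) π)
    (q : RestrictedMomentumBundle m n π) (i : Fin m) (α : Fin n) : ℝ :=
  e.momentum q.1 i (MultiIndex.zero m 1) α q.2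

/-- The coordinates `p_α^I`, `|I| = 2`, of `J^2π^‡`: `p_α^I = ∑_{1_i + 1_j = I} p_α^{ij}`,
which by symmetry means `p_α^{ij} = (1 / n(ij)) p_α^{1_i + 1_j}`. -/
def AdaptedChart.momentumTwo (e : AdaptedChart (m := m) (n := n) π)
    (q : RestrictedMomentumBundle m n π) (I : Sym (Fin m) 2) (α : Fin n) : ℝ :=
  ∑ i, ∑ j, if pairIndex i j = I then e.momentum q.1 j (MultiIndex.single 0 i) α q.2 else 0

/-! ### The restricted jet-multimomentum bundle and its forms -/

variable (m n) in
/-- The restricted `2`-symmetric jet-multimomentum bundle `W_r = J^3π ×_{J^1π} J^2π^‡`. -/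
def Wr (π : E → M) : Type _ :=
  Σ z : JetBundle m n π 3, RestrictedFibre (z.proj 1 (by omega))

/-- The projection `ρ_1^r : W_r → J^3π`. -/
def Wr.toJet (w : Wr m n π) : JetBundle m n π 3 := w.1

/-- The projection `ρ_2^r : W_r → J^2π^‡`. -/
def Wr.toMomentum (w : Wr m n π) : RestrictedMomentumBundle m n π := ⟨_, w.2⟩

/-- The projection `ρ_M^r : W_r → M`. -/
def Wr.toBase (w : Wr m n π) : M := w.1.1

/-- The projection `W_r → E`. -/
def Wr.toE (w : Wr m n π) : E := w.1.toE

/-- Natural coordinates `(x^i, u_I^α, p_α^i, p_α^K)`, `|I| ≤ 3`, `|K| = 2`, of `W_r`. -/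
abbrev WrCoord (m n : ℕ) : Type :=
  JetCoord m n 3 × (Fin m → Fin n → ℝ) × (Sym (Fin m) 2 → Fin n → ℝ)

/-- Natural coordinates `(x^i, u_I^α, p, p_α^i, p_α^K)`, `|I| ≤ 3`, `|K| = 2`, of
`W = J^3π ×_{J^1π} J^2π^†`. -/
abbrev WCoord (m n : ℕ) : Type :=
  JetCoord m n 3 × ℝ × (Fin m → Fin n → ℝ) × (Sym (Fin m) 2 → Fin n → ℝ)

/-- The domain of the natural chart of `W_r` induced by `e`. -/
def AdaptedChart.wrSource (e : AdaptedChart (m := m) (n := n) π) : Set (Wr m n π) :=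
  {w | w.toE ∈ e.total.source}

/-- The open set of coordinates onto which the natural chart of `W_r` maps its domain. -/
def AdaptedChart.wrTarget (e : AdaptedChart (m := m) (n := n) π) : Set (WrCoord m n) :=
  {c | c.1 ∈ e.jetTarget 3}

/-- The natural coordinates of a point of `W_r`. -/
def AdaptedChart.wrCoord (e : AdaptedChart (m := m) (n := n) π) (w : Wr m n π) : WrCoord m n :=
  (e.jetCoord 3 w.toJet, e.momentumOne w.toMomentum, e.momentumTwo w.toMomentum)

/-- The `m`-form
`p d^mx + p_α^i du^α ∧ d^{m-1}x_i + (1 / n(ij)) p_α^{1_i+1_j} du_i^α ∧ d^{m-1}x_j`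
with given momentum coordinates; `du ∧ d^{m-1}x_i` is `dx^1 ∧ ⋯ ∧ dx^m` with `dx^i` replaced by
`du`. -/
def momentumForm (p : ℝ) (p₁ : Fin m → Fin n → ℝ) (p₂ : Sym (Fin m) 2 → Fin n → ℝ) :
    (JetCoord m n 1) [⋀^Fin m]→L[ℝ] ℝ :=
  p • wedge (dx n 1)
    + ∑ i, ∑ α, p₁ i α • wedge (Function.update (dx n 1) i (du (MultiIndex.zero m 1) α))
    + ∑ i, ∑ j, ∑ α, ((1 / nfac i j) * p₂ (pairIndex i j) α) •
        wedge (Function.update (dx n 1) j (du (MultiIndex.single 0 i) α))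

variable (m n) in
/-- The unified canonical form `Θ` on `W` in natural coordinates: the pull-back of the
tautological `m`-form. -/
def Theta (w : WCoord m n) : (WCoord m n) [⋀^Fin m]→L[ℝ] ℝ :=
  (momentumForm w.2.1 w.2.2.1 w.2.2.2).compContinuousLinearMap
    ((coordProj (by omega : 1 ≤ 3)).comp (ContinuousLinearMap.fst ℝ _ _))

variable (m n) in
/-- The unified canonical form `Ω = -dΘ` on `W` in natural coordinates. -/
def Omega (w : WCoord m n) : (WCoord m n) [⋀^Fin (m + 1)]→L[ℝ] ℝ :=
  -extDeriv (Theta m n) w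

/-! ### Lagrangian densities -/

/-- The function `ρ` with `η = ρ dx^1 ∧ ⋯ ∧ dx^m` in the coordinates `(x^i)` given by `b`. -/
def volumeCoeff (η : (x : M) → (TangentSpace 𝓘(ℝ, Fin m → ℝ) x) [⋀^Fin m]→L[ℝ] ℝ)
    (b : OpenPartialHomeomorph M (Fin m → ℝ)) (y : Fin m → ℝ) : ℝ :=
  η (b.symm y) fun i =>
    mfderiv 𝓘(ℝ, Fin m → ℝ) 𝓘(ℝ, Fin m → ℝ) b.symm y (Pi.single i (1 : ℝ) : Fin m → ℝ)

/-- `η` is a smooth, nowhere vanishing `m`-form on `M`. -/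
def IsVolumeForm (η : (x : M) → (TangentSpace 𝓘(ℝ, Fin m → ℝ) x) [⋀^Fin m]→L[ℝ] ℝ) : Prop :=
  (∀ b ∈ IsManifold.maximalAtlas 𝓘(ℝ, Fin m → ℝ) ∞ M,
    ContDiffOn ℝ ∞ (volumeCoeff η b) b.target) ∧ ∀ x, η x ≠ 0

/-- `L` is a smooth function on `J^kπ`: it is smooth in natural coordinates. -/
def IsSmoothOnJets {k : ℕ} (L : JetBundle m n π k → ℝ) : Prop :=
  ∀ e : AdaptedChart (m := m) (n := n) π,
    ContDiffOn ℝ ∞ (coordExpr (e.jetSource k) (e.jetCoord k) L) (e.jetTarget k)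

/-- The function which represents the Lagrangian density `L η` in natural coordinates:
`L η = (localLagrangian) dx^1 ∧ ⋯ ∧ dx^m`. In coordinates with `η = dx^1 ∧ ⋯ ∧ dx^m` it is the
coordinate expression of `L`. -/
def AdaptedChart.localLagrangian (e : AdaptedChart (m := m) (n := n) π)
    (η : (x : M) → (TangentSpace 𝓘(ℝ, Fin m → ℝ) x) [⋀^Fin m]→L[ℝ] ℝ)
    (L : JetBundle m n π 2 → ℝ) (c : JetCoord m n 2) : ℝ :=
  volumeCoeff η e.base c.1 * coordExpr (e.jetSource 2) (e.jetCoord 2) L c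

/-- The local Hamiltonian function `Ĥ = p_α^i u_i^α + p_α^I u_I^α - L̂`. -/
def AdaptedChart.hamiltonian (e : AdaptedChart (m := m) (n := n) π)
    (η : (x : M) → (TangentSpace 𝓘(ℝ, Fin m → ℝ) x) [⋀^Fin m]→L[ℝ] ℝ)
    (L : JetBundle m n π 2 → ℝ) (w : WrCoord m n) : ℝ :=
  ∑ i, ∑ α, w.2.1 i α * w.1.2 (MultiIndex.single 2 i) α
    + ∑ I, ∑ α, w.2.2 I α * w.1.2 (MultiIndex.ofTwo 1 I) α
    - e.localLagrangian η L (coordProj (by omega) w.1)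

/-- The Hamiltonian section `ĥ : W_r → W` in natural coordinates. Its image is the submanifold on
which the coupling form `(p + p_α^i u_i^α + p_α^I u_I^α) d^mx` equals the Lagrangian density. -/
def AdaptedChart.hamiltonianSection (e : AdaptedChart (m := m) (n := n) π)
    (η : (x : M) → (TangentSpace 𝓘(ℝ, Fin m → ℝ) x) [⋀^Fin m]→L[ℝ] ℝ)
    (L : JetBundle m n π 2 → ℝ) (w : WrCoord m n) : WCoord m n :=
  (w.1, -e.hamiltonian η L w, w.2)

/-- The form `Ω_r = ĥ^*Ω` on `W_r` in natural coordinates. -/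
def AdaptedChart.OmegaR (e : AdaptedChart (m := m) (n := n) π)
    (η : (x : M) → (TangentSpace 𝓘(ℝ, Fin m → ℝ) x) [⋀^Fin m]→L[ℝ] ℝ)
    (L : JetBundle m n π 2 → ℝ) (w : WrCoord m n) :
    (WrCoord m n) [⋀^Fin (m + 1)]→L[ℝ] ℝ :=
  (Omega m n (e.hamiltonianSection η L w)).compContinuousLinearMap
    (fderiv ℝ (e.hamiltonianSection η L) w)

/-- The contraction `i(X)Ω_r` at a point, evaluated on `m` vectors. -/
def AdaptedChart.contractOmegaR (e : AdaptedChart (m := m) (n := n) π)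
    (η : (x : M) → (TangentSpace 𝓘(ℝ, Fin m → ℝ) x) [⋀^Fin m]→L[ℝ] ℝ)
    (L : JetBundle m n π 2 → ℝ) (X : WrCoord m n → WrCoord m n) (w : WrCoord m n)
    (v : Fin m → WrCoord m n) : ℝ :=
  e.OmegaR η L w (Fin.cons (X w) v)

/-! ### Solutions of the field equation -/

/-- The coordinate expression of a map `ψ : M → W_r`. -/
def AdaptedChart.wrExpr (e : AdaptedChart (m := m) (n := n) π) (ψ : M → Wr m n π) :
    (Fin m → ℝ) → WrCoord m n :=
  fun y => e.wrCoord (ψ (e.base.symm y))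

/-- The set of coordinates `(x^i)` of the points of `U` that `ψ` maps to the domain of the
natural chart. -/
def AdaptedChart.exprDomain (e : AdaptedChart (m := m) (n := n) π) (U : Set M)
    (ψ : M → Wr m n π) : Set (Fin m → ℝ) :=
  {y ∈ e.base.target | e.base.symm y ∈ U ∧ ψ (e.base.symm y) ∈ e.wrSource}

/-- `ψ` is a smooth section of `ρ_M^r : W_r → M` over the open set `U`. -/
def IsSmoothSection (U : Set M) (ψ : M → Wr m n π) : Prop :=
  (∀ x ∈ U, (ψ x).toBase = x) ∧
  ContMDiffOn 𝓘(ℝ, Fin m → ℝ) 𝓘(ℝ, (Fin m → ℝ) × (Fin n → ℝ)) ∞ (fun x => (ψ x).toE) U ∧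
  ∀ e : AdaptedChart (m := m) (n := n) π, ContDiffOn ℝ ∞ (e.wrExpr ψ) (e.exprDomain U ψ)

/-- `ψ` is holonomic over `U`: `ρ_1^r ∘ ψ = j^3φ` for `φ = π^3 ∘ ρ_1^r ∘ ψ`. -/
def IsHolonomic (U : Set M) (ψ : M → Wr m n π) : Prop :=
  ∀ x ∈ U, ∃ h : IsLocalSection π (fun y => (ψ y).toE) x,
    (ψ x).toJet = jet 3 (fun y => (ψ y).toE) x h

/-- The field equation `ψ^* i(X)Ω_r = 0` for every vector field `X`, expressed in each natural
chart. -/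
def SatisfiesFieldEquation
    (η : (x : M) → (TangentSpace 𝓘(ℝ, Fin m → ℝ) x) [⋀^Fin m]→L[ℝ] ℝ)
    (L : JetBundle m n π 2 → ℝ) (U : Set M) (ψ : M → Wr m n π) : Prop :=
  ∀ e : AdaptedChart (m := m) (n := n) π, ∀ X : WrCoord m n → WrCoord m n,
    ContDiffOn ℝ ∞ X e.wrTarget → ∀ y ∈ e.exprDomain U ψ, ∀ v : Fin m → Fin m → ℝ,
      e.contractOmegaR η L X (e.wrExpr ψ y) (fun a => fderiv ℝ (e.wrExpr ψ) y (v a)) = 0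

/-- `ψ` is a solution of the Lagrangian-Hamiltonian problem for sections over `U`. -/
def IsSolution
    (η : (x : M) → (TangentSpace 𝓘(ℝ, Fin m → ℝ) x) [⋀^Fin m]→L[ℝ] ℝ)
    (L : JetBundle m n π 2 → ℝ) (U : Set M) (ψ : M → Wr m n π) : Prop :=
  IsSmoothSection U ψ ∧ IsHolonomic U ψ ∧ SatisfiesFieldEquation η L U ψ

/-! ### Submanifolds of `W_r` -/

/-- The first constraint submanifold `W_c` of `W_r`: the points where `i(X)Ω_r` vanishes for every
`ρ_2^r`-vertical vector field `X`. -/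
def Wc (η : (x : M) → (TangentSpace 𝓘(ℝ, Fin m → ℝ) x) [⋀^Fin m]→L[ℝ] ℝ)
    (L : JetBundle m n π 2 → ℝ) : Set (Wr m n π) :=
  {w | ∀ e : AdaptedChart (m := m) (n := n) π, w ∈ e.wrSource →
    ∀ X : WrCoord m n → WrCoord m n, ContDiffOn ℝ ∞ X e.wrTarget →
      (∀ c ∈ e.wrTarget, coordProj (by omega : 1 ≤ 3) (X c).1 = 0 ∧ (X c).2 = 0) →
      ∀ v, e.contractOmegaR η L X (e.wrCoord w) v = 0}

/-- `S` is an embedded submanifold of codimension `d` of `W_r`: near each of its points it is, in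
natural coordinates, the zero set of a smooth submersion to `ℝ^d`. -/
def IsSubmanifoldOfCodim (S : Set (Wr m n π)) (d : ℕ) : Prop :=
  ∀ w ∈ S, ∀ e : AdaptedChart (m := m) (n := n) π, w ∈ e.wrSource →
    ∃ (N : Set (WrCoord m n)) (f : WrCoord m n → Fin d → ℝ),
      IsOpen N ∧ e.wrCoord w ∈ N ∧ N ⊆ e.wrTarget ∧ ContDiffOn ℝ ∞ f N ∧
      (∀ c ∈ N, Function.Surjective (fderiv ℝ f c)) ∧
      ∀ w' ∈ e.wrSource, e.wrCoord w' ∈ N → (w' ∈ S ↔ f (e.wrCoord w') = 0)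

/-- `F : J^3π → J^2π^‡` is a smooth bundle map over `J^1π`. -/
def IsBundleMap (F : JetBundle m n π 3 → RestrictedMomentumBundle m n π) : Prop :=
  (∀ z, (F z).1 = z.proj 1 (by omega)) ∧
  ∀ e : AdaptedChart (m := m) (n := n) π,
    ContDiffOn ℝ ∞
      (coordExpr (e.jetSource 3) (e.jetCoord 3)
        fun z => (e.momentumOne (F z), e.momentumTwo (F z)))
      (e.jetTarget 3)

/-- The graph of `F`, as a subset of `W_r`. -/
def graphOf (F : JetBundle m n π 3 → RestrictedMomentumBundle m n π) : Set (Wr m n π) :=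
  {w | F w.toJet = w.toMomentum}

end Bundle

end SecondOrderField

end

/-!
The point of the theorem is that the formulas of the restricted Legendre map, which involve
coordinate total derivatives, are the same in all adapted charts. This is proved by a variational
characterization instead of a computation of the coordinate change on third-order jets.

Let `Λ` be the coefficient of the Lagrangian density in an adapted chart, `f` the expression of a
section, and `p^a`, `p^{aj}` the momenta which the formulas attach to `f`. Integration by parts
(`first_variation`) shows that the first variation of `Λ` at `f` in the direction of a field `V`
with `V x = 0` is, at `x`, the divergence of the Legendre current `p^a V + p^{aj} ∂V/∂x^j`, where
`p^{aj}` is symmetric. Conversely a first-order current with symmetric symbol vanishes when its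
divergence vanishes at every `x` for all `V` with `V x = 0` (`current_unique`; test fields of the
form `(y^k - x^k)(y^l - x^l) w` and `(y^k - x^k) w`). The rows of the adjugate of a Jacobian are
divergence free (`divergence_adjugate_jacobian`, `divergence_piola`), so the Legendre current of
another chart, pulled back as a vector density, has the divergence prescribed by the same first
variation. Therefore the two currents agree (`current_transform`, `legendre_current_change`).

On the other side, the value of an `m`-form that vanishes on two vertical vectors, on one vertical
vector and `m - 1` further vectors, changes through the same adjugate (`apply_of_vertical`,
`comp_fderiv_transition_update`). So the form with the momenta given in one chart satisfies the
formulas in all charts. It belongs to `J^2π^†` because the symmetry `p^{ij} = p^{ji}` is independent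
of the chart, the adjugate of the Jacobian being a multiple of the inverse (`extendForm_mem`).
This gives the map `FL` (`exists_legendre`).

In natural coordinates `Θ` is linear in the point of `W`, so the contraction of `Ω_r` with a vector
is explicit (`fderiv_Theta`, `Omega_apply_cons`, `contractOmegaR_apply`). For `X` vertical over
`J^2π^‡` it is a combination of the functions `p^I_α - ∂L̂/∂u^α_I`, `|I| = 2`, whose vanishing
therefore describes `W_c` (`forall_contractOmegaR_eq_zero_iff`); `momentumTwo_congr` makes this
description independent of the chart. Along a solution, the equations for `X = ∂/∂u^α_I` give the
`p^I_α` on an open set, where they can be differentiated, and by holonomy those for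
`X = ∂/∂u^α_i` then become the formula for `p^i_α` (`wrExpr_eq_of_isSolution`). Finally, a set on
which some of the momenta are prescribed as smooth functions of the jet coordinates is an embedded
submanifold (`isSubmanifoldOfCodim_of_momenta`).
-/


noncomputable section

namespace SecondOrderField

/-! ### Functions smooth near a point -/

theorem minSmoothness_two_le : minSmoothness ℝ 2 ≤ (∞ : WithTop ℕ∞) := by
  simp; norm_cast

section Smooth

variable {V W Z : Type*} [NormedAddCommGroup V] [NormedSpace ℝ V]
  [NormedAddCommGroup W] [NormedSpace ℝ W] [NormedAddCommGroup Z] [NormedSpace ℝ Z]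

/-- `f` is smooth at all points of a neighbourhood of `x`. (In Mathlib `ContDiffAt ℝ ∞ f x` allows
the neighbourhood to shrink with the order of differentiability.) -/
def SmoothNear (f : V → W) (x : V) : Prop := ∀ᶠ y in 𝓝 x, ContDiffAt ℝ ∞ f y

namespace SmoothNear

variable {f g : V → W} {x : V}

theorem self (h : SmoothNear f x) : ContDiffAt ℝ ∞ f x := Filter.Eventually.self_of_nhds h

theorem eventually (h : SmoothNear f x) : ∀ᶠ y in 𝓝 x, SmoothNear f y :=
  eventually_eventually_nhds.2 h

theorem differentiableAt (h : SmoothNear f x) : DifferentiableAt ℝ f x :=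
  h.self.differentiableAt (by simp)

theorem congr (h : SmoothNear f x) (hfg : g =ᶠ[𝓝 x] f) : SmoothNear g x := by
  filter_upwards [h, hfg.eventually_nhds] with y hy hy'
  exact hy.congr_of_eventuallyEq hy'

theorem of_contDiffOn {s : Set V} (h : ContDiffOn ℝ ∞ f s) (hs : IsOpen s) (hx : x ∈ s) :
    SmoothNear f x := by
  filter_upwards [hs.mem_nhds hx] with y hy
  exact h.contDiffAt (hs.mem_nhds hy)

theorem of_contDiff (h : ContDiff ℝ ∞ f) : SmoothNear f x :=
  Filter.Eventually.of_forall fun _ => h.contDiffAt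

theorem fderiv (h : SmoothNear f x) : SmoothNear (fderiv ℝ f) x :=
  h.mono fun _ hy => hy.fderiv_right (m := ∞) (by simp)

theorem fderiv_apply (h : SmoothNear f x) (v : V) : SmoothNear (fun y => _root_.fderiv ℝ f y v) x :=
  h.fderiv.mono fun _ hy => hy.clm_apply contDiffAt_const

theorem add (hf : SmoothNear f x) (hg : SmoothNear g x) : SmoothNear (fun y => f y + g y) x := by
  filter_upwards [hf, hg] with y h1 h2 using h1.add h2

theorem const_smul (c : ℝ) (hf : SmoothNear f x) : SmoothNear (fun y => c • f y) x := by
  filter_upwards [hf] with y h1 using contDiffAt_const.smul h1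

theorem comp {k : W → Z} (hk : SmoothNear k (f x)) (hf : SmoothNear f x) :
    SmoothNear (fun y => k (f y)) x := by
  filter_upwards [hf, hf.self.continuousAt.eventually hk] with y h1 h2 using
    ContDiffAt.comp y h2 h1

theorem prodMk {k : V → Z} (hf : SmoothNear f x) (hk : SmoothNear k x) :
    SmoothNear (fun y => (f y, k y)) x := by
  filter_upwards [hf, hk] with y h1 h2 using h1.prodMk h2

end SmoothNear

end Smooth

/-! ### Iterated partial derivatives and jets of functions -/

section Partials

variable {m n : ℕ} {f g : (Fin m → ℝ) → (Fin n → ℝ)} {x : Fin m → ℝ}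

theorem partials_nil : partials [] f = f := rfl

theorem partials_cons (i : Fin m) (l : List (Fin m)) :
    partials (i :: l) f = fun y => fderiv ℝ (partials l f) y (Pi.single i 1) := rfl

theorem SmoothNear.partials (h : SmoothNear f x) (l : List (Fin m)) :
    SmoothNear (partials l f) x := by
  induction l with
  | nil => exact h
  | cons i l ih => exact ih.fderiv_apply _

theorem partials_congr (h : f =ᶠ[𝓝 x] g) (l : List (Fin m)) :
    partials l f =ᶠ[𝓝 x] partials l g := by
  induction l with
  | nil => exact h
  | cons i l ih =>
    filter_upwards [ih.eventually_nhds] with y hy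
    simp only [partials_cons, Filter.EventuallyEq.fderiv_eq hy]

theorem partials_add (hf : SmoothNear f x) (hg : SmoothNear g x) (l : List (Fin m)) :
    partials l (fun y => f y + g y) =ᶠ[𝓝 x] fun y => partials l f y + partials l g y := by
  induction l with
  | nil => rfl
  | cons i l ih =>
    filter_upwards [ih.eventually_nhds, hf.partials l, hg.partials l] with y hy h1 h2
    simp only [partials_cons, Filter.EventuallyEq.fderiv_eq hy]
    rw [fderiv_fun_add (h1.differentiableAt (by simp)) (h2.differentiableAt (by simp))]
    rfl

theorem partials_const_smul (hf : SmoothNear f x) (c : ℝ) (l : List (Fin m)) :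
    partials l (fun y => c • f y) =ᶠ[𝓝 x] fun y => c • partials l f y := by
  induction l with
  | nil => rfl
  | cons i l ih =>
    filter_upwards [ih.eventually_nhds, hf.partials l] with y hy h1
    simp only [partials_cons, Filter.EventuallyEq.fderiv_eq hy]
    rw [fderiv_fun_const_smul (h1.differentiableAt (by simp))]
    rfl

/-- Iterated partial derivatives commute. -/
theorem partials_perm (hf : SmoothNear f x) {l l' : List (Fin m)} (h : l.Perm l') :
    partials l f =ᶠ[𝓝 x] partials l' f := by
  induction h with
  | nil => rfl
  | cons i _ ih =>
    filter_upwards [ih.eventually_nhds] with y hy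
    simp only [partials_cons, Filter.EventuallyEq.fderiv_eq hy]
  | swap i j l =>
    filter_upwards [hf.partials l] with y hy
    have h2 : DifferentiableAt ℝ (fderiv ℝ (partials l f)) y :=
      (hy.fderiv_right (m := ∞) (by simp)).differentiableAt (by simp)
    simp only [partials_cons]
    rw [fderiv_clm_apply h2 (differentiableAt_const _),
      fderiv_clm_apply h2 (differentiableAt_const _)]
    simpa using (hy.isSymmSndFDerivAt minSmoothness_two_le).eq _ _
  | trans _ _ ih1 ih2 => exact ih1.trans ih2

theorem partials_eq_iteratedFDeriv (hf : SmoothNear f x) (l : List (Fin m)) :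
    partials l f =ᶠ[𝓝 x] fun y =>
      iteratedFDeriv ℝ l.length f y fun a => (Pi.single (l.get a) 1 : Fin m → ℝ) := by
  induction l with
  | nil => exact Filter.Eventually.of_forall fun y => by simp [partials_nil]
  | cons i l ih =>
    filter_upwards [ih.eventually_nhds, hf] with y hy h1
    simp only [partials_cons, Filter.EventuallyEq.fderiv_eq hy]
    have h2 : DifferentiableAt ℝ (iteratedFDeriv ℝ l.length f) y :=
      h1.differentiableAt_iteratedFDeriv (by exact_mod_cast WithTop.coe_lt_top _)
    change _ = iteratedFDeriv ℝ (l.length + 1) f y _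
    rw [iteratedFDeriv_succ_apply_left]
    have h3 := (((ContinuousMultilinearMap.apply ℝ (fun _ : Fin l.length => (Fin m → ℝ)) (Fin n → ℝ)
      (fun a => (Pi.single (l.get a) 1 : Fin m → ℝ))).hasFDerivAt).comp y h2.hasFDerivAt).fderiv
    have h4 : (fun y => (iteratedFDeriv ℝ l.length f y)
        fun a => (Pi.single (l.get a) 1 : Fin m → ℝ)) =
      (ContinuousMultilinearMap.apply ℝ (fun _ : Fin l.length => (Fin m → ℝ)) (Fin n → ℝ)
      (fun a => (Pi.single (l.get a) 1 : Fin m → ℝ))) ∘ (iteratedFDeriv ℝ l.length f) := rfl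
    rw [h4, h3]
    rfl

/-- `f` and `g` have the same partial derivatives of order at most `k` at `x`. -/
def SameJet (k : ℕ) (f g : (Fin m → ℝ) → (Fin n → ℝ)) (x : Fin m → ℝ) : Prop :=
  ∀ l : List (Fin m), l.length ≤ k → partials l f x = partials l g x

theorem sameJet_iff_iteratedFDeriv (hf : SmoothNear f x) (hg : SmoothNear g x) (k : ℕ) :
    SameJet k f g x ↔ ∀ r ≤ k, iteratedFDeriv ℝ r f x = iteratedFDeriv ℝ r g x := by
  constructor
  · intro h r hr
    apply ContinuousMultilinearMap.toMultilinearMap_injective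
    apply Module.Basis.ext_multilinear (fun _ : Fin r => Pi.basisFun ℝ (Fin m))
    intro s
    have h1 := h (List.ofFn s) (by simpa using hr)
    beta_reduce at h1
    rw [(partials_eq_iteratedFDeriv hf _).self_of_nhds,
      (partials_eq_iteratedFDeriv hg _).self_of_nhds] at h1
    beta_reduce at h1
    have key : ∀ (q : ℕ) (hq : q = r) (F : (Fin m → ℝ) → (Fin n → ℝ)) (t : Fin q → Fin m)
        (_ : ∀ a, t a = s (Fin.cast hq a)),
        iteratedFDeriv ℝ q F x (fun a => (Pi.single (t a) 1 : Fin m → ℝ)) =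
          iteratedFDeriv ℝ r F x (fun a => (Pi.single (s a) 1 : Fin m → ℝ)) := by
      rintro q rfl F t ht
      congr 1
      funext a
      rw [ht]
      rfl
    rw [key _ (by simp) f _ (by intro a; simp [Fin.cast]),
      key _ (by simp) g _ (by intro a; simp [Fin.cast])] at h1
    simpa [Pi.basisFun_apply] using h1
  · intro h l hl
    rw [(partials_eq_iteratedFDeriv hf _).self_of_nhds,
      (partials_eq_iteratedFDeriv hg _).self_of_nhds]
    beta_reduce
    rw [h _ hl]

/-- The chain rule of all orders: the `k`-jet of `y ↦ F (g y, f (g y))` depends on `f` only through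
its `k`-jet. -/
theorem SameJet.comp {f₁ f₂ : (Fin m → ℝ) → (Fin n → ℝ)} {g : (Fin m → ℝ) → (Fin m → ℝ)}
    {F : (Fin m → ℝ) × (Fin n → ℝ) → (Fin n → ℝ)} {y : Fin m → ℝ} {k : ℕ}
    (hf₁ : SmoothNear f₁ (g y)) (hf₂ : SmoothNear f₂ (g y)) (hg : SmoothNear g y)
    (hF : SmoothNear F (g y, f₁ (g y))) (h : SameJet k f₁ f₂ (g y)) :
    SameJet k (fun z => F (g z, f₁ (g z))) (fun z => F (g z, f₂ (g z))) y := by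
  have h0 : f₁ (g y) = f₂ (g y) := h [] (by simp)
  have taylor_congr : ∀ {A B C : Type} [NormedAddCommGroup A] [NormedSpace ℝ A]
      [NormedAddCommGroup B] [NormedSpace ℝ B] [NormedAddCommGroup C] [NormedSpace ℝ C]
      (q q' : FormalMultilinearSeries ℝ B C) (p p' : FormalMultilinearSeries ℝ A B) (r : ℕ),
      (∀ i ≤ r, q i = q' i) → (∀ i ≤ r, p i = p' i) → q.taylorComp p r = q'.taylorComp p' r := by
    intro A B C _ _ _ _ _ _ q q' p p' r hq hp
    refine Finset.sum_congr rfl fun c _ => ?_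
    unfold FormalMultilinearSeries.compAlongOrderedFinpartition
    rw [hq _ c.length_le]
    congr 1
    funext a
    exact hp _ (c.partSize_le a)
  have hi : SmoothNear (fun z : Fin m → ℝ => z) (g y) := .of_contDiff contDiff_id
  have s1 : SmoothNear (fun z => F (z, f₁ z)) (g y) := SmoothNear.comp hF (hi.prodMk hf₁)
  have s2 : SmoothNear (fun z => F (z, f₂ z)) (g y) :=
    SmoothNear.comp (f := fun z => (z, f₂ z)) (by rw [← h0]; exact hF) (hi.prodMk hf₂)
  rw [sameJet_iff_iteratedFDeriv hf₁ hf₂] at h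
  have hle : ∀ r : ℕ, (r : WithTop ℕ∞) ≤ ∞ := fun r => by norm_cast; exact le_top
  have h2 : ∀ r ≤ k, iteratedFDeriv ℝ r (fun z => (z, f₁ z)) (g y) =
      iteratedFDeriv ℝ r (fun z => (z, f₂ z)) (g y) := by
    intro r hr
    rw [iteratedFDeriv_prodMk hi.self hf₁.self (hle r), iteratedFDeriv_prodMk hi.self hf₂.self (hle r),
      h r hr]
  have h3 : ∀ r ≤ k, iteratedFDeriv ℝ r (fun z => F (z, f₁ z)) (g y) =
      iteratedFDeriv ℝ r (fun z => F (z, f₂ z)) (g y) := by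
    intro r hr
    have e1 := iteratedFDeriv_comp (g := F) (f := fun z => (z, f₁ z)) hF.self
      (hi.prodMk hf₁).self (hle r)
    have e2 := iteratedFDeriv_comp (g := F) (f := fun z => (z, f₂ z)) (by rw [← h0]; exact hF.self)
      (hi.prodMk hf₂).self (hle r)
    refine e1.trans (Eq.trans ?_ e2.symm)
    rw [← h0]
    exact taylor_congr _ _ _ _ _ (fun i _ => rfl) fun i hi => h2 i (hi.trans hr)
  rw [sameJet_iff_iteratedFDeriv (SmoothNear.comp s1 hg) (SmoothNear.comp s2 hg)]
  intro r hr
  have e1 := iteratedFDeriv_comp (g := fun z => F (z, f₁ z)) (f := g) s1.self hg.self (hle r)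
  have e2 := iteratedFDeriv_comp (g := fun z => F (z, f₂ z)) (f := g) s2.self hg.self (hle r)
  refine e1.trans (Eq.trans ?_ e2.symm)
  exact taylor_congr _ _ _ _ _ (fun i hi => h3 i (hi.trans hr)) fun i _ => rfl

end Partials

/-! ### Prolongations -/

section Prolong

variable {m n : ℕ} {f g : (Fin m → ℝ) → (Fin n → ℝ)} {x : Fin m → ℝ}

/-- The coordinates `(x, ∂_I f(x))`, `|I| ≤ k`, of the `k`-th prolongation of `f` at `x`. -/
def prolong (k : ℕ) (f : (Fin m → ℝ) → (Fin n → ℝ)) (x : Fin m → ℝ) : JetCoord m n k :=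
  (x, fun I => partials I.1.sort f x)

theorem prolong_zero (k : ℕ) : (prolong k f x).2 (MultiIndex.zero m k) = f x := by
  simp [prolong, MultiIndex.zero, partials_nil]

theorem prolong_single (k : ℕ) (i : Fin m) :
    (prolong (k + 1) f x).2 (MultiIndex.single k i) = fderiv ℝ f x (Pi.single i 1) := by
  simp [prolong, MultiIndex.single, partials_cons, partials_nil]

theorem coordProj_prolong {r k : ℕ} (h : r ≤ k) : coordProj h (prolong k f x) = prolong r f x := rfl

theorem prolong_congr (h : f =ᶠ[𝓝 x] g) (k : ℕ) : prolong k f x = prolong k g x := by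
  refine Prod.ext rfl (funext fun I => ?_)
  exact (partials_congr h _).self_of_nhds

theorem prolong_eq_iff_sameJet (hf : SmoothNear f x) (hg : SmoothNear g x) (k : ℕ) :
    prolong k f x = prolong k g x ↔ SameJet k f g x := by
  constructor
  · intro h l hl
    have h1 := congrFun (congrArg Prod.snd h) (⟨(l : Multiset (Fin m)), by simpa using hl⟩ :
      MultiIndex m k)
    have hp : l.Perm (l : Multiset (Fin m)).sort := by
      rw [← Multiset.coe_eq_coe, Multiset.sort_eq]
    rw [(partials_perm hf hp).self_of_nhds, (partials_perm hg hp).self_of_nhds]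
    exact h1
  · intro h
    refine Prod.ext rfl (funext fun I => h _ ?_)
    rw [Multiset.length_sort]
    exact I.2

/-- The prolongation of a sum, with a scalar factor, in the fibre direction. -/
theorem prolong_add_smul (hf : SmoothNear f x) (hg : SmoothNear g x) (k : ℕ) (t : ℝ) :
    prolong k (fun y => f y + t • g y) x = prolong k f x + t • (0, (prolong k g x).2) := by
  refine Prod.ext (by simp [prolong]) (funext fun I => ?_)
  change partials _ _ _ = partials _ _ _ + t • partials _ _ _
  rw [(partials_add hf (hg.const_smul t) _).self_of_nhds]
  beta_reduce
  rw [(partials_const_smul hg t _).self_of_nhds]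

theorem partials_sort_cons (hf : SmoothNear f x) (i : Fin m) (I : Multiset (Fin m)) :
    partials (i ::ₘ I).sort f x = fderiv ℝ (partials I.sort f) x (Pi.single i 1) := by
  have hp : (i ::ₘ I).sort.Perm (i :: I.sort) := by
    rw [← Multiset.coe_eq_coe, Multiset.sort_eq, ← Multiset.cons_coe, Multiset.sort_eq]
  rw [(partials_perm hf hp).self_of_nhds]
  rfl

theorem SmoothNear.prolong (hf : SmoothNear f x) (k : ℕ) : SmoothNear (prolong k f) x := by
  have h : ∀ᶠ y in 𝓝 x, ∀ I : MultiIndex m k, ContDiffAt ℝ ∞ (SecondOrderField.partials I.1.sort f) y :=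
    Filter.eventually_all.2 fun I => hf.partials _
  filter_upwards [h] with y hy
  exact contDiffAt_id.prodMk (contDiffAt_pi.2 hy)

/-- The tangent vectors of a prolonged section are the holonomic lifts. -/
theorem fderiv_prolong (hf : SmoothNear f x) (k : ℕ) (j : Fin m) :
    fderiv ℝ (prolong k f) x (Pi.single j 1) = holonomicLift (prolong (k + 1) f x) j := by
  have hd : ∀ I : MultiIndex m k, DifferentiableAt ℝ (partials I.1.sort f) x :=
    fun I => (hf.partials _).differentiableAt
  have h : HasFDerivAt (prolong k f) ((ContinuousLinearMap.id ℝ _).prod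
      (ContinuousLinearMap.pi fun I : MultiIndex m k => fderiv ℝ (partials I.1.sort f) x)) x :=
    (hasFDerivAt_id x).prodMk (hasFDerivAt_pi.2 fun I => (hd I).hasFDerivAt)
  rw [h.fderiv]
  refine Prod.ext rfl (funext fun I => ?_)
  exact (partials_sort_cons hf j I.1).symm

/-- The total derivative along a prolonged section is the partial derivative of the pulled back
function. -/
theorem totalDeriv_prolong {k : ℕ} {G : JetCoord m n k → ℝ} (hf : SmoothNear f x)
    (hG : DifferentiableAt ℝ G (prolong k f x)) (j : Fin m) :
    totalDeriv j G (prolong (k + 1) f x) =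
      fderiv ℝ (fun y => G (prolong k f y)) x (Pi.single j 1) := by
  have h := (hG.hasFDerivAt.comp x (hf.prolong k).differentiableAt.hasFDerivAt).fderiv
  have h' : (fun y => G (prolong k f y)) = G ∘ prolong k f := rfl
  rw [h', h, ContinuousLinearMap.comp_apply, fderiv_prolong hf]
  rfl

end Prolong

/-! ### Functions with prescribed jet -/

section Taylor

variable {m n : ℕ}

/-- The homogeneous polynomial of degree `r` whose partial derivative with respect to the
multi-index `I`, `|I| = r`, is the constant `a I`. -/
def homogeneous : ℕ → (Multiset (Fin m) → (Fin n → ℝ)) → (Fin m → ℝ) → (Fin n → ℝ)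
  | 0, a, _ => a 0
  | r + 1, a, y => (1 / (r + 1 : ℝ)) • ∑ i, y i • homogeneous r (fun I => a (i ::ₘ I)) y

theorem contDiff_homogeneous (r : ℕ) (a : Multiset (Fin m) → (Fin n → ℝ)) :
    ContDiff ℝ ∞ (homogeneous r a) := by
  induction r generalizing a with
  | zero => exact contDiff_const
  | succ r ih =>
    change ContDiff ℝ ∞ fun y => (1 / (r + 1 : ℝ)) • ∑ i, y i • homogeneous r (fun I => a (i ::ₘ I)) y
    exact ContDiff.const_smul (1 / (r + 1 : ℝ)) (ContDiff.sum fun i _ => (contDiff_apply ℝ ℝ i).smul (ih _))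

theorem fderiv_homogeneous (r : ℕ) (a : Multiset (Fin m) → (Fin n → ℝ)) (y : Fin m → ℝ)
    (j : Fin m) : fderiv ℝ (homogeneous (r + 1) a) y (Pi.single j 1) =
      homogeneous r (fun I => a (j ::ₘ I)) y := by
  induction r generalizing a with
  | zero =>
    have h : homogeneous 1 a = fun y => ∑ i, y i • a {i} := by
      funext y; simp [homogeneous]
    have h' : HasFDerivAt (homogeneous 1 a) (∑ i, (ContinuousLinearMap.proj (R := ℝ) (φ := fun _ : Fin m => ℝ) i).smulRight
        (a {i})) y := by
      rw [h]
      exact HasFDerivAt.fun_sum fun i _ => (hasFDerivAt_apply i y).smul_const _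
    rw [h'.fderiv]
    simp [homogeneous, Pi.single_apply]
  | succ r ih =>
    have hd : ∀ i, HasFDerivAt (homogeneous (r + 1) fun I => a (i ::ₘ I))
        (fderiv ℝ (homogeneous (r + 1) fun I => a (i ::ₘ I)) y) y := fun i =>
      ((contDiff_homogeneous _ _).differentiable (by simp) y).hasFDerivAt
    have h' : HasFDerivAt (homogeneous (r + 2) a) ((1 / ((r + 1 : ℕ) + 1 : ℝ)) • ∑ i, (y i • fderiv ℝ (homogeneous (r + 1) fun I => a (i ::ₘ I)) y +
          (ContinuousLinearMap.proj (R := ℝ) (φ := fun _ : Fin m => ℝ) i).smulRight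
        (homogeneous (r + 1) (fun I => a (i ::ₘ I)) y))) y := by
      exact (HasFDerivAt.fun_sum fun i _ =>
        (hasFDerivAt_apply (𝕜 := ℝ) i y).fun_smul (hd i)).fun_const_smul (1 / ((r + 1 : ℕ) + 1 : ℝ))
    rw [h'.fderiv]
    have key : ∑ i, y i • homogeneous r (fun I => a (i ::ₘ j ::ₘ I)) y =
        (r + 1 : ℝ) • homogeneous (r + 1) (fun I => a (j ::ₘ I)) y := by
      rw [homogeneous, smul_smul, mul_one_div_cancel (by positivity), one_smul]
      simp only [Multiset.cons_swap j]
    simp only [_root_.smul_apply, _root_.sum_apply,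
      _root_.add_apply, ih, ContinuousLinearMap.smulRight_apply,
      ContinuousLinearMap.proj_apply, Finset.sum_add_distrib, key]
    simp only [Pi.single_apply, ite_smul, one_smul, zero_smul, Finset.sum_ite_eq', Finset.mem_univ,
      if_true]
    rw [show ∀ w : Fin n → ℝ, (r + 1 : ℝ) • w + w = (r + 1 + 1 : ℝ) • w from
      fun w => by rw [add_smul (r + 1 : ℝ), one_smul], smul_smul]
    push_cast
    rw [one_div_mul_cancel (by positivity), one_smul]

/-- The polynomial of degree at most `k` in `y - x` with prescribed partial derivatives at `x`. -/
def taylorPoly (k : ℕ) (a : Multiset (Fin m) → (Fin n → ℝ)) (x y : Fin m → ℝ) : Fin n → ℝ :=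
  ∑ r ∈ Finset.range (k + 1), homogeneous r a (y - x)

theorem contDiff_taylorPoly (k : ℕ) (a : Multiset (Fin m) → (Fin n → ℝ)) (x : Fin m → ℝ) :
    ContDiff ℝ ∞ (taylorPoly k a x) :=
  ContDiff.sum fun r _ => (contDiff_homogeneous r a).comp (contDiff_id.sub contDiff_const)

theorem taylorPoly_self (k : ℕ) (a : Multiset (Fin m) → (Fin n → ℝ)) (x : Fin m → ℝ) :
    taylorPoly k a x x = a 0 := by
  rw [taylorPoly, Finset.sum_range_succ', Finset.sum_eq_zero]
  · simp [homogeneous]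
  · intro r _
    simp [homogeneous]

theorem fderiv_taylorPoly (k : ℕ) (a : Multiset (Fin m) → (Fin n → ℝ)) (x y : Fin m → ℝ)
    (j : Fin m) : fderiv ℝ (taylorPoly (k + 1) a x) y (Pi.single j 1) =
      taylorPoly k (fun I => a (j ::ₘ I)) x y := by
  have hd : ∀ r, HasFDerivAt (fun y => homogeneous r a (y - x))
      (fderiv ℝ (homogeneous r a) (y - x)) y := fun r => by
    have h := ((contDiff_homogeneous r a).differentiable (by simp) (y - x)).hasFDerivAt.comp y
      ((hasFDerivAt_id y).sub_const x)
    simpa using h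
  have h : HasFDerivAt (taylorPoly (k + 1) a x)
      (∑ r ∈ Finset.range (k + 1 + 1), fderiv ℝ (homogeneous r a) (y - x)) y :=
    HasFDerivAt.fun_sum fun r _ => hd r
  have h0 : fderiv ℝ (homogeneous 0 a) (y - x) = 0 := by
    have : homogeneous 0 a = fun _ => a 0 := rfl
    rw [this]; simp
  rw [h.fderiv, _root_.sum_apply, Finset.sum_range_succ', h0]
  simp [fderiv_homogeneous, taylorPoly]

theorem partials_taylorPoly (l : List (Fin m)) (k : ℕ) (a : Multiset (Fin m) → (Fin n → ℝ))
    (x : Fin m → ℝ) : partials l (taylorPoly (k + l.length) a x) =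
      taylorPoly k (fun I => a ((l : Multiset (Fin m)) + I)) x := by
  induction l generalizing k with
  | nil => simp [partials_nil]
  | cons i l ih =>
    have h := ih (k + 1)
    rw [show k + 1 + l.length = k + (i :: l).length by simp; omega] at h
    funext y
    rw [partials_cons, h]
    beta_reduce
    rw [fderiv_taylorPoly]
    simp [← Multiset.cons_coe]

/-- Every point of the coordinate space of `k`-jets is the prolongation of a smooth function. -/
theorem exists_prolong_eq {k : ℕ} (c : JetCoord m n k) :
    ∃ f : (Fin m → ℝ) → (Fin n → ℝ), ContDiff ℝ ∞ f ∧ prolong k f c.1 = c := by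
  classical
  refine ⟨taylorPoly k (fun I => if h : I.card ≤ k then c.2 ⟨I, h⟩ else 0) c.1,
    contDiff_taylorPoly _ _ _, Prod.ext rfl (funext fun I => ?_)⟩
  have h := partials_taylorPoly I.1.sort (k - I.1.card)
    (fun I => if h : I.card ≤ k then c.2 ⟨I, h⟩ else 0) c.1
  rw [Multiset.length_sort, Nat.sub_add_cancel I.2] at h
  change partials _ _ _ = _
  rw [h, taylorPoly_self]
  simp [I.2]

end Taylor

/-! ### Variations of prolongations -/

section Variation

variable {m n : ℕ} {f : ℝ → (Fin m → ℝ) → (Fin n → ℝ)} {x : Fin m → ℝ}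

theorem smoothNear_partials_family (h : SmoothNear (fun p : ℝ × (Fin m → ℝ) => f p.1 p.2) (0, x))
    (l : List (Fin m)) :
    SmoothNear (fun p : ℝ × (Fin m → ℝ) => partials l (f p.1) p.2) (0, x) ∧
      ∀ i, (fun p : ℝ × (Fin m → ℝ) => partials (i :: l) (f p.1) p.2) =ᶠ[𝓝 (0, x)]
        fun p => fderiv ℝ (fun p : ℝ × (Fin m → ℝ) => partials l (f p.1) p.2) p
          (0, Pi.single i 1) := by
  have step : ∀ l, SmoothNear (fun p : ℝ × (Fin m → ℝ) => partials l (f p.1) p.2) (0, x) →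
      ∀ i, (fun p : ℝ × (Fin m → ℝ) => partials (i :: l) (f p.1) p.2) =ᶠ[𝓝 (0, x)]
        fun p => fderiv ℝ (fun p : ℝ × (Fin m → ℝ) => partials l (f p.1) p.2) p
          (0, Pi.single i 1) := by
    intro l hl i
    filter_upwards [hl] with p hp
    have h1 : HasFDerivAt (partials l (f p.1)) _ p.2 :=
      (hp.differentiableAt (by simp)).hasFDerivAt.comp
        (f := fun z => (p.1, z)) p.2 (hasFDerivAt_prodMk_right p.1 p.2)
    rw [partials_cons]
    beta_reduce
    rw [h1.fderiv]
    simp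
  induction l with
  | nil => exact ⟨h, step [] h⟩
  | cons i l ih =>
    have h2 := (ih.1.fderiv_apply (0, Pi.single i 1)).congr (ih.2 i)
    exact ⟨h2, step _ h2⟩

/-- The derivative of a family of functions with respect to the parameter commutes with iterated
partial derivatives. -/
theorem partials_variation (h : SmoothNear (fun p : ℝ × (Fin m → ℝ) => f p.1 p.2) (0, x))
    (l : List (Fin m)) :
    ∀ᶠ y in 𝓝 x,
      fderiv ℝ (fun p : ℝ × (Fin m → ℝ) => partials l (f p.1) p.2) (0, y) (1, 0) =
        partials l (fun y => fderiv ℝ (fun p : ℝ × (Fin m → ℝ) => f p.1 p.2) (0, y) (1, 0)) y := by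
  have hc : Filter.Tendsto (fun y : Fin m → ℝ => ((0 : ℝ), y)) (𝓝 x) (𝓝 (0, x)) :=
    (Continuous.prodMk_right (0 : ℝ)).tendsto x
  induction l with
  | nil => exact Filter.Eventually.of_forall fun y => rfl
  | cons i l ih =>
    have hs := smoothNear_partials_family h l
    filter_upwards [ih.eventually_nhds, hc.eventually hs.1, hc.eventually (hs.2 i).eventually_nhds]
      with y h1 h2 h3
    set Φ := fun p : ℝ × (Fin m → ℝ) => partials l (f p.1) p.2 with hΦ
    have hd : DifferentiableAt ℝ (fderiv ℝ Φ) (0, y) :=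
      (h2.fderiv_right (m := ∞) (by simp)).differentiableAt (by simp)
    rw [Filter.EventuallyEq.fderiv_eq h3, partials_cons]
    beta_reduce
    rw [← Filter.EventuallyEq.fderiv_eq h1]
    have e2 : HasFDerivAt (fun z => fderiv ℝ Φ (0, z) (1, 0)) _ y :=
      (hd.clm_apply (differentiableAt_const ((1 : ℝ), (0 : Fin m → ℝ)))).hasFDerivAt.comp
        (f := fun z => ((0 : ℝ), z)) y (hasFDerivAt_prodMk_right (0 : ℝ) y)
    rw [e2.fderiv, ContinuousLinearMap.comp_apply, fderiv_clm_apply hd (differentiableAt_const _),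
      fderiv_clm_apply hd (differentiableAt_const _)]
    simpa using (h2.isSymmSndFDerivAt minSmoothness_two_le).eq _ _

/-- The derivative of the prolongations of a family of functions with respect to the parameter is
the prolongation of the variation field. -/
theorem hasDerivAt_prolong_family
    (h : SmoothNear (fun p : ℝ × (Fin m → ℝ) => f p.1 p.2) (0, x)) (k : ℕ) :
    HasDerivAt (fun t => prolong k (f t) x)
      (0, (prolong k (fun y => fderiv ℝ (fun p : ℝ × (Fin m → ℝ) => f p.1 p.2) (0, y) (1, 0)) x).2)
      0 := by
  refine (hasDerivAt_const (0 : ℝ) x).prodMk (hasDerivAt_pi.2 fun I => ?_)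
  have h1 := (partials_variation h I.1.sort).self_of_nhds
  have h2 := ((smoothNear_partials_family h I.1.sort).1.differentiableAt.hasFDerivAt.comp_hasDerivAt
    (0 : ℝ) ((hasDerivAt_id (0 : ℝ)).prodMk (hasDerivAt_const (0 : ℝ) x)))
  change HasDerivAt _ (partials _ _ _) _
  rw [← h1]
  exact h2

end Variation

/-! ### Operations on functions smooth near a point -/

section Smooth

variable {V W Z : Type*} [NormedAddCommGroup V] [NormedSpace ℝ V]
  [NormedAddCommGroup W] [NormedSpace ℝ W] [NormedAddCommGroup Z] [NormedSpace ℝ Z] {x : V}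

namespace SmoothNear

theorem sub {f g : V → W} (hf : SmoothNear f x) (hg : SmoothNear g x) :
    SmoothNear (fun y => f y - g y) x := by
  filter_upwards [hf, hg] with y h1 h2 using h1.sub h2

theorem smul {c : V → ℝ} {f : V → W} (hc : SmoothNear c x) (hf : SmoothNear f x) :
    SmoothNear (fun y => c y • f y) x := by
  filter_upwards [hc, hf] with y h1 h2 using h1.smul h2

theorem mul {c f : V → ℝ} (hc : SmoothNear c x) (hf : SmoothNear f x) :
    SmoothNear (fun y => c y * f y) x := hc.smul hf

theorem sum {ι : Type*} [Fintype ι] {f : ι → V → W} (hf : ∀ i, SmoothNear (f i) x) :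
    SmoothNear (fun y => ∑ i, f i y) x := by
  filter_upwards [Filter.eventually_all.2 hf] with y h using ContDiffAt.sum fun i _ => h i

theorem clm_comp {A : V → W →L[ℝ] Z} {Y : Type*} [NormedAddCommGroup Y] [NormedSpace ℝ Y]
    {B : V → Y →L[ℝ] W} (hA : SmoothNear A x) (hB : SmoothNear B x) :
    SmoothNear (fun y => (A y).comp (B y)) x := by
  filter_upwards [hA, hB] with y h1 h2 using h1.clm_comp h2

theorem clm_apply {A : V → W →L[ℝ] Z} {f : V → W} (hA : SmoothNear A x) (hf : SmoothNear f x) :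
    SmoothNear (fun y => A y (f y)) x := by
  filter_upwards [hA, hf] with y h1 h2 using h1.clm_apply h2

theorem const (c : W) : SmoothNear (fun _ : V => c) x := .of_contDiff contDiff_const

theorem id : SmoothNear (fun y : V => y) x := .of_contDiff contDiff_id

theorem apply {ι : Type*} [Fintype ι] {f : V → ι → W} (hf : SmoothNear f x) (i : ι) :
    SmoothNear (fun y => f y i) x := by
  filter_upwards [hf] with y h using contDiffAt_pi.1 h i

theorem pi {ι : Type*} [Fintype ι] {f : V → ι → W} (hf : ∀ i, SmoothNear (fun y => f y i) x) :
    SmoothNear f x := by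
  filter_upwards [Filter.eventually_all.2 hf] with y h using contDiffAt_pi.2 h

end SmoothNear

end Smooth

/-! ### The Piola identity -/

section Piola

variable {m : ℕ}

/-- The determinant as an alternating form in the columns of a square matrix. -/
def detForm (m : ℕ) : (Fin m → ℝ) [⋀^Fin m]→L[ℝ] ℝ :=
  { (Matrix.detRowAlternating : (Fin m → ℝ) [⋀^Fin m]→ₗ[ℝ] ℝ) with
    cont := by
      change Continuous fun A : Matrix (Fin m) (Fin m) ℝ => A.det
      exact continuous_id.matrix_det }

/-- The Jacobian matrix of a map of `ℝ^m` to itself. -/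
def jacobian (h : (Fin m → ℝ) → (Fin m → ℝ)) (x : Fin m → ℝ) : Matrix (Fin m) (Fin m) ℝ :=
  Matrix.of fun i j => fderiv ℝ h x (Pi.single j 1) i

theorem adjugate_apply_eq_detForm (A : Matrix (Fin m) (Fin m) ℝ) (a i : Fin m) :
    A.adjugate a i = detForm m (Function.update (fun b r => A r b) a (Pi.single i 1)) := by
  have h : A.adjugate a i = A.cramer (Pi.single i 1) a := by
    rw [Matrix.cramer_eq_adjugate_mulVec]; simp
  rw [h, Matrix.cramer_apply, ← Matrix.det_transpose, ← Matrix.updateRow_transpose]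
  rfl

theorem adjugate_jacobian_apply (h : (Fin m → ℝ) → (Fin m → ℝ)) (x : Fin m → ℝ) (a i : Fin m) :
    (jacobian h x).adjugate a i =
      detForm m (Function.update (fun b => fderiv ℝ h x (Pi.single b 1)) a (Pi.single i 1)) :=
  adjugate_apply_eq_detForm _ a i

/-- The divergence `∑_a ∂R^a/∂x^a`. -/
def divergence (R : (Fin m → ℝ) → Fin m → ℝ) (x : Fin m → ℝ) : ℝ :=
  ∑ a, fderiv ℝ (fun y => R y a) x (Pi.single a 1)

theorem divergence_congr {R S : (Fin m → ℝ) → Fin m → ℝ} {x : Fin m → ℝ} (h : R =ᶠ[𝓝 x] S) :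
    divergence R x = divergence S x := by
  refine Finset.sum_congr rfl fun a _ => ?_
  have h' : (fun y => R y a) =ᶠ[𝓝 x] fun y => S y a := h.mono fun y hy => congrFun hy a
  rw [h'.fderiv_eq]

variable {h : (Fin m → ℝ) → (Fin m → ℝ)} {x : Fin m → ℝ}

theorem SmoothNear.adjugate_jacobian (hh : SmoothNear h x) (a i : Fin m) :
    SmoothNear (fun y => (jacobian h y).adjugate a i) x := by
  simp only [adjugate_jacobian_apply]
  refine SmoothNear.comp (k := detForm m) (.of_contDiff (detForm m).contDiff) (.pi fun b => ?_)
  by_cases hb : b = a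
  · subst hb
    simpa only [Function.update_self] using SmoothNear.const (Pi.single i (1 : ℝ) : Fin m → ℝ)
  · simpa only [Function.update_of_ne hb] using hh.fderiv_apply (Pi.single b 1)

/-- The rows of the adjugate of a Jacobian matrix are divergence free. -/
theorem divergence_adjugate_jacobian (hh : SmoothNear h x) (i : Fin m) :
    divergence (fun y a => (jacobian h y).adjugate a i) x = 0 := by
  set cols : (Fin m → ℝ) → Fin m → (Fin m → ℝ) := fun y b => fderiv ℝ h y (Pi.single b 1) with hcols
  have hd : DifferentiableAt ℝ (fderiv ℝ h) x := hh.fderiv.differentiableAt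
  set w : Fin m → Fin m → (Fin m → ℝ) := fun a b =>
    fderiv ℝ (fderiv ℝ h) x (Pi.single a 1) (Pi.single b 1) with hw
  have hws : ∀ a b, w a b = w b a := fun a b =>
    (hh.self.isSymmSndFDerivAt minSmoothness_two_le).eq _ _
  -- the summand of `∂/∂x^a adj(J)^a_i` in which the column `b` is differentiated; as the second
  -- derivatives `w a b` are symmetric, exchanging `a` and `b` only swaps two columns
  set T : Fin m → Fin m → ℝ := fun a b => if b = a then 0 else
    detForm m (Function.update (Function.update (cols x) a (Pi.single i 1)) b (w a b)) with hT
  have hTs : ∀ a b, T a b = -T b a := by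
    intro a b
    by_cases hab : a = b
    · subst hab; simp [hT]
    · have e : Function.update (Function.update (cols x) b (Pi.single i 1)) a (w b a) =
          Function.update (Function.update (cols x) a (Pi.single i 1)) b (w a b) ∘
            Equiv.swap a b := by
        funext c
        by_cases hca : c = a
        · subst hca; simp [hws c b]
        · by_cases hcb : c = b
          · subst hcb; simp [hab, hca]
          · simp [hca, hcb, Equiv.swap_apply_of_ne_of_ne hca hcb]
      simp only [hT, hab, Ne.symm hab, if_false, e]
      rw [show ∀ v, detForm m (v ∘ Equiv.swap a b) = -detForm m v from
        fun v => (detForm m).toAlternatingMap.map_swap v hab, neg_neg]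
  have hterm : ∀ a, fderiv ℝ (fun y => (jacobian h y).adjugate a i) x (Pi.single a 1) =
      ∑ b, T a b := by
    intro a
    simp only [adjugate_jacobian_apply]
    have hu : HasFDerivAt (fun y => Function.update (fun b => fderiv ℝ h y (Pi.single b 1)) a (Pi.single i 1))
        (ContinuousLinearMap.pi fun b => if b = a then 0 else
          ((ContinuousLinearMap.apply ℝ (Fin m → ℝ) (Pi.single b 1 : Fin m → ℝ)).comp
            (fderiv ℝ (fderiv ℝ h) x))) x := by
      refine hasFDerivAt_pi.2 fun b => ?_
      by_cases hb : b = a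
      · subst hb
        simpa only [Function.update_self, if_true] using
          hasFDerivAt_const (Pi.single i (1 : ℝ) : Fin m → ℝ) x
      · simp only [hb, if_false, Function.update_of_ne hb]
        exact (ContinuousLinearMap.apply ℝ (Fin m → ℝ)
          (Pi.single b 1 : Fin m → ℝ)).hasFDerivAt.comp x hd.hasFDerivAt
    have h2 := ((detForm m).hasFDerivAt _).comp x hu
    have h3 : (fun y => detForm m (Function.update (fun b => fderiv ℝ h y (Pi.single b 1)) a (Pi.single i 1))) =
      (detForm m) ∘ (fun y => Function.update (fun b => fderiv ℝ h y (Pi.single b 1)) a (Pi.single i 1)) := rfl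
    rw [h3, h2.fderiv, ContinuousLinearMap.comp_apply, ContinuousMultilinearMap.linearDeriv_apply]
    refine Finset.sum_congr rfl fun b _ => ?_
    by_cases hb : b = a
    · subst hb
      simp only [hT, if_true]
      exact (detForm m).map_coord_zero b (by simp)
    · simp only [hT, hb, if_false, ContinuousLinearMap.coe_pi']
      rfl
  unfold divergence
  simp only [hterm]
  have h1 : ∑ a, ∑ b, T a b = -∑ a, ∑ b, T a b := by
    conv_lhs => rw [Finset.sum_comm]
    rw [← Finset.sum_neg_distrib]
    refine Finset.sum_congr rfl fun a _ => ?_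
    rw [← Finset.sum_neg_distrib]
    exact Finset.sum_congr rfl fun b _ => hTs b a
  linarith

theorem fderiv_eq_sum_jacobian {W : Type*} [NormedAddCommGroup W] [NormedSpace ℝ W]
    (A : (Fin m → ℝ) →L[ℝ] W) (k : Fin m) :
    A (fderiv ℝ h x (Pi.single k 1)) = ∑ l, jacobian h x l k • A (Pi.single l 1) := by
  conv_lhs => rw [← Finset.univ_sum_single (fderiv ℝ h x (Pi.single k 1)), map_sum]
  refine Finset.sum_congr rfl fun l _ => ?_
  rw [← map_smul, ← Pi.single_smul]
  simp [jacobian]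

/-- The Piola identity: the divergence of a vector density is a scalar density. -/
theorem divergence_piola (hh : SmoothNear h x) {R : (Fin m → ℝ) → Fin m → ℝ}
    (hR : DifferentiableAt ℝ R (h x)) :
    divergence (fun y a => ∑ i, (jacobian h y).adjugate a i * R (h y) i) x =
      (jacobian h x).det * divergence R (h x) := by
  have hRi : ∀ i, HasFDerivAt (fun y => R y i) (fderiv ℝ (fun y => R y i) (h x)) (h x) := fun i =>
    (differentiableAt_pi.1 hR i).hasFDerivAt
  have hA : ∀ a i, HasFDerivAt (fun y => (jacobian h y).adjugate a i)
      (fderiv ℝ (fun y => (jacobian h y).adjugate a i) x) x := fun a i =>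
    (hh.adjugate_jacobian a i).differentiableAt.hasFDerivAt
  have hterm : ∀ a, fderiv ℝ (fun y => ∑ i, (jacobian h y).adjugate a i * R (h y) i) x
      (Pi.single a 1) = ∑ i, ((jacobian h x).adjugate a i *
        ∑ l, jacobian h x l a * fderiv ℝ (fun y => R y i) (h x) (Pi.single l 1) +
        R (h x) i * fderiv ℝ (fun y => (jacobian h y).adjugate a i) x (Pi.single a 1)) := by
    intro a
    have h1 := HasFDerivAt.fun_sum (u := Finset.univ) fun i _ => (hA a i).fun_mul
      ((hRi i).comp x hh.differentiableAt.hasFDerivAt)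
    have h2 := congrArg (fun A => A (Pi.single a 1)) h1.fderiv
    refine h2.trans ?_
    simp only [_root_.sum_apply, _root_.add_apply, _root_.smul_apply,
      ContinuousLinearMap.comp_apply, fderiv_eq_sum_jacobian, smul_eq_mul, Function.comp]
  unfold divergence
  simp only [hterm, Finset.sum_add_distrib]
  have hz : ∑ a, ∑ i, R (h x) i * fderiv ℝ (fun y => (jacobian h y).adjugate a i) x
      (Pi.single a 1) = 0 := by
    rw [Finset.sum_comm]
    refine Finset.sum_eq_zero fun i _ => ?_
    rw [← Finset.mul_sum]
    have := divergence_adjugate_jacobian hh i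
    unfold divergence at this
    rw [this, mul_zero]
  rw [hz, add_zero, Finset.sum_comm, Finset.mul_sum]
  refine Finset.sum_congr rfl fun i _ => ?_
  simp only [Finset.mul_sum]
  rw [Finset.sum_comm]
  have hdet : ∀ l, ∑ a, jacobian h x l a * (jacobian h x).adjugate a i =
      if l = i then (jacobian h x).det else 0 := by
    intro l
    have := congrFun (congrFun (Matrix.mul_adjugate (jacobian h x)) l) i
    rw [Matrix.mul_apply] at this
    rw [this]
    simp [Matrix.one_apply]
  calc _ = ∑ l, (∑ a, jacobian h x l a * (jacobian h x).adjugate a i) *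
        fderiv ℝ (fun y => R y i) (h x) (Pi.single l 1) := by
        refine Finset.sum_congr rfl fun l _ => ?_
        rw [Finset.sum_mul]
        exact Finset.sum_congr rfl fun a _ => by ring
    _ = _ := by simp [hdet]

end Piola

/-! ### First-order currents -/

section Current

variable {m n : ℕ}

/-- The first-order current `V ↦ q^a V + q^{aj} ∂V/∂x^j`, a vector field on `ℝ^m` which depends
linearly on the first prolongation of the variation field `V`. -/
def current (q₀ : Fin m → (Fin m → ℝ) → (Fin n → ℝ) →L[ℝ] ℝ)
    (q₁ : Fin m → Fin m → (Fin m → ℝ) → (Fin n → ℝ) →L[ℝ] ℝ)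
    (V : (Fin m → ℝ) → (Fin n → ℝ)) (x : Fin m → ℝ) (a : Fin m) : ℝ :=
  q₀ a x (V x) + ∑ j, q₁ a j x (fderiv ℝ V x (Pi.single j 1))

theorem fderiv_sub_mul {r : (Fin m → ℝ) → ℝ} {x : Fin m → ℝ} (hr : DifferentiableAt ℝ r x)
    (l : Fin m) : HasFDerivAt (fun y => (y l - x l) * r y)
      (r x • ContinuousLinearMap.proj (R := ℝ) (φ := fun _ : Fin m => ℝ) l) x := by
  have h1 : HasFDerivAt (fun y : Fin m → ℝ => y l - x l)
      (ContinuousLinearMap.proj (R := ℝ) (φ := fun _ : Fin m => ℝ) l) x :=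
    (hasFDerivAt_apply l x).sub_const _
  have h := h1.fun_mul hr.hasFDerivAt
  simpa using h

/-- A first-order current with symmetric symbol whose divergence is of order zero in the variation
field vanishes. -/
theorem current_unique {U : Set (Fin m → ℝ)} (hU : IsOpen U)
    {q₀ : Fin m → (Fin m → ℝ) → (Fin n → ℝ) →L[ℝ] ℝ}
    {q₁ : Fin m → Fin m → (Fin m → ℝ) → (Fin n → ℝ) →L[ℝ] ℝ}
    (h₀ : ∀ x ∈ U, ∀ a, DifferentiableAt ℝ (q₀ a) x)
    (h₁ : ∀ x ∈ U, ∀ a j, DifferentiableAt ℝ (q₁ a j) x)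
    (hs : ∀ x ∈ U, ∀ a j, q₁ a j x = q₁ j a x)
    (H : ∀ x ∈ U, ∀ V : (Fin m → ℝ) → (Fin n → ℝ), ContDiff ℝ ∞ V → V x = 0 →
      divergence (current q₀ q₁ V) x = 0) :
    ∀ x ∈ U, (∀ a, q₀ a x = 0) ∧ ∀ a j, q₁ a j x = 0 := by
  have happ : ∀ {q : (Fin m → ℝ) → (Fin n → ℝ) →L[ℝ] ℝ} {x} (w : Fin n → ℝ),
      DifferentiableAt ℝ q x → DifferentiableAt ℝ (fun y => q y w) x :=
    fun w h => h.clm_apply (differentiableAt_const w)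
  have hc : ∀ l : Fin m, ContDiff ℝ ∞ fun y : Fin m → ℝ => y l := fun l => contDiff_apply ℝ ℝ l
  have hq₁ : ∀ x ∈ U, ∀ a j, q₁ a j x = 0 := by
    intro x hx k l
    ext1 w
    -- the variation field `(y^k - x^k)(y^l - x^l) w` isolates the symbol
    set V : (Fin m → ℝ) → (Fin n → ℝ) := fun y => ((y k - x k) * (y l - x l)) • w with hV
    have hVs : ContDiff ℝ ∞ V :=
      (((hc k).sub contDiff_const).mul ((hc l).sub contDiff_const)).smul contDiff_const
    have hVd : ∀ y j, fderiv ℝ V y (Pi.single j 1) =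
        ((if k = j then 1 else 0) * (y l - x l) + (if l = j then 1 else 0) * (y k - x k)) • w := by
      intro y j
      have e : HasFDerivAt V _ y := (((hasFDerivAt_apply (𝕜 := ℝ) k y).sub_const (x k)).fun_mul
        ((hasFDerivAt_apply (𝕜 := ℝ) l y).sub_const (x l))).smul_const w
      rw [e.fderiv]
      simp only [ContinuousLinearMap.smulRight_apply, _root_.add_apply, _root_.smul_apply,
        ContinuousLinearMap.proj_apply, Pi.single_apply, smul_eq_mul]
      congr 1
      ring
    have hcur : ∀ a, (fun y => current q₀ q₁ V y a) = fun y =>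
        (y k - x k) * ((y l - x l) * q₀ a y w) +
          ((y l - x l) * q₁ a k y w + (y k - x k) * q₁ a l y w) := by
      intro a
      funext y
      simp only [current, hVd]
      simp only [hV, map_smul, smul_eq_mul, add_mul, Finset.sum_add_distrib]
      simp only [ite_mul, one_mul, zero_mul, Finset.sum_ite_eq, Finset.mem_univ, if_true]
      ring
    have hdiv := H x hx V hVs (by simp [hV])
    unfold divergence at hdiv
    have hterm : ∀ a, fderiv ℝ (fun y => current q₀ q₁ V y a) x (Pi.single a 1) =
        (if l = a then q₁ a k x w else 0) + (if k = a then q₁ a l x w else 0) := by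
      intro a
      rw [hcur]
      have d0 := happ w (h₀ x hx a)
      have e := (fderiv_sub_mul (x := x) (r := fun y => (y l - x l) * q₀ a y w)
        (fderiv_sub_mul d0 l).differentiableAt k).fun_add
        ((fderiv_sub_mul (happ w (h₁ x hx a k)) l).fun_add
          (fderiv_sub_mul (happ w (h₁ x hx a l)) k))
      rw [e.fderiv]
      simp [Pi.single_apply]
    simp only [hterm, Finset.sum_add_distrib, Finset.sum_ite_eq, Finset.mem_univ, if_true] at hdiv
    rw [hs x hx l k] at hdiv
    simpa using (by linarith : q₁ k l x w = 0)
  intro x hx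
  refine ⟨fun k => ?_, hq₁ x hx⟩
  ext1 w
  -- once the symbol vanishes on `U`, the variation field `(y^k - x^k) w` isolates `q^k`
  set V : (Fin m → ℝ) → (Fin n → ℝ) := fun y => (y k - x k) • w with hV
  have hVs : ContDiff ℝ ∞ V := ((hc k).sub contDiff_const).smul contDiff_const
  have hcur : ∀ a, (fun y => current q₀ q₁ V y a) =ᶠ[𝓝 x] fun y => (y k - x k) * q₀ a y w := by
    intro a
    filter_upwards [hU.mem_nhds hx] with y hy
    simp [current, hq₁ y hy, hV]
  have hdiv := H x hx V hVs (by simp [hV])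
  unfold divergence at hdiv
  have hterm : ∀ a, fderiv ℝ (fun y => current q₀ q₁ V y a) x (Pi.single a 1) =
      if k = a then q₀ a x w else 0 := by
    intro a
    rw [(hcur a).fderiv_eq, (fderiv_sub_mul (happ w (h₀ x hx a)) k).fderiv]
    simp [Pi.single_apply]
  simpa [hterm] using hdiv

end Current

/-! ### The Legendre current of a second-order Lagrangian -/

section Momenta

variable {m n : ℕ}

/-- The inclusion of the coordinates `u_I` into the tangent space of the `k`-jets. -/
def inclU {k : ℕ} (I : MultiIndex m k) : (Fin n → ℝ) →L[ℝ] JetCoord m n k :=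
  (ContinuousLinearMap.inr ℝ _ _).comp (ContinuousLinearMap.single ℝ (fun _ => Fin n → ℝ) I)

theorem inclU_single {k : ℕ} (I : MultiIndex m k) (α : Fin n) :
    inclU I (Pi.single α 1) = ddu I α := rfl

/-- The Legendre momenta `p^{ij} = (1 / n(ij)) ∂Λ/∂u_{1_i+1_j}` along the second prolongation of
`f`. -/
def legendreTwo (Λ : JetCoord m n 2 → ℝ) (f : (Fin m → ℝ) → (Fin n → ℝ)) (i j : Fin m)
    (x : Fin m → ℝ) : (Fin n → ℝ) →L[ℝ] ℝ :=
  (1 / nfac i j) • (fderiv ℝ Λ (prolong 2 f x)).comp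
    (inclU (MultiIndex.ofTwo 0 (pairIndex i j)))

/-- The Legendre momenta `p^i = ∂Λ/∂u_i - ∑_j ∂p^{ij}/∂x^j` along the second prolongation of
`f`. -/
def legendreOne (Λ : JetCoord m n 2 → ℝ) (f : (Fin m → ℝ) → (Fin n → ℝ)) (i : Fin m)
    (x : Fin m → ℝ) : (Fin n → ℝ) →L[ℝ] ℝ :=
  (fderiv ℝ Λ (prolong 2 f x)).comp (inclU (MultiIndex.single 1 i)) -
    ∑ j, fderiv ℝ (legendreTwo Λ f i j) x (Pi.single j 1)

theorem pairIndex_comm (i j : Fin m) : pairIndex i j = pairIndex j i :=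
  Subtype.ext (Multiset.pair_comm i j)

theorem nfac_comm (i j : Fin m) : nfac i j = nfac j i := by
  simp [nfac, eq_comm]

theorem nfac_ne_zero (i j : Fin m) : nfac i j ≠ 0 := by
  unfold nfac; split_ifs <;> norm_num

theorem legendreTwo_symm (Λ : JetCoord m n 2 → ℝ) (f : (Fin m → ℝ) → (Fin n → ℝ)) (i j : Fin m) :
    legendreTwo Λ f i j = legendreTwo Λ f j i := by
  unfold legendreTwo
  rw [nfac_comm i j, pairIndex_comm i j]

theorem pairIndex_eq_iff (i j a b : Fin m) :
    pairIndex i j = pairIndex a b ↔ (i = a ∧ j = b) ∨ (i = b ∧ j = a) := by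
  constructor
  · intro h
    have h' : ({i, j} : Multiset (Fin m)) = {a, b} := congrArg Subtype.val h
    rcases Multiset.cons_eq_cons.1 h' with ⟨h1, h2⟩ | ⟨_, s, h1, h2⟩
    · exact .inl ⟨h1, Multiset.singleton_inj.1 h2⟩
    · obtain ⟨h3, rfl⟩ := Multiset.singleton_eq_cons_iff _ |>.1 h1
      exact .inr ⟨(Multiset.singleton_inj.1 h2).symm, h3⟩
  · rintro (⟨rfl, rfl⟩ | ⟨rfl, rfl⟩)
    · rfl
    · exact pairIndex_comm _ _

theorem exists_pairIndex (I : Sym (Fin m) 2) : ∃ i j, I = pairIndex i j := by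
  obtain ⟨s, hs⟩ := I
  obtain ⟨i, j, rfl⟩ := Multiset.card_eq_two.1 hs
  exact ⟨i, j, rfl⟩

theorem sum_pairIndex {W : Type*} [AddCommGroup W] [Module ℝ W] (φ : Sym (Fin m) 2 → W) :
    ∑ i, ∑ j, (1 / nfac i j) • φ (pairIndex i j) = ∑ I, φ I := by
  rw [← Finset.sum_product']
  rw [← Finset.sum_fiberwise (s := Finset.univ ×ˢ Finset.univ)
    (g := fun p : Fin m × Fin m => pairIndex p.1 p.2)]
  refine Finset.sum_congr rfl fun I _ => ?_
  obtain ⟨a, b, rfl⟩ := exists_pairIndex I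
  have h1 : ∑ p ∈ Finset.univ ×ˢ Finset.univ with pairIndex p.1 p.2 = pairIndex a b,
      (1 / nfac p.1 p.2) • φ (pairIndex p.1 p.2) =
      ∑ p ∈ ({(a, b), (b, a)} : Finset (Fin m × Fin m)), (1 / nfac p.1 p.2) • φ (pairIndex a b) := by
    refine Finset.sum_congr ?_ fun p hp => ?_
    · ext p
      simp [pairIndex_eq_iff, Prod.ext_iff]
    · rcases Finset.mem_insert.1 hp with rfl | hp
      · rfl
      · rw [Finset.mem_singleton.1 hp, pairIndex_comm b a]
  rw [h1]
  by_cases hab : a = b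
  · subst hab; simp [nfac]
  · rw [Finset.sum_pair (by simp [hab]), nfac_comm b a, ← add_smul]
    simp only [nfac, hab, if_false]
    norm_num

theorem sum_multiIndex_two {W : Type*} [AddCommGroup W] (φ : MultiIndex m 2 → W) :
    ∑ I, φ I = φ (MultiIndex.zero m 2) + ∑ i, φ (MultiIndex.single 1 i) +
      ∑ I, φ (MultiIndex.ofTwo 0 I) := by
  have e : Function.Bijective (Sum.elim (Sum.elim (fun _ : Unit => MultiIndex.zero m 2)
      (MultiIndex.single 1)) (MultiIndex.ofTwo 0) :
      (Unit ⊕ Fin m) ⊕ Sym (Fin m) 2 → MultiIndex m 2) := by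
    constructor
    · have hcard : ∀ s, (Sum.elim (Sum.elim (fun _ : Unit => MultiIndex.zero m 2)
          (MultiIndex.single 1)) (MultiIndex.ofTwo 0) s).1.card =
          Sum.elim (Sum.elim (fun _ => 0) fun _ => 1) (fun _ => 2) s := by
        rintro ((_ | i) | I)
        · rfl
        · rfl
        · exact I.2
      intro s t h
      have h1 := hcard s
      rw [h, hcard t] at h1
      rcases s with (_ | i) | I <;> rcases t with (_ | j) | J <;>
        simp only [Sum.elim_inl, Sum.elim_inr] at h1 <;> first | omega | skip
      · rfl
      · rw [Multiset.singleton_inj.1 (congrArg Subtype.val h : ({i} : Multiset (Fin m)) = {j})]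
      · have h2 : MultiIndex.ofTwo 0 I = MultiIndex.ofTwo 0 J := h
        have h3 := Subtype.ext_iff.1 h2
        rw [show I = J from Subtype.ext h3]
    · rintro ⟨I, hI⟩
      have h3 : I.card = 0 ∨ I.card = 1 ∨ I.card = 2 := by omega
      rcases h3 with h | h | h
      · exact ⟨.inl (.inl ()), Subtype.ext (Multiset.card_eq_zero.1 h).symm⟩
      · obtain ⟨i, rfl⟩ := Multiset.card_eq_one.1 h
        exact ⟨.inl (.inr i), rfl⟩
      · exact ⟨.inr ⟨I, h⟩, rfl⟩
  rw [← (Equiv.ofBijective _ e).sum_comp]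
  simp [Fintype.sum_sum_type]

theorem apply_eq_sum_inclU {k : ℕ} (A : JetCoord m n k →L[ℝ] ℝ) (w : MultiIndex m k → Fin n → ℝ) :
    A (0, w) = ∑ I, A (inclU I (w I)) := by
  have h : ((0 : Fin m → ℝ), w) = ∑ I, inclU I (w I) := by
    refine Prod.ext ?_ ?_
    · simp [Prod.fst_sum, inclU]
    · simp [Prod.snd_sum, inclU, Finset.univ_sum_single]
  rw [h, map_sum]

section

variable {f V : (Fin m → ℝ) → (Fin n → ℝ)} {x : Fin m → ℝ} {Λ : JetCoord m n 2 → ℝ}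

theorem smoothNear_legendreTwo (hf : SmoothNear f x) (hΛ : SmoothNear Λ (prolong 2 f x))
    (i j : Fin m) : SmoothNear (legendreTwo Λ f i j) x :=
  (((hΛ.fderiv).comp (hf.prolong 2)).clm_comp (.const _)).const_smul _

theorem smoothNear_legendreOne (hf : SmoothNear f x) (hΛ : SmoothNear Λ (prolong 2 f x))
    (i : Fin m) : SmoothNear (legendreOne Λ f i) x :=
  (((hΛ.fderiv).comp (hf.prolong 2)).clm_comp (.const _)).sub
    (.sum fun j => (smoothNear_legendreTwo hf hΛ i j).fderiv_apply _)

theorem smoothNear_current {q₀ : Fin m → (Fin m → ℝ) → (Fin n → ℝ) →L[ℝ] ℝ}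
    {q₁ : Fin m → Fin m → (Fin m → ℝ) → (Fin n → ℝ) →L[ℝ] ℝ}
    (h₀ : ∀ a, SmoothNear (q₀ a) x) (h₁ : ∀ a j, SmoothNear (q₁ a j) x) (hV : SmoothNear V x) :
    SmoothNear (current q₀ q₁ V) x :=
  .pi fun a => ((h₀ a).clm_apply hV).add (.sum fun j => (h₁ a j).clm_apply (hV.fderiv_apply _))

/-- Integration by parts: up to terms of order zero in the variation field, the first variation of
the Lagrangian is the divergence of the Legendre current. -/
theorem first_variation (hf : SmoothNear f x) (hΛ : SmoothNear Λ (prolong 2 f x))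
    (hV : SmoothNear V x) (hVx : V x = 0) :
    fderiv ℝ Λ (prolong 2 f x) (0, (prolong 2 V x).2) =
      divergence (current (legendreOne Λ f) (legendreTwo Λ f) V) x := by
  have dV := hV.differentiableAt
  have dV' : ∀ j, DifferentiableAt ℝ (fun y => fderiv ℝ V y (Pi.single j 1)) x :=
    fun j => (hV.fderiv_apply _).differentiableAt
  have d2 := fun i j => (smoothNear_legendreTwo hf hΛ i j).differentiableAt
  have d1 := fun i => (smoothNear_legendreOne hf hΛ i).differentiableAt
  have hterm : ∀ a, fderiv ℝ (fun y => current (legendreOne Λ f) (legendreTwo Λ f) V y a) x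
      (Pi.single a 1) = legendreOne Λ f a x (fderiv ℝ V x (Pi.single a 1)) +
        ∑ j, (fderiv ℝ (legendreTwo Λ f a j) x (Pi.single a 1) (fderiv ℝ V x (Pi.single j 1)) +
          legendreTwo Λ f a j x
            (fderiv ℝ (fun y => fderiv ℝ V y (Pi.single j 1)) x (Pi.single a 1))) := by
    intro a
    have e := ((d1 a).hasFDerivAt.clm_apply dV.hasFDerivAt).fun_add (HasFDerivAt.fun_sum
      (u := Finset.univ) fun j _ => (d2 a j).hasFDerivAt.clm_apply (dV' j).hasFDerivAt)
    have e' := congrArg (fun A => A (Pi.single a 1)) e.fderiv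
    refine e'.trans ?_
    simp [hVx, add_comm]
  unfold divergence
  simp only [hterm, Finset.sum_add_distrib]
  have hsec : ∀ a j, fderiv ℝ (fun y => fderiv ℝ V y (Pi.single j 1)) x (Pi.single a 1) =
      (prolong 2 V x).2 (MultiIndex.ofTwo 0 (pairIndex a j)) := by
    intro a j
    have h := partials_sort_cons hV a {j}
    simp only [Multiset.sort_singleton, partials_cons, partials_nil] at h
    exact h.symm
  -- the total derivatives in `legendreOne` cancel the derivatives of `legendreTwo`
  have h1 : ∑ a, legendreOne Λ f a x (fderiv ℝ V x (Pi.single a 1)) +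
      ∑ a, ∑ j, fderiv ℝ (legendreTwo Λ f a j) x (Pi.single a 1) (fderiv ℝ V x (Pi.single j 1)) =
      ∑ a, fderiv ℝ Λ (prolong 2 f x)
        (inclU (MultiIndex.single 1 a) (fderiv ℝ V x (Pi.single a 1))) := by
    rw [Finset.sum_comm, ← Finset.sum_add_distrib]
    refine Finset.sum_congr rfl fun a _ => ?_
    simp only [legendreOne, _root_.sub_apply, _root_.sum_apply, ContinuousLinearMap.comp_apply]
    rw [sub_add_eq_add_sub, sub_eq_iff_eq_add]
    congr 1
    exact Finset.sum_congr rfl fun j _ => by rw [legendreTwo_symm]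
  have h2 : ∑ a, ∑ j, legendreTwo Λ f a j x
      (fderiv ℝ (fun y => fderiv ℝ V y (Pi.single j 1)) x (Pi.single a 1)) =
      ∑ I, fderiv ℝ Λ (prolong 2 f x) (inclU (MultiIndex.ofTwo 0 I)
        ((prolong 2 V x).2 (MultiIndex.ofTwo 0 I))) := by
    rw [← sum_pairIndex]
    refine Finset.sum_congr rfl fun a _ => Finset.sum_congr rfl fun j _ => ?_
    rw [hsec]
    rfl
  rw [← add_assoc, h1, h2, apply_eq_sum_inclU, sum_multiIndex_two, prolong_zero, hVx, map_zero,
    map_zero, zero_add]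
  congr 1
  exact Finset.sum_congr rfl fun a _ => by rw [prolong_single]

end

end Momenta

/-! ### Transformation of the Legendre current -/

section Transform

variable {m n : ℕ}

/-- The variation field induced on `y ↦ F (g y, f (g y))` by a variation field `V` of `f`. -/
def pushVariation (F : (Fin m → ℝ) × (Fin n → ℝ) → (Fin n → ℝ)) (g : (Fin m → ℝ) → (Fin m → ℝ))
    (f V : (Fin m → ℝ) → (Fin n → ℝ)) (y : Fin m → ℝ) : Fin n → ℝ :=
  fderiv ℝ F (g y, f (g y)) (0, V (g y))

section

variable {F : (Fin m → ℝ) × (Fin n → ℝ) → (Fin n → ℝ)} {g : (Fin m → ℝ) → (Fin m → ℝ)}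
  {f V : (Fin m → ℝ) → (Fin n → ℝ)} {y : Fin m → ℝ}

/-- The prolongations of the transforms of `f + tV` have the prolongation of the induced variation
field as derivative. -/
theorem hasDerivAt_prolong_transform (hg : SmoothNear g y) (hf : SmoothNear f (g y))
    (hF : SmoothNear F (g y, f (g y))) (hV : SmoothNear V (g y)) (k : ℕ) :
    HasDerivAt (fun t : ℝ => prolong k (fun z => F (g z, f (g z) + t • V (g z))) y)
      (0, (prolong k (pushVariation F g f V) y).2) 0 := by
  have hg' : SmoothNear (fun p : ℝ × (Fin m → ℝ) => g p.2) (0, y) :=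
    SmoothNear.comp (k := g) (f := Prod.snd) hg (.of_contDiff contDiff_snd)
  have hf' : SmoothNear (fun p : ℝ × (Fin m → ℝ) => f (g p.2)) (0, y) :=
    SmoothNear.comp (k := f) (f := fun p : ℝ × (Fin m → ℝ) => g p.2) hf hg'
  have hV' : SmoothNear (fun p : ℝ × (Fin m → ℝ) => V (g p.2)) (0, y) :=
    SmoothNear.comp (k := V) (f := fun p : ℝ × (Fin m → ℝ) => g p.2) hV hg'
  have ht : SmoothNear (fun p : ℝ × (Fin m → ℝ) => p.1) (0, y) := .of_contDiff contDiff_fst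
  have hin : SmoothNear (fun p : ℝ × (Fin m → ℝ) => (g p.2, f (g p.2) + p.1 • V (g p.2)))
    (0, y) := hg'.prodMk (hf'.add (ht.smul hV'))
  have hs : SmoothNear (fun p : ℝ × (Fin m → ℝ) => F (g p.2, f (g p.2) + p.1 • V (g p.2)))
      (0, y) := SmoothNear.comp (k := F) (by simpa using hF) hin
  have h := hasDerivAt_prolong_family (f := fun t z => F (g z, f (g z) + t • V (g z))) hs k
  have he : (fun z => fderiv ℝ (fun p : ℝ × (Fin m → ℝ) =>
      F (g p.2, f (g p.2) + p.1 • V (g p.2))) (0, z) (1, 0)) =ᶠ[𝓝 y] pushVariation F g f V := by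
    filter_upwards [hg,
      hg.self.continuousAt.eventually hf, hg.self.continuousAt.eventually hV,
      ((hg.prodMk (hf.comp hg)).self.continuousAt.eventually hF)] with z h1 h3 h4 h5
    have dg := HasFDerivAt.comp (g := g) (f := Prod.snd) ((0 : ℝ), z)
      (h1.differentiableAt (by simp)).hasFDerivAt hasFDerivAt_snd
    have df := HasFDerivAt.comp (g := f) ((0 : ℝ), z)
      (h3.differentiableAt (by simp)).hasFDerivAt dg
    have dV := HasFDerivAt.comp (g := V) ((0 : ℝ), z)
      (h4.differentiableAt (by simp)).hasFDerivAt dg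
    have h5' : HasFDerivAt F (fderiv ℝ F (g z, f (g z))) (g z, f (g z) + (0 : ℝ) • V (g z)) := by
      simpa using (h5.differentiableAt (by simp)).hasFDerivAt
    have d := HasFDerivAt.comp (g := F) ((0 : ℝ), z) h5'
      (dg.prodMk (df.fun_add (hasFDerivAt_fst.fun_smul dV)))
    have d' := congrArg (fun A => A (1, 0)) d.fderiv
    refine d'.trans ?_
    simp [pushVariation]
  rw [prolong_congr he] at h
  exact h

end

theorem adjugate_jacobian_of_leftInverse {h g : (Fin m → ℝ) → (Fin m → ℝ)} {x : Fin m → ℝ}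
    (hg : DifferentiableAt ℝ g (h x)) (hh : DifferentiableAt ℝ h x)
    (hgh : ∀ᶠ y in 𝓝 x, g (h y) = y) (a i : Fin m) :
    (jacobian h x).adjugate a i = (jacobian h x).det * jacobian g (h x) a i := by
  have hJ : jacobian g (h x) * jacobian h x = 1 := by
    have d := (hg.hasFDerivAt.comp x hh.hasFDerivAt).fderiv
    have d' : fderiv ℝ g (h x) ∘SL fderiv ℝ h x = ContinuousLinearMap.id ℝ _ := by
      rw [← d]
      exact (Filter.EventuallyEq.fderiv_eq hgh).trans fderiv_fun_id
    ext i j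
    have d2 := congrFun (congrArg (fun B => B (Pi.single j 1)) d') i
    simp only [ContinuousLinearMap.comp_apply, fderiv_eq_sum_jacobian] at d2
    rw [Matrix.mul_apply, Matrix.one_apply]
    simp only [Finset.sum_apply, Pi.smul_apply, smul_eq_mul, ContinuousLinearMap.id_apply,
      Pi.single_apply] at d2
    rw [← d2]
    exact Finset.sum_congr rfl fun l _ => mul_comm _ _
  have e : (jacobian h x).adjugate = (jacobian h x).det • jacobian g (h x) := by
    calc (jacobian h x).adjugate = jacobian g (h x) * jacobian h x * (jacobian h x).adjugate := by
          rw [hJ, one_mul]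
      _ = _ := by rw [mul_assoc, Matrix.mul_adjugate, Matrix.mul_smul, mul_one]
  rw [e]; rfl

/-- Second-order Lagrangian densities `Λ d^mx` and `Λ' d^mx'` which represent the same density along
the sections near `f` have the same Legendre current; its components transform as a vector
density. -/
theorem current_transform {U : Set (Fin m → ℝ)} (hU : IsOpen U)
    {f : (Fin m → ℝ) → (Fin n → ℝ)} {h g : (Fin m → ℝ) → (Fin m → ℝ)}
    {F : (Fin m → ℝ) × (Fin n → ℝ) → (Fin n → ℝ)} {Λ Λ' : JetCoord m n 2 → ℝ}
    (hf : ∀ x ∈ U, SmoothNear f x) (hh : ∀ x ∈ U, SmoothNear h x)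
    (hg : ∀ x ∈ U, SmoothNear g (h x)) (hgh : ∀ x ∈ U, g (h x) = x)
    (hF : ∀ x ∈ U, SmoothNear F (x, f x))
    (hΛ : ∀ x ∈ U, SmoothNear Λ (prolong 2 f x))
    (hΛ' : ∀ x ∈ U, SmoothNear Λ' (prolong 2 (fun y => F (g y, f (g y))) (h x)))
    (hrel : ∀ x ∈ U, ∀ V : (Fin m → ℝ) → (Fin n → ℝ), ContDiff ℝ ∞ V → ∀ᶠ t : ℝ in 𝓝 0,
      Λ (prolong 2 (fun y => f y + t • V y) x) =
        (jacobian h x).det * Λ' (prolong 2 (fun y => F (g y, f (g y) + t • V (g y))) (h x)))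
    {x : Fin m → ℝ} (hx : x ∈ U) {V : (Fin m → ℝ) → (Fin n → ℝ)} (hV : SmoothNear V x)
    (a : Fin m) :
    current (legendreOne Λ f) (legendreTwo Λ f) V x a =
      ∑ i, (jacobian h x).adjugate a i *
        current (legendreOne Λ' fun y => F (g y, f (g y)))
          (legendreTwo Λ' fun y => F (g y, f (g y))) (pushVariation F g f V) (h x) i := by
  set f' : (Fin m → ℝ) → (Fin n → ℝ) := fun y => F (g y, f (g y)) with hf'
  have hg' : ∀ x ∈ U, ∀ {W : Type} [NormedAddCommGroup W] [NormedSpace ℝ W]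
      {k : (Fin m → ℝ) → W}, SmoothNear k x → SmoothNear (fun y => k (g y)) (h x) := by
    intro x hx W _ _ k hk
    exact SmoothNear.comp (k := k) (by rw [hgh x hx]; exact hk) (hg x hx)
  have sf' : ∀ x ∈ U, SmoothNear f' (h x) := fun x hx =>
    hg' x hx (k := fun x => F (x, f x)) ((hF x hx).comp (f := fun x => (x, f x)) (SmoothNear.id.prodMk (hf x hx)))
  -- `A` is the vertical derivative of the coordinate change along the section
  set A : (Fin m → ℝ) → (Fin n → ℝ) →L[ℝ] (Fin n → ℝ) := fun x =>
    (fderiv ℝ F (x, f x)).comp (ContinuousLinearMap.inr ℝ _ _) with hA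
  have sA : ∀ x ∈ U, SmoothNear A x := fun x hx =>
    ((hF x hx).fderiv.comp (f := fun x => (x, f x)) (SmoothNear.id.prodMk (hf x hx))).clm_comp
      (.const _)
  have hpush : ∀ V, pushVariation F g f V = fun y => A (g y) (V (g y)) := fun V => rfl
  have hadj : ∀ x ∈ U, ∀ a i, (jacobian h x).adjugate a i =
      (jacobian h x).det * jacobian g (h x) a i := by
    intro x hx a i
    refine adjugate_jacobian_of_leftInverse (hg x hx).differentiableAt (hh x hx).differentiableAt
      ?_ a i
    filter_upwards [hU.mem_nhds hx] with y hy using hgh y hy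
  -- the coefficients of the transformed current, as an operator on `x ↦ A x (V x)`
  set r₀ : Fin m → (Fin m → ℝ) → (Fin n → ℝ) →L[ℝ] ℝ := fun a x =>
    ∑ i, (jacobian h x).adjugate a i • legendreOne Λ' f' i (h x) with hr₀
  set r₁ : Fin m → Fin m → (Fin m → ℝ) → (Fin n → ℝ) →L[ℝ] ℝ := fun a l x =>
    ∑ i, ∑ k, ((jacobian h x).adjugate a i * jacobian g (h x) l k) • legendreTwo Λ' f' i k (h x)
    with hr₁
  have sr₀ : ∀ x ∈ U, ∀ a, SmoothNear (r₀ a) x := fun x hx a => .sum fun i =>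
    ((hh x hx).adjugate_jacobian a i).smul
      ((smoothNear_legendreOne (sf' x hx) (hΛ' x hx) i).comp (hh x hx))
  have sr₁ : ∀ x ∈ U, ∀ a l, SmoothNear (r₁ a l) x := fun x hx a l => .sum fun i => .sum fun k =>
    (((hh x hx).adjugate_jacobian a i).mul
      ((((hg x hx).fderiv_apply (Pi.single k 1)).apply l).comp (hh x hx))).smul
      ((smoothNear_legendreTwo (sf' x hx) (hΛ' x hx) i k).comp (hh x hx))
  -- the difference of the two currents, again as a first-order current in `V`
  set q₀ : Fin m → (Fin m → ℝ) → (Fin n → ℝ) →L[ℝ] ℝ := fun a x =>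
    (r₀ a x).comp (A x) + ∑ l, (r₁ a l x).comp (fderiv ℝ A x (Pi.single l 1)) - legendreOne Λ f a x
    with hq₀
  set q₁ : Fin m → Fin m → (Fin m → ℝ) → (Fin n → ℝ) →L[ℝ] ℝ := fun a l x =>
    (r₁ a l x).comp (A x) - legendreTwo Λ f a l x with hq₁
  have htrans : ∀ x ∈ U, ∀ V : (Fin m → ℝ) → (Fin n → ℝ), SmoothNear V x → ∀ a,
      current q₀ q₁ V x a = ∑ i, (jacobian h x).adjugate a i *
        current (legendreOne Λ' f') (legendreTwo Λ' f') (pushVariation F g f V) (h x) i -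
        current (legendreOne Λ f) (legendreTwo Λ f) V x a := by
    intro x hx V hV a
    have dA := (sA x hx).differentiableAt.hasFDerivAt.clm_apply hV.differentiableAt.hasFDerivAt
    have d : ∀ k, fderiv ℝ (pushVariation F g f V) (h x) (Pi.single k 1) =
        ∑ l, jacobian g (h x) l k • (A x (fderiv ℝ V x (Pi.single l 1)) +
          fderiv ℝ A x (Pi.single l 1) (V x)) := by
      intro k
      have dA' : HasFDerivAt (fun x => A x (V x)) (fderiv ℝ (fun x => A x (V x)) x) (g (h x)) := by
        rw [hgh x hx]; exact dA.differentiableAt.hasFDerivAt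
      have e := congrArg (fun B => B (Pi.single k 1))
        (dA'.comp (h x) (hg x hx).differentiableAt.hasFDerivAt).fderiv
      refine (Eq.trans ?_ e).trans ?_
      · rfl
      · simp only [ContinuousLinearMap.comp_apply, fderiv_eq_sum_jacobian, dA.fderiv]
        rfl
    have hr : ∀ (v : Fin n → ℝ) (w : Fin m → Fin n → ℝ),
        ∑ i, (jacobian h x).adjugate a i * (legendreOne Λ' f' i (h x) v +
          ∑ k, legendreTwo Λ' f' i k (h x) (∑ l : Fin m, jacobian g (h x) l k • (w l : Fin n → ℝ))) =
        r₀ a x v + ∑ l, r₁ a l x (w l) := by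
      intro v w
      simp only [hr₀, hr₁, mul_add, Finset.sum_add_distrib, _root_.sum_apply, _root_.smul_apply,
        map_sum, map_smul, smul_eq_mul, Finset.mul_sum]
      congr 1
      rw [Finset.sum_comm (s := Finset.univ (α := Fin m))]
      conv_rhs => rw [Finset.sum_comm]
      rw [Finset.sum_comm]
      refine Finset.sum_congr rfl fun i _ => ?_
      conv_rhs => rw [Finset.sum_comm]
      refine Finset.sum_congr rfl fun k _ => Finset.sum_congr rfl fun l _ => ?_
      ring
    simp only [current, d, hr]
    rw [hpush]
    simp only [hgh x hx, hq₀, hq₁, _root_.sub_apply, _root_.add_apply, _root_.sum_apply,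
      ContinuousLinearMap.comp_apply, map_add, Finset.sum_add_distrib, Finset.sum_sub_distrib]
    ring
  have hq : ∀ x ∈ U, (∀ a, q₀ a x = 0) ∧ ∀ a j, q₁ a j x = 0 := by
    refine current_unique hU (fun x hx a => ?_) (fun x hx a j => ?_) ?_ ?_
    · exact ((((sr₀ x hx a).clm_comp (sA x hx)).add (.sum fun l =>
        (sr₁ x hx a l).clm_comp ((sA x hx).fderiv_apply _))).sub
        (smoothNear_legendreOne (hf x hx) (hΛ x hx) a)).differentiableAt
    · exact (((sr₁ x hx a j).clm_comp (sA x hx)).sub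
        (smoothNear_legendreTwo (hf x hx) (hΛ x hx) a j)).differentiableAt
    · -- the symbol is symmetric because `adj J = det J • J⁻¹`
      intro x hx a j
      have e : r₁ a j x = r₁ j a x := by
        simp only [hr₁, hadj x hx]
        rw [Finset.sum_comm]
        refine Finset.sum_congr rfl fun i _ => Finset.sum_congr rfl fun k _ => ?_
        rw [legendreTwo_symm]
        congr 1
        ring
      simp only [hq₁, e, legendreTwo_symm Λ f a j]
    · intro x hx V hVs hVx
      have sV : ∀ x, SmoothNear V x := fun x => .of_contDiff hVs
      have sp : SmoothNear (pushVariation F g f V) (h x) :=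
        hg' x hx (k := fun x => A x (V x)) ((sA x hx).clm_apply (sV x))
      have e1 : current q₀ q₁ V =ᶠ[𝓝 x] fun y a =>
          ∑ i, (jacobian h y).adjugate a i *
            current (legendreOne Λ' f') (legendreTwo Λ' f') (pushVariation F g f V) (h y) i -
          current (legendreOne Λ f) (legendreTwo Λ f) V y a := by
        filter_upwards [hU.mem_nhds hx] with y hy
        exact funext fun a => htrans y hy V (sV y) a
      have sc := smoothNear_current (smoothNear_legendreOne (hf x hx) (hΛ x hx))
        (smoothNear_legendreTwo (hf x hx) (hΛ x hx)) (sV x)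
      have sc' := smoothNear_current (smoothNear_legendreOne (sf' x hx) (hΛ' x hx))
        (smoothNear_legendreTwo (sf' x hx) (hΛ' x hx)) sp
      have e2 : divergence (current q₀ q₁ V) x =
          divergence (fun y a => ∑ i, (jacobian h y).adjugate a i *
            current (legendreOne Λ' f') (legendreTwo Λ' f') (pushVariation F g f V) (h y) i) x -
          divergence (current (legendreOne Λ f) (legendreTwo Λ f) V) x := by
        rw [divergence_congr e1]
        unfold divergence
        rw [← Finset.sum_sub_distrib]
        refine Finset.sum_congr rfl fun a _ => ?_
        have d1 : DifferentiableAt ℝ (fun y => ∑ i, (jacobian h y).adjugate a i *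
            current (legendreOne Λ' f') (legendreTwo Λ' f') (pushVariation F g f V) (h y) i) x :=
          (SmoothNear.sum fun i => ((hh x hx).adjugate_jacobian a i).mul
            ((sc'.apply i).comp (hh x hx))).differentiableAt
        rw [fderiv_fun_sub d1 (sc.apply a).differentiableAt]
        rfl
      have hpx : pushVariation F g f V (h x) = 0 := by
        rw [hpush]; simp [hgh x hx, hVx]
      -- both divergences are first variations of the same density
      rw [e2, divergence_piola (hh x hx) sc'.differentiableAt,
        ← first_variation (hf x hx) (hΛ x hx) (sV x) hVx,
        ← first_variation (sf' x hx) (hΛ' x hx) sp hpx]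
      have d1 : HasDerivAt (fun t : ℝ => Λ (prolong 2 (fun y => f y + t • V y) x))
          (fderiv ℝ Λ (prolong 2 f x) (0, (prolong 2 V x).2)) 0 := by
        simp only [prolong_add_smul (hf x hx) (sV x)]
        have e : HasDerivAt (fun t : ℝ => prolong 2 f x + t • ((0, (prolong 2 V x).2) :
            JetCoord m n 2)) (0, (prolong 2 V x).2) 0 := by
          simpa using ((hasDerivAt_id (0 : ℝ)).smul_const
            ((0, (prolong 2 V x).2) : JetCoord m n 2)).const_add (prolong 2 f x)
        exact HasFDerivAt.comp_hasDerivAt (l := Λ) 0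
          (by simpa using (hΛ x hx).differentiableAt.hasFDerivAt) e
      have d2 : HasDerivAt (fun t : ℝ => (jacobian h x).det *
          Λ' (prolong 2 (fun y => F (g y, f (g y) + t • V (g y))) (h x)))
          ((jacobian h x).det * fderiv ℝ Λ' (prolong 2 f' (h x))
            (0, (prolong 2 (pushVariation F g f V) (h x)).2)) 0 := by
        have e := hasDerivAt_prolong_transform (hg x hx) (by rw [hgh x hx]; exact hf x hx)
          (by rw [hgh x hx]; exact hF x hx) (by rw [hgh x hx]; exact sV x) 2
        exact (HasFDerivAt.comp_hasDerivAt (l := Λ') 0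
          (by simpa using (hΛ' x hx).differentiableAt.hasFDerivAt) e).const_mul _
      rw [d1.unique (d2.congr_of_eventuallyEq (hrel x hx V hVs)), sub_self]
  have h0 := htrans x hx V hV a
  rw [current] at h0
  simp only [(hq x hx).1, (hq x hx).2] at h0
  simp only [_root_.zero_apply, Finset.sum_const_zero, add_zero] at h0
  linarith

end Transform

/-! ### Forms which vanish on two vertical vectors -/

section Forms

variable {m n k : ℕ}

theorem wedge_apply (ℓ : Fin m → (JetCoord m n k →L[ℝ] ℝ)) (v : Fin m → JetCoord m n k) :
    wedge ℓ v = detForm m fun a b => ℓ b (v a) := rfl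

/-- The matrix whose columns are the components over the base of the vectors `v`. -/
def baseMatrix (v : Fin m → JetCoord m n k) : Matrix (Fin m) (Fin m) ℝ :=
  Matrix.of fun r c => (v c).1 r

theorem adjugate_baseMatrix (v : Fin m → JetCoord m n k) (a i : Fin m) :
    (baseMatrix v).adjugate a i =
      detForm m (Function.update (fun c => (v c).1) a (Pi.single i 1)) :=
  adjugate_apply_eq_detForm _ a i

theorem baseMatrix_ddx : baseMatrix (ddx (m := m) n k) = 1 := by
  ext i j
  simp [baseMatrix, ddx, Matrix.one_apply, Pi.single_apply]

theorem wedge_dx (v : Fin m → JetCoord m n k) : wedge (dx n k) v = (baseMatrix v).det :=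
  (Matrix.det_transpose (baseMatrix v))

theorem wedge_dx_of_vertical {v : Fin m → JetCoord m n k} {a : Fin m} (ha : (v a).1 = 0) :
    wedge (dx n k) v = 0 := by
  rw [wedge_apply]
  refine (detForm m).map_coord_zero a ?_
  funext b
  simp [dx, ha]

theorem wedge_update_of_vertical (i a : Fin m) (ℓ : JetCoord m n k →L[ℝ] ℝ)
    (v : Fin m → JetCoord m n k) (ha : (v a).1 = 0) :
    wedge (Function.update (dx n k) i ℓ) v = ℓ (v a) * (baseMatrix v).adjugate a i := by
  classical
  set M : Fin m → Fin m → ℝ := fun c r => Function.update (dx n k) i ℓ r (v c) with hM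
  set M' : Fin m → Fin m → ℝ := Function.update (fun c => (v c).1) a (Pi.single i 1) with hM'
  have hMa : M = Function.update M a (ℓ (v a) • Pi.single i (1 : ℝ)) := by
    refine (Function.update_eq_self_iff.2 ?_).symm
    funext r
    by_cases hr : r = i
    · subst hr; simp [hM]
    · simp [hM, hr, dx, ha]
  have hdet : detForm m (Function.update M a (Pi.single i (1 : ℝ))) = detForm m M' := by
    refine Matrix.det_eq_of_forall_row_eq_smul_add_const
      (fun c => if c = a then 0 else ℓ (v c) - (v c).1 i) a (by simp) fun c r => ?_
    by_cases hc : c = a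
    · subst hc; simp [hM']
    · by_cases hr : r = i
      · subst hr; simp [hM, hM', hc]
      · simp [hM, hM', hc, hr, dx]
  rw [wedge_apply, adjugate_baseMatrix, ← hM', ← hdet]
  change detForm m M = _
  conv_lhs => rw [hMa, (detForm m).map_update_smul]
  rfl

/-- A form which vanishes on two vertical vectors and on `m - 1` coordinate vectors `∂/∂x^b`
together with one vertical vector is semibasic. -/
theorem eq_zero_of_vertical (ξ : (JetCoord m n k) [⋀^Fin m]→L[ℝ] ℝ)
    (h₂ : ∀ v : Fin m → JetCoord m n k, (∃ a b, a ≠ b ∧ (v a).1 = 0 ∧ (v b).1 = 0) → ξ v = 0)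
    (h₁ : ∀ i, ∀ w : JetCoord m n k, w.1 = 0 → ξ (Function.update (ddx n k) i w) = 0)
    (v : Fin m → JetCoord m n k) (a : Fin m) (ha : (v a).1 = 0) : ξ v = 0 := by
  classical
  have hcoord : ∀ s : Fin m → Fin m, ξ (Function.update (fun b => ddx n k (s b)) a (v a)) = 0 := by
    intro s
    by_cases hs : ∃ b c, b ≠ a ∧ c ≠ a ∧ b ≠ c ∧ s b = s c
    · obtain ⟨b, c, hb, hc, hbc, hsc⟩ := hs
      refine ξ.map_eq_zero_of_eq _ (i := b) (j := c) ?_ hbc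
      simp [hb, hc, hsc]
    · push Not at hs
      have himg : ((Finset.univ.erase a).image s).card < (Finset.univ : Finset (Fin m)).card :=
        Finset.card_image_le.trans_lt (Finset.card_erase_lt_of_mem (Finset.mem_univ a))
      obtain ⟨i, _, hi⟩ := Finset.exists_mem_notMem_of_card_lt_card himg
      have hi' : ∀ b, b ≠ a → s b ≠ i := fun b hb hbi =>
        hi (Finset.mem_image.2 ⟨b, by simp [hb], hbi⟩)
      have hinj : Function.Injective (Function.update s a i) := by
        intro b c hbc
        by_cases hb : b = a <;> by_cases hc : c = a
        · rw [hb, hc]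
        · subst hb; simp [hc] at hbc; exact absurd hbc.symm (hi' c hc)
        · subst hc; simp [hb] at hbc; exact absurd hbc (hi' b hb)
        · simp [hb, hc] at hbc
          by_contra hne
          exact hs b c hb hc hne hbc
      set σ : Equiv.Perm (Fin m) := Equiv.ofBijective _ (Finite.injective_iff_bijective.1 hinj)
      have hσ : Function.update (fun b => ddx n k (s b)) a (v a) =
          Function.update (ddx n k) i (v a) ∘ σ := by
        funext b
        by_cases hb : b = a
        · subst hb; simp [σ]
        · simp [σ, hb, hi' b hb]
      rw [hσ, show ξ (Function.update (ddx n k) i (v a) ∘ σ) = _ from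
        ξ.toAlternatingMap.map_perm _ σ]
      have := h₁ i (v a) ha
      simp only [ContinuousAlternatingMap.coe_toAlternatingMap, this, smul_zero]
  set g : Fin m → Option (Fin m) → JetCoord m n k := fun b o =>
    o.elim (if b = a then v a else (0, (v b).2)) fun c => if b = a then 0 else (v b).1 c • ddx n k c
    with hg
  have hv : v = fun b => ∑ o, g b o := by
    funext b
    rw [Fintype.sum_option]
    by_cases hb : b = a
    · subst hb; simp [hg]
    · simp only [hg, hb, if_false, Option.elim]
      refine Prod.ext ?_ ?_
      · funext r
        simp [Prod.fst_sum, ddx, Finset.sum_apply, Pi.single_apply]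
      · simp [Prod.snd_sum, ddx]
  rw [hv, show ξ (fun b => ∑ o, g b o) = _ from ξ.toMultilinearMap.map_sum g]
  refine Finset.sum_eq_zero fun r _ => ?_
  change ξ (fun b => g b (r b)) = 0
  by_cases hra : r a = none
  · by_cases hr : ∃ b, b ≠ a ∧ r b = none
    · obtain ⟨b, hb, hrb⟩ := hr
      exact h₂ _ ⟨a, b, hb.symm, by simp [hg, hra, ha], by simp [hg, hrb, hb]⟩
    · push Not at hr
      have hs : ∀ b, ∃ c, b ≠ a → r b = some c := fun b => by
        by_cases hb : b = a
        · exact ⟨a, fun h => absurd hb h⟩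
        · obtain ⟨c, hc⟩ := Option.ne_none_iff_exists'.1 (hr b hb)
          exact ⟨c, fun _ => hc⟩
      choose s hs using hs
      have e : (fun b => g b (r b)) = fun b => (if b = a then 1 else (v b).1 (s b)) •
          Function.update (fun b => ddx n k (s b)) a (v a) b := by
        funext b
        by_cases hb : b = a
        · subst hb; simp [hg, hra]
        · simp [hg, hs b hb, hb]
      rw [e]
      refine (ξ.toMultilinearMap.map_smul_univ _ _).trans ?_
      exact (congrArg (fun t => (∏ b, if b = a then (1 : ℝ) else (v b).1 (s b)) • t)
        (hcoord s)).trans (smul_zero _)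
  · obtain ⟨c, hc⟩ := Option.ne_none_iff_exists'.1 hra
    exact ξ.map_coord_zero a (by simp [hg, hc])

/-- The value of a form which vanishes on two vertical vectors on one vertical vector and `m - 1`
arbitrary vectors: a change of the base coordinates acts through the adjugate of its Jacobian. -/
theorem apply_of_vertical (ξ : (JetCoord m n k) [⋀^Fin m]→L[ℝ] ℝ)
    (h₂ : ∀ v : Fin m → JetCoord m n k, (∃ a b, a ≠ b ∧ (v a).1 = 0 ∧ (v b).1 = 0) → ξ v = 0)
    (v : Fin m → JetCoord m n k) (a : Fin m) (ha : (v a).1 = 0) :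
    ξ v = ∑ i, (baseMatrix v).adjugate a i * ξ (Function.update (ddx n k) i (v a)) := by
  set ℓ : Fin m → JetCoord m n k →L[ℝ] ℝ := fun i =>
    (ξ.toContinuousMultilinearMap.toContinuousLinearMap (ddx n k) i).comp
      ((ContinuousLinearMap.inr ℝ _ _).comp (ContinuousLinearMap.snd ℝ _ _)) with hℓ
  have hℓv : ∀ i, ∀ w : JetCoord m n k, w.1 = 0 → ℓ i w = ξ (Function.update (ddx n k) i w) := by
    intro i w hw
    have : w = (0, w.2) := Prod.ext hw rfl
    rw [this]
    rfl
  set D : (JetCoord m n k) [⋀^Fin m]→L[ℝ] ℝ :=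
    ξ - ∑ i, wedge (Function.update (dx n k) i (ℓ i)) with hD
  have hDv : ∀ v : Fin m → JetCoord m n k, ∀ a, (v a).1 = 0 →
      D v = ξ v - ∑ i, ξ (Function.update (ddx n k) i (v a)) * (baseMatrix v).adjugate a i := by
    intro v a ha
    simp only [hD, ContinuousAlternatingMap.sub_apply, ContinuousAlternatingMap.sum_apply]
    congr 1
    refine Finset.sum_congr rfl fun i _ => ?_
    rw [wedge_update_of_vertical i a _ v ha, hℓv i _ ha]
  have h := eq_zero_of_vertical D ?_ ?_ v a ha
  · rw [hDv v a ha, sub_eq_zero] at h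
    rw [h]
    exact Finset.sum_congr rfl fun i _ => mul_comm _ _
  · rintro v ⟨a, b, hab, hva, hvb⟩
    rw [hDv v a hva, h₂ v ⟨a, b, hab, hva, hvb⟩, zero_sub, neg_eq_zero]
    refine Finset.sum_eq_zero fun i _ => ?_
    rw [adjugate_baseMatrix, (detForm m).map_coord_zero b, mul_zero]
    simpa [hab.symm] using hvb
  · intro i w hw
    have hb : (baseMatrix (Function.update (ddx n k) i w)).adjugate i =
        (1 : Matrix (Fin m) (Fin m) ℝ) i := by
      funext j
      rw [adjugate_baseMatrix, ← Matrix.adjugate_one, ← baseMatrix_ddx (n := n) (k := k),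
        adjugate_baseMatrix]
      congr 1
      funext c
      by_cases hc : c = i
      · subst hc; simp
      · simp [hc]
    rw [hDv _ i (by simpa using hw)]
    simp [hb, Matrix.one_apply]

theorem momentumForm_apply_of_vertical (p : ℝ) (p₁ : Fin m → Fin n → ℝ)
    (p₂ : Sym (Fin m) 2 → Fin n → ℝ) (v : Fin m → JetCoord m n 1) (a : Fin m)
    (ha : (v a).1 = 0) : momentumForm p p₁ p₂ v =
      ∑ i, (∑ α, p₁ i α * (v a).2 (MultiIndex.zero m 1) α +
        ∑ j, ∑ α, (1 / nfac j i) * p₂ (pairIndex j i) α * (v a).2 (MultiIndex.single 0 j) α) *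
          (baseMatrix v).adjugate a i := by
  simp only [momentumForm, ContinuousAlternatingMap.add_apply, ContinuousAlternatingMap.sum_apply,
    ContinuousAlternatingMap.smul_apply, wedge_dx_of_vertical ha, smul_eq_mul, mul_zero, zero_add,
    wedge_update_of_vertical _ a _ v ha, add_mul, Finset.sum_add_distrib, Finset.sum_mul]
  congr 1
  · refine Finset.sum_congr rfl fun i _ => Finset.sum_congr rfl fun α _ => ?_
    rw [← mul_assoc]
    rfl
  · rw [Finset.sum_comm]
    refine Finset.sum_congr rfl fun i _ => Finset.sum_congr rfl fun j _ =>
      Finset.sum_congr rfl fun α _ => ?_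
    rw [← mul_assoc]
    rfl

theorem momentumForm_vertical_two (p : ℝ) (p₁ : Fin m → Fin n → ℝ)
    (p₂ : Sym (Fin m) 2 → Fin n → ℝ) (v : Fin m → JetCoord m n 1)
    (hv : ∃ a b, a ≠ b ∧ (v a).1 = 0 ∧ (v b).1 = 0) : momentumForm p p₁ p₂ v = 0 := by
  obtain ⟨a, b, hab, ha, hb⟩ := hv
  rw [momentumForm_apply_of_vertical p p₁ p₂ v a ha]
  refine Finset.sum_eq_zero fun i _ => ?_
  rw [adjugate_baseMatrix, (detForm m).map_coord_zero b, mul_zero]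
  simpa [hab.symm] using hb

theorem adjugate_baseMatrix_update (v : Fin m → JetCoord m n k) (a : Fin m) (w : JetCoord m n k)
    (i : Fin m) : (baseMatrix (Function.update v a w)).adjugate a i =
      (baseMatrix v).adjugate a i := by
  rw [adjugate_baseMatrix, adjugate_baseMatrix]
  congr 1
  funext c
  by_cases hc : c = a
  · subst hc; simp
  · simp [hc]

theorem momentumForm_update_ddx (p : ℝ) (p₁ : Fin m → Fin n → ℝ)
    (p₂ : Sym (Fin m) 2 → Fin n → ℝ) (a : Fin m) (w : JetCoord m n 1) (hw : w.1 = 0) :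
    momentumForm p p₁ p₂ (Function.update (ddx n 1) a w) =
      ∑ α, p₁ a α * w.2 (MultiIndex.zero m 1) α +
        ∑ j, ∑ α, (1 / nfac j a) * p₂ (pairIndex j a) α * w.2 (MultiIndex.single 0 j) α := by
  rw [momentumForm_apply_of_vertical p p₁ p₂ _ a (by simpa using hw)]
  simp [adjugate_baseMatrix_update, baseMatrix_ddx, Matrix.one_apply]

end Forms

/-! ### Adapted charts and local sections -/

section Charts

variable {m n : ℕ} {M E : Type*}
  [TopologicalSpace M] [ChartedSpace (Fin m → ℝ) M]
  [TopologicalSpace E] [ChartedSpace ((Fin m → ℝ) × (Fin n → ℝ)) E]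
  {π : E → M}

namespace AdaptedChart

variable (e e' e'' : AdaptedChart (m := m) (n := n) π)

/-- The change of base coordinates from `e` to `e'`. -/
def baseChange (x : Fin m → ℝ) : Fin m → ℝ := e'.base (e.base.symm x)

/-- The fibre component of the change of coordinates of `E` from `e` to `e'`. -/
def fibreChange (p : (Fin m → ℝ) × (Fin n → ℝ)) : Fin n → ℝ := (e'.total (e.total.symm p)).2

/-- The coordinates in `e` of the common domain of `e` and `e'`. -/
def overlap : Set ((Fin m → ℝ) × (Fin n → ℝ)) :=
  e.total.target ∩ e.total.symm ⁻¹' e'.total.source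

theorem isOpen_overlap : IsOpen (e.overlap e') :=
  e.total.isOpen_inter_preimage_symm e'.total.open_source

variable {e e' e''}

theorem mem_base_target {p : (Fin m → ℝ) × (Fin n → ℝ)} (hp : p ∈ e.total.target) :
    p.1 ∈ e.base.target ∧ e.base.symm p.1 = π (e.total.symm p) := by
  have hq := e.total.map_target hp
  have h := e.fst_eq _ hq
  rw [e.total.right_inv hp] at h
  have hb := e.mapsTo _ hq
  rw [h]
  exact ⟨e.base.map_source hb, e.base.left_inv hb⟩

theorem symm_mem_of_overlap {p : (Fin m → ℝ) × (Fin n → ℝ)} (hp : p ∈ e.overlap e') :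
    e.base.symm p.1 ∈ e'.base.source := by
  rw [(mem_base_target hp.1).2]
  exact e'.mapsTo _ hp.2

theorem total_eq_of_overlap {p : (Fin m → ℝ) × (Fin n → ℝ)} (hp : p ∈ e.overlap e') :
    e'.total (e.total.symm p) = (e.baseChange e' p.1, e.fibreChange e' p) := by
  refine Prod.ext ?_ rfl
  rw [e'.fst_eq _ hp.2]
  simp only [baseChange, (mem_base_target hp.1).2]

theorem overlap_symm {p : (Fin m → ℝ) × (Fin n → ℝ)} (hp : p ∈ e.overlap e') :
    (e.baseChange e' p.1, e.fibreChange e' p) ∈ e'.overlap e := by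
  rw [← total_eq_of_overlap hp]
  refine ⟨e'.total.map_source hp.2, ?_⟩
  rw [Set.mem_preimage, e'.total.left_inv hp.2]
  exact e.total.map_target hp.1

theorem baseChange_baseChange {x : Fin m → ℝ} (hx : x ∈ e.base.target)
    (hx' : e.base.symm x ∈ e'.base.source) : e'.baseChange e (e.baseChange e' x) = x := by
  simp only [baseChange, e'.base.left_inv hx', e.base.right_inv hx]

theorem smoothNear_baseChange {x : Fin m → ℝ} (hx : x ∈ e.base.target)
    (hx' : e.base.symm x ∈ e'.base.source) : SmoothNear (e.baseChange e') x := by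
  have h1 : ContMDiffOn 𝓘(ℝ, Fin m → ℝ) 𝓘(ℝ, Fin m → ℝ) ∞ (e.baseChange e')
      (e.base.target ∩ e.base.symm ⁻¹' e'.base.source) :=
    (contMDiffOn_of_mem_maximalAtlas e'.base_mem).comp
      ((contMDiffOn_symm_of_mem_maximalAtlas e.base_mem).mono Set.inter_subset_left)
      Set.inter_subset_right
  exact .of_contDiffOn (contMDiffOn_iff_contDiffOn.1 h1)
    (e.base.isOpen_inter_preimage_symm e'.base.open_source) ⟨hx, hx'⟩

theorem smoothNear_fibreChange {p : (Fin m → ℝ) × (Fin n → ℝ)} (hp : p ∈ e.overlap e') :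
    SmoothNear (e.fibreChange e') p := by
  have h1 : ContMDiffOn 𝓘(ℝ, (Fin m → ℝ) × (Fin n → ℝ)) 𝓘(ℝ, (Fin m → ℝ) × (Fin n → ℝ)) ∞
      (fun p => e'.total (e.total.symm p)) (e.overlap e') :=
    (contMDiffOn_of_mem_maximalAtlas e'.total_mem).comp
      ((contMDiffOn_symm_of_mem_maximalAtlas e.total_mem).mono Set.inter_subset_left)
      Set.inter_subset_right
  exact .of_contDiffOn (contDiff_snd.comp_contDiffOn (contMDiffOn_iff_contDiffOn.1 h1))
    (e.isOpen_overlap e') hp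

section Sections

variable {φ : M → E} {x : M}

theorem total_section (hφ : IsLocalSection (m := m) (n := n) π φ x) (hx : φ x ∈ e.total.source) :
    x ∈ e.base.source ∧ e.total (φ x) = (e.base x, e.expr φ (e.base x)) := by
  obtain ⟨V, _, hxV, _, hV⟩ := hφ
  have hb : x ∈ e.base.source := by
    have := e.mapsTo _ hx
    rwa [hV x hxV] at this
  refine ⟨hb, Prod.ext ?_ ?_⟩
  · rw [e.fst_eq _ hx, hV x hxV]
  · simp [expr, e.base.left_inv hb]

theorem mem_target_section (hφ : IsLocalSection (m := m) (n := n) π φ x)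
    (hx : φ x ∈ e.total.source) : (e.base x, e.expr φ (e.base x)) ∈ e.total.target := by
  rw [← (total_section hφ hx).2]
  exact e.total.map_source hx

theorem mem_overlap_section (hφ : IsLocalSection (m := m) (n := n) π φ x)
    (hx : φ x ∈ e.total.source) (hx' : φ x ∈ e'.total.source) :
    (e.base x, e.expr φ (e.base x)) ∈ e.overlap e' := by
  refine ⟨mem_target_section hφ hx, ?_⟩
  rw [← (total_section hφ hx).2, Set.mem_preimage, e.total.left_inv hx]
  exact hx'

theorem _root_.SecondOrderField.IsLocalSection.eventually
    (hφ : IsLocalSection (m := m) (n := n) π φ x) (hx : φ x ∈ e.total.source) :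
    ∀ᶠ y in 𝓝 (e.base x), y ∈ e.base.target ∧
      IsLocalSection (m := m) (n := n) π φ (e.base.symm y) ∧
        φ (e.base.symm y) ∈ e.total.source := by
  have hb := (total_section hφ hx).1
  obtain ⟨V, hVo, hxV, hVs, hV⟩ := hφ
  have ht : Filter.Tendsto e.base.symm (𝓝 (e.base x)) (𝓝 x) := by
    have := e.base.continuousAt_symm (e.base.map_source hb)
    rwa [ContinuousAt, e.base.left_inv hb] at this
  have hc : ContinuousAt φ x := hVs.continuousOn.continuousAt (hVo.mem_nhds hxV)
  filter_upwards [e.base.open_target.mem_nhds (e.base.map_source hb),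
    ht.eventually (hVo.mem_nhds hxV),
    ht.eventually (hc.eventually (e.total.open_source.mem_nhds hx))] with y h1 h2 h3
  exact ⟨h1, ⟨V, hVo, h2, hVs, hV⟩, h3⟩

theorem expr_eventuallyEq (hφ : IsLocalSection (m := m) (n := n) π φ x)
    (hx : φ x ∈ e.total.source) (hx' : φ x ∈ e'.total.source) :
    e'.expr φ =ᶠ[𝓝 (e'.base x)] fun y =>
      e.fibreChange e' (e'.baseChange e y, e.expr φ (e'.baseChange e y)) := by
  have hb := (total_section hφ hx).1
  have hb' := (total_section hφ hx').1
  have ht : Filter.Tendsto (e'.baseChange e) (𝓝 (e'.base x)) (𝓝 (e.base x)) := by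
    have h1 := e'.base.continuousAt_symm (e'.base.map_source hb')
    rw [ContinuousAt, e'.base.left_inv hb'] at h1
    exact (e.base.continuousAt hb).tendsto.comp h1
  have hs' : ∀ᶠ y in 𝓝 (e'.base x), e'.base.symm y ∈ e.base.source := by
    refine (e'.base.continuousAt_symm (e'.base.map_source hb')).eventually ?_
    rw [e'.base.left_inv hb']
    exact e.base.open_source.mem_nhds hb
  filter_upwards [hφ.eventually hx', ht.eventually (hφ.eventually hx), hs'] with y hy hy' hs
  have h2 : e.base.symm (e'.baseChange e y) = e'.base.symm y := by
    simp [baseChange, e.base.left_inv hs]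
  have h3 := total_section hy'.2.1 hy'.2.2
  rw [e.base.right_inv hy'.1] at h3
  simp only [fibreChange]
  rw [← h3.2, e.total.left_inv hy'.2.2, h2]
  rfl


theorem smoothNear_expr (hφ : IsLocalSection (m := m) (n := n) π φ x)
    (hx : φ x ∈ e.total.source) : SmoothNear (e.expr φ) (e.base x) := by
  have hb := (total_section hφ hx).1
  obtain ⟨V, hVo, hxV, hVs, hV⟩ := hφ
  have hO : IsOpen (V ∩ φ ⁻¹' e.total.source) :=
    hVs.continuousOn.isOpen_inter_preimage hVo e.total.open_source
  have h1 : ContMDiffOn 𝓘(ℝ, Fin m → ℝ) 𝓘(ℝ, (Fin m → ℝ) × (Fin n → ℝ)) ∞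
      (fun y => e.total (φ (e.base.symm y)))
      (e.base.target ∩ e.base.symm ⁻¹' (V ∩ φ ⁻¹' e.total.source)) :=
    (contMDiffOn_of_mem_maximalAtlas e.total_mem).comp
      (hVs.comp ((contMDiffOn_symm_of_mem_maximalAtlas e.base_mem).mono Set.inter_subset_left)
        fun y hy => hy.2.1) fun y hy => hy.2.2
  refine .of_contDiffOn (contDiff_snd.comp_contDiffOn (contMDiffOn_iff_contDiffOn.1 h1))
    (e.base.isOpen_inter_preimage_symm hO) ⟨e.base.map_source hb, ?_⟩
  rw [Set.mem_preimage, e.base.left_inv hb]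
  exact ⟨hxV, hx⟩

/-- The local section with coordinate expression `f`. -/
def mkSection (e : AdaptedChart (m := m) (n := n) π) (f : (Fin m → ℝ) → (Fin n → ℝ)) (x : M) : E :=
  e.total.symm (e.base x, f (e.base x))

variable {f : (Fin m → ℝ) → (Fin n → ℝ)} {y : Fin m → ℝ}

theorem mkSection_apply (hy : (y, f y) ∈ e.total.target) :
    e.mkSection f (e.base.symm y) = e.total.symm (y, f y) := by
  simp [mkSection, e.base.right_inv (mem_base_target hy).1]

theorem isLocalSection_mkSection (hf : SmoothNear f y) (hy : (y, f y) ∈ e.total.target) :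
    IsLocalSection (m := m) (n := n) π (e.mkSection f) (e.base.symm y) := by
  have hc : ContinuousAt (fun y => (y, f y)) y := continuousAt_id.prodMk hf.self.continuousAt
  obtain ⟨O, hO, hOo, hyO⟩ := eventually_nhds_iff.1
    (hf.and (hc.eventually (e.total.open_target.mem_nhds hy)))
  have hb := (mem_base_target hy).1
  refine ⟨e.base.source ∩ e.base ⁻¹' O, e.base.isOpen_inter_preimage hOo,
    ⟨e.base.map_target hb, by simpa [e.base.right_inv hb] using hyO⟩, ?_, ?_⟩
  · have hs : ContDiffOn ℝ ∞ (fun y => (y, f y)) O := fun y hy =>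
      (contDiffAt_id.prodMk (hO y hy).1).contDiffWithinAt
    exact (contMDiffOn_symm_of_mem_maximalAtlas e.total_mem).comp
      ((contMDiffOn_iff_contDiffOn.2 hs).comp
        ((contMDiffOn_of_mem_maximalAtlas e.base_mem).mono Set.inter_subset_left)
        Set.inter_subset_right) fun z hz => (hO _ hz.2).2
  · rintro z ⟨hz, hzO⟩
    have h := mem_base_target (hO _ hzO).2
    rw [e.base.left_inv hz] at h
    exact h.2.symm

theorem expr_mkSection (hf : SmoothNear f y) (hy : (y, f y) ∈ e.total.target) :
    e.expr (e.mkSection f) =ᶠ[𝓝 y] f := by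
  have hc : ContinuousAt (fun y => (y, f y)) y := continuousAt_id.prodMk hf.self.continuousAt
  filter_upwards [hc.eventually (e.total.open_target.mem_nhds hy)] with z hz
  simp only [expr, mkSection_apply hz, e.total.right_inv hz]

end Sections

end AdaptedChart

end Charts

/-! ### Natural coordinates of jets -/

section Jets

variable {m n : ℕ} {M E : Type*}
  [TopologicalSpace M] [ChartedSpace (Fin m → ℝ) M]
  [TopologicalSpace E] [ChartedSpace ((Fin m → ℝ) × (Fin n → ℝ)) E]
  {π : E → M}

theorem JetBundle.exists_rep {k : ℕ} (z : JetBundle m n π k) :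
    ∃ (φ : M → E) (h : IsLocalSection (m := m) (n := n) π φ z.1), z = jet k φ z.1 h := by
  obtain ⟨x, q⟩ := z
  induction q using Quotient.inductionOn with
  | h φ => exact ⟨φ.1, φ.2, rfl⟩

theorem JetBundle.toE_proj {k r : ℕ} (h : r ≤ k) (z : JetBundle m n π k) :
    (z.proj r h).toE = z.toE := by
  obtain ⟨φ, hφ, hz⟩ := z.exists_rep
  rw [hz]
  rfl

namespace AdaptedChart

variable {e e' e'' : AdaptedChart (m := m) (n := n) π} {k : ℕ} {φ : M → E} {x : M}

theorem jetCoord_jet (h : IsLocalSection (m := m) (n := n) π φ x) (hx : φ x ∈ e.total.source) :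
    e.jetCoord k (jet k φ x h) = prolong k (e.expr φ) (e.base x) := by
  have hr : (jetSetoid (m := m) (n := n) π k x).r
      (Quotient.out (Quotient.mk (jetSetoid (m := m) (n := n) π k x) ⟨φ, h⟩)) ⟨φ, h⟩ :=
    Quotient.mk_out (s := jetSetoid (m := m) (n := n) π k x) ⟨φ, h⟩
  refine Prod.ext rfl (funext fun I => ?_)
  refine hr.2 e ?_ _ ?_
  · rw [hr.1]; exact hx
  · rw [Multiset.length_sort]; exact I.2

theorem jetCoord_proj {r : ℕ} (h : r ≤ k) (z : JetBundle m n π k) (hz : z ∈ e.jetSource k) :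
    e.jetCoord r (z.proj r h) = coordProj h (e.jetCoord k z) := by
  obtain ⟨φ, hφ, hz'⟩ := z.exists_rep
  have hx : φ z.1 ∈ e.total.source := by
    have := hz
    rw [hz'] at this
    exact this
  rw [hz', show (jet k φ z.1 hφ).proj r h = jet r φ z.1 hφ from rfl, jetCoord_jet hφ hx,
    jetCoord_jet hφ hx, coordProj_prolong]

/-- A jet in the domain of `e` is represented by a section whose coordinate expression
prolongs to its natural coordinates. -/
theorem exists_rep_of_mem {z : JetBundle m n π k} (hz : z ∈ e.jetSource k) :
    ∃ (φ : M → E) (h : IsLocalSection (m := m) (n := n) π φ z.1), z = jet k φ z.1 h ∧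
      φ z.1 ∈ e.total.source ∧ z.toE = φ z.1 ∧
      e.jetCoord k z = prolong k (e.expr φ) (e.base z.1) := by
  obtain ⟨φ, hφ, hz'⟩ := z.exists_rep
  have hx : z.toE = φ z.1 := by
    conv_lhs => rw [hz']
    rfl
  have hx' : φ z.1 ∈ e.total.source := by rw [← hx]; exact hz
  refine ⟨φ, hφ, hz', hx', hx, ?_⟩
  conv_lhs => rw [hz']
  exact jetCoord_jet hφ hx'

theorem jetCoord_mem_target {z : JetBundle m n π k} (hz : z ∈ e.jetSource k) :
    e.jetCoord k z ∈ e.jetTarget k := by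
  obtain ⟨φ, hφ, -, hx, -, hc⟩ := exists_rep_of_mem hz
  rw [hc]
  rw [jetTarget, Set.mem_ofPred_eq, prolong_zero]
  exact mem_target_section hφ hx

/-- Equality of natural coordinates in one chart is equality of jets, since the chain rule carries
equality of partial derivatives to all other charts. -/
theorem jet_eq_of_prolong_eq {φ' : M → E} {x' : M}
    (hφ : IsLocalSection (m := m) (n := n) π φ x) (hφ' : IsLocalSection (m := m) (n := n) π φ' x')
    (hx : φ x ∈ e.total.source) (hx' : φ' x' ∈ e.total.source)
    (hzz : prolong k (e.expr φ) (e.base x) = prolong k (e.expr φ') (e.base x')) :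
    jet k φ x hφ = jet k φ' x' hφ' := by
  have hxx : x = x' :=
    e.base.injOn (total_section hφ hx).1 (total_section hφ' hx').1 (congrArg Prod.fst hzz)
  subst hxx
  have hb := total_section hφ hx
  have hb' := total_section hφ' hx'
  have hs := smoothNear_expr hφ hx
  have hs' := smoothNear_expr hφ' hx'
  have hval : φ x = φ' x := by
    refine e.total.injOn hx hx' ?_
    rw [hb.2, hb'.2, ← prolong_zero (f := e.expr φ) k, hzz, prolong_zero]
  have hsame := (prolong_eq_iff_sameJet hs hs' k).1 hzz
  refine congrArg (Sigma.mk x) (Quotient.sound (s := jetSetoid (m := m) (n := n) π k x)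
    ⟨hval, fun e' he' l hl => ?_⟩)
  have he'' : φ' x ∈ e'.total.source := hval ▸ he'
  rw [(partials_congr (expr_eventuallyEq hφ hx he') l).self_of_nhds,
    (partials_congr (expr_eventuallyEq hφ' hx' he'') l).self_of_nhds]
  have hov := mem_overlap_section hφ hx he'
  have hg := smoothNear_baseChange (overlap_symm hov |> fun h => (mem_base_target h.1).1)
    (symm_mem_of_overlap (overlap_symm hov))
  have hbb : e.baseChange e' (e.base x) = e'.base x := by
    simp [baseChange, e.base.left_inv hb.1]
  have hgg : e'.baseChange e (e'.base x) = e.base x := by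
    simp [baseChange, e'.base.left_inv (total_section hφ he').1]
  simp only [hbb] at hg
  refine SameJet.comp (f₁ := e.expr φ) (f₂ := e.expr φ') (g := e'.baseChange e)
    (F := e.fibreChange e') ?_ ?_ hg ?_ ?_ l hl
  · rw [hgg]; exact hs
  · rw [hgg]; exact hs'
  · rw [hgg]; exact smoothNear_fibreChange hov
  · rw [hgg]; exact hsame

/-- Natural coordinates separate the jets in their domain. -/
theorem jetCoord_injOn : Set.InjOn (e.jetCoord k) (e.jetSource k) := by
  intro z hz z' hz' hzz
  obtain ⟨φ, hφ, hj, hx, -, hc⟩ := exists_rep_of_mem hz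
  obtain ⟨φ', hφ', hj', hx', -, hc'⟩ := exists_rep_of_mem hz'
  rw [hj, hj']
  exact jet_eq_of_prolong_eq hφ hφ' hx hx' (by rw [← hc, ← hc', hzz])

/-- The jet in the domain of `e` of the local section with coordinate expression `f`. -/
theorem exists_jet_of_expr {f : (Fin m → ℝ) → (Fin n → ℝ)} {y : Fin m → ℝ}
    (hf : SmoothNear f y) (hy : (y, f y) ∈ e.total.target) (k : ℕ) :
    ∃ (h : IsLocalSection (m := m) (n := n) π (e.mkSection f) (e.base.symm y)),
      jet k (e.mkSection f) (e.base.symm y) h ∈ e.jetSource k ∧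
      e.mkSection f (e.base.symm y) = e.total.symm (y, f y) ∧
      e.jetCoord k (jet k (e.mkSection f) (e.base.symm y) h) = prolong k f y := by
  have h := isLocalSection_mkSection hf hy
  have hv := mkSection_apply (f := f) hy
  have hs : e.mkSection f (e.base.symm y) ∈ e.total.source := by
    rw [hv]; exact e.total.map_target hy
  refine ⟨h, hs, hv, ?_⟩
  rw [jetCoord_jet h hs, e.base.right_inv (mem_base_target hy).1]
  exact prolong_congr (expr_mkSection hf hy) k

theorem exists_jetCoord_eq {c : JetCoord m n k} (hc : c ∈ e.jetTarget k) :
    ∃ z ∈ e.jetSource k, e.jetCoord k z = c := by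
  obtain ⟨f, hf, hfc⟩ := exists_prolong_eq c
  have h0 : f c.1 = c.2 (MultiIndex.zero m k) := by
    rw [← prolong_zero (f := f) k, hfc]
  obtain ⟨h, h1, -, h2⟩ := exists_jet_of_expr (e := e) (f := f) (y := c.1) (.of_contDiff hf)
    (by rw [h0]; exact hc) k
  exact ⟨_, h1, h2.trans hfc⟩

theorem coordExpr_jetCoord {Y : Type*} [Zero Y] (g : JetBundle m n π k → Y) {z : JetBundle m n π k}
    (hz : z ∈ e.jetSource k) :
    coordExpr (e.jetSource k) (e.jetCoord k) g (e.jetCoord k z) = g z :=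
  (Set.injOn_iff_injective.1 jetCoord_injOn).extend_apply _ _ (⟨z, hz⟩ : e.jetSource k)

theorem isOpen_jetTarget : IsOpen (e.jetTarget k) :=
  e.total.open_target.preimage (by fun_prop)

end AdaptedChart

end Jets

/-! ### Existence of adapted charts -/

section Existence

variable {m n : ℕ} {M E : Type*}
  [TopologicalSpace M] [ChartedSpace (Fin m → ℝ) M]
  [TopologicalSpace E] [ChartedSpace ((Fin m → ℝ) × (Fin n → ℝ)) E]
  [IsManifold 𝓘(ℝ, (Fin m → ℝ) × (Fin n → ℝ)) ∞ E] {π : E → M}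

/-- The charts in which a submersion is a projection are adapted charts. -/
theorem exists_adaptedChart
    (hsubm : Manifold.IsSubmersionOfComplement (Fin n → ℝ)
      𝓘(ℝ, (Fin m → ℝ) × (Fin n → ℝ)) 𝓘(ℝ, Fin m → ℝ) ∞ π) (p : E) :
    ∃ e : AdaptedChart (m := m) (n := n) π, p ∈ e.total.source := by
  have h := hsubm p
  set T := h.equiv with hT
  have hwr := h.writtenInCharts
  refine ⟨⟨h.domChart.trans T.toHomeomorph.toOpenPartialHomeomorph, h.codChart, ?_,
    h.codChart_mem_maximalAtlas, ?_, ?_⟩, ?_⟩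
  · refine OpenPartialHomeomorph.mem_maximalAtlas_of_contMDiffOn _ ?_ ?_
    · have h1 := contMDiffOn_of_mem_maximalAtlas h.domChart_mem_maximalAtlas
      have h2 : ContMDiff 𝓘(ℝ, (Fin m → ℝ) × (Fin n → ℝ)) 𝓘(ℝ, (Fin m → ℝ) × (Fin n → ℝ)) ∞ T :=
        T.contDiff.contMDiff
      exact h2.comp_contMDiffOn (h1.mono (by simp))
    · have h1 := contMDiffOn_symm_of_mem_maximalAtlas h.domChart_mem_maximalAtlas
      have h2 : ContMDiff 𝓘(ℝ, (Fin m → ℝ) × (Fin n → ℝ)) 𝓘(ℝ, (Fin m → ℝ) × (Fin n → ℝ)) ∞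
          T.symm := T.symm.contDiff.contMDiff
      refine h1.comp h2.contMDiffOn ?_
      intro q hq
      simpa using hq
  · intro q hq
    exact h.source_subset_preimage_source (by simpa using hq)
  · intro q hq
    have hq' : q ∈ h.domChart.source := by simpa using hq
    have hw := @hwr (h.domChart q) (by simpa using h.domChart.map_source hq')
    simp [h.domChart.left_inv hq'] at hw
    simp [hw, hT]
  · simpa using h.mem_domChart_source

end Existence

/-! ### The Lagrangian density in natural coordinates -/

section Lagrangian

variable {m n : ℕ} {M E : Type*}
  [TopologicalSpace M] [ChartedSpace (Fin m → ℝ) M]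
  [TopologicalSpace E] [ChartedSpace ((Fin m → ℝ) × (Fin n → ℝ)) E]
  {π : E → M}

theorem alternating_apply_eq_det (ζ : (Fin m → ℝ) [⋀^Fin m]→L[ℝ] ℝ)
    (A : (Fin m → ℝ) →L[ℝ] (Fin m → ℝ)) :
    ζ (fun i => A (Pi.single i 1)) =
      (Matrix.of fun i j => A (Pi.single j 1) i : Matrix (Fin m) (Fin m) ℝ).det *
        ζ fun i => Pi.single i 1 := by
  have h := congrArg (fun F => F fun i => A (Pi.single i 1))
    (ζ.toAlternatingMap.eq_smul_basis_det (Pi.basisFun ℝ (Fin m)))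
  simp only [ContinuousAlternatingMap.coe_toAlternatingMap] at h
  refine h.trans ?_
  rw [AlternatingMap.smul_apply, Pi.basisFun_det_apply, smul_eq_mul, mul_comm,
    ← Matrix.det_transpose]
  congr 2
  funext i
  simp [Pi.basisFun_apply]

namespace AdaptedChart

variable {e e' : AdaptedChart (m := m) (n := n) π}

/-- The coefficient of a volume form is a density. -/
theorem volumeCoeff_change (η : (x : M) → (TangentSpace 𝓘(ℝ, Fin m → ℝ) x) [⋀^Fin m]→L[ℝ] ℝ)
    {x : Fin m → ℝ} (hx : x ∈ e.base.target) (hx' : e.base.symm x ∈ e'.base.source) :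
    volumeCoeff η e.base x =
      (jacobian (e.baseChange e') x).det * volumeCoeff η e'.base (e.baseChange e' x) := by
  have hd1 : MDifferentiableAt 𝓘(ℝ, Fin m → ℝ) 𝓘(ℝ, Fin m → ℝ) e'.base.symm
      (e.baseChange e' x) :=
    (contMDiffAt_symm_of_mem_maximalAtlas e'.base_mem (e'.base.map_source hx')).mdifferentiableAt
      (by simp)
  have hd2 : MDifferentiableAt 𝓘(ℝ, Fin m → ℝ) 𝓘(ℝ, Fin m → ℝ) (e.baseChange e') x :=
    (smoothNear_baseChange hx hx').differentiableAt.mdifferentiableAt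
  have he : (e.base.symm : (Fin m → ℝ) → M) =ᶠ[𝓝 x] e'.base.symm ∘ e.baseChange e' := by
    filter_upwards [(e.base.isOpen_inter_preimage_symm e'.base.open_source).mem_nhds ⟨hx, hx'⟩]
      with y hy
    simp [baseChange, e'.base.left_inv hy.2]
  have hm := he.mfderiv_eq (I := 𝓘(ℝ, Fin m → ℝ)) (I' := 𝓘(ℝ, Fin m → ℝ))
  rw [mfderiv_comp x hd1 hd2, mfderiv_eq_fderiv] at hm
  have hpt : e.base.symm x = e'.base.symm (e.baseChange e' x) := by
    simp [baseChange, e'.base.left_inv hx']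
  set B : (Fin m → ℝ) →L[ℝ] (Fin m → ℝ) :=
    mfderiv 𝓘(ℝ, Fin m → ℝ) 𝓘(ℝ, Fin m → ℝ) e'.base.symm (e.baseChange e' x) with hB
  set ζ : (p : M) → (Fin m → ℝ) [⋀^Fin m]→L[ℝ] ℝ := fun p => η p with hζ
  have h := alternating_apply_eq_det ((ζ (e.base.symm x)).compContinuousLinearMap B)
    (fderiv ℝ (e.baseChange e') x)
  have h1 : volumeCoeff η e.base x = ζ (e.base.symm x) fun i =>
      B (fderiv ℝ (e.baseChange e') x (Pi.single i 1)) := by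
    unfold volumeCoeff
    rw [hm]
    rfl
  have h2 : volumeCoeff η e'.base (e.baseChange e' x) =
      ζ (e.base.symm x) fun i => B (Pi.single i 1) := by
    rw [hpt]
    rfl
  rw [h1, h2]
  exact h

theorem localLagrangian_change
    (η : (x : M) → (TangentSpace 𝓘(ℝ, Fin m → ℝ) x) [⋀^Fin m]→L[ℝ] ℝ)
    (L : JetBundle m n π 2 → ℝ) {f : (Fin m → ℝ) → (Fin n → ℝ)} {x : Fin m → ℝ}
    (hf : SmoothNear f x) (hx : (x, f x) ∈ e.overlap e') :
    e.localLagrangian η L (prolong 2 f x) = (jacobian (e.baseChange e') x).det *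
      e'.localLagrangian η L (prolong 2
        (fun y => e.fibreChange e' (e'.baseChange e y, f (e'.baseChange e y)))
        (e.baseChange e' x)) := by
  obtain ⟨h, h1, h2, h3⟩ := exists_jet_of_expr (e := e) hf hx.1 2
  have hb := mem_base_target hx.1
  have hs : e.mkSection f (e.base.symm x) ∈ e.total.source := h1
  have hs' : e.mkSection f (e.base.symm x) ∈ e'.total.source := by rw [h2]; exact hx.2
  have h4 : e'.jetCoord 2 (jet 2 (e.mkSection f) (e.base.symm x) h) = prolong 2
      (fun y => e.fibreChange e' (e'.baseChange e y, f (e'.baseChange e y)))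
        (e.baseChange e' x) := by
    rw [jetCoord_jet h hs']
    refine prolong_congr ((expr_eventuallyEq h hs hs').trans ?_) 2
    have ht : Filter.Tendsto (e'.baseChange e) (𝓝 (e'.base (e.base.symm x))) (𝓝 x) := by
      have hov := overlap_symm hx
      have hg := (smoothNear_baseChange (mem_base_target hov.1).1
        (symm_mem_of_overlap hov)).self.continuousAt
      rw [ContinuousAt, baseChange_baseChange hb.1 (symm_mem_of_overlap hx)] at hg
      exact hg
    filter_upwards [ht.eventually (expr_mkSection hf hx.1)] with y hy
    rw [hy]
  simp only [localLagrangian]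
  rw [← h4, ← h3, coordExpr_jetCoord L h1, coordExpr_jetCoord L hs', h3, h4]
  change volumeCoeff η e.base x * _ = _ * (volumeCoeff η e'.base (e.baseChange e' x) * _)
  rw [volumeCoeff_change η hb.1 (symm_mem_of_overlap hx), mul_assoc]

theorem contDiffOn_localLagrangian
    {η : (x : M) → (TangentSpace 𝓘(ℝ, Fin m → ℝ) x) [⋀^Fin m]→L[ℝ] ℝ} (hη : IsVolumeForm η)
    {L : JetBundle m n π 2 → ℝ} (hL : IsSmoothOnJets L)
    (e : AdaptedChart (m := m) (n := n) π) :
    ContDiffOn ℝ ∞ (e.localLagrangian η L) (e.jetTarget 2) :=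
  ContDiffOn.mul (f := fun c : JetCoord m n 2 => volumeCoeff η e.base c.1)
    ((hη.1 e.base e.base_mem).comp contDiff_fst.contDiffOn
      fun c hc => (mem_base_target (e := e) (p := (c.1, c.2 (MultiIndex.zero m 2))) hc).1) (hL e)

/-- The base points near `e.base x` over which the section `φ` stays in the common domain of two
adapted charts. -/
theorem exists_overlap_nhds {φ : M → E} {x : M}
    (hφ : IsLocalSection (m := m) (n := n) π φ x) (hx : φ x ∈ e.total.source)
    (hx' : φ x ∈ e'.total.source) :
    ∃ U : Set (Fin m → ℝ), IsOpen U ∧ e.base x ∈ U ∧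
      ∀ y ∈ U, SmoothNear (e.expr φ) y ∧ (y, e.expr φ y) ∈ e.overlap e' := by
  have hs := smoothNear_expr hφ hx
  have hc : ContinuousAt (fun y => (y, e.expr φ y)) (e.base x) :=
    continuousAt_id.prodMk hs.self.continuousAt
  obtain ⟨U, hU, hUo, hxU⟩ := eventually_nhds_iff.1 (hs.eventually.and
    (hc.eventually ((e.isOpen_overlap e').mem_nhds (mem_overlap_section hφ hx hx'))))
  exact ⟨U, hUo, hxU, hU⟩

/-- The Legendre current of a Lagrangian density along a section does not depend on the adapted
chart. -/
theorem legendre_current_change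
    {η : (x : M) → (TangentSpace 𝓘(ℝ, Fin m → ℝ) x) [⋀^Fin m]→L[ℝ] ℝ} (hη : IsVolumeForm η)
    {L : JetBundle m n π 2 → ℝ} (hL : IsSmoothOnJets L) {φ : M → E} {x : M}
    (hφ : IsLocalSection (m := m) (n := n) π φ x) (hx : φ x ∈ e.total.source)
    (hx' : φ x ∈ e'.total.source) {V : (Fin m → ℝ) → (Fin n → ℝ)}
    (hV : SmoothNear V (e.base x)) (a : Fin m) :
    current (legendreOne (e.localLagrangian η L) (e.expr φ))
        (legendreTwo (e.localLagrangian η L) (e.expr φ)) V (e.base x) a =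
      ∑ i, (jacobian (e.baseChange e') (e.base x)).adjugate a i *
        current (legendreOne (e'.localLagrangian η L) (e'.expr φ))
          (legendreTwo (e'.localLagrangian η L) (e'.expr φ))
          (pushVariation (e.fibreChange e') (e'.baseChange e) (e.expr φ) V) (e'.base x) i := by
  obtain ⟨U, hUo, hxU, hU⟩ := exists_overlap_nhds hφ hx hx'
  have hbb : e.baseChange e' (e.base x) = e'.base x := by
    simp [baseChange, e.base.left_inv (total_section hφ hx).1]
  have hbase : ∀ y ∈ U, y ∈ e.base.target ∧ e.base.symm y ∈ e'.base.source := fun y hy =>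
    ⟨(mem_base_target (hU y hy).2.1).1, symm_mem_of_overlap (hU y hy).2⟩
  have hov : ∀ y ∈ U, (e.baseChange e' y, e.fibreChange e' (y, e.expr φ y)) ∈ e'.overlap e :=
    fun y hy => overlap_symm (hU y hy).2
  have hgh : ∀ y ∈ U, e'.baseChange e (e.baseChange e' y) = y := fun y hy =>
    baseChange_baseChange (hbase y hy).1 (hbase y hy).2
  have hLs : ∀ (e : AdaptedChart (m := m) (n := n) π) (f : (Fin m → ℝ) → (Fin n → ℝ)) y,
      (y, f y) ∈ e.total.target → SmoothNear (e.localLagrangian η L) (prolong 2 f y) := by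
    intro e f y hy
    refine .of_contDiffOn (contDiffOn_localLagrangian hη hL e) isOpen_jetTarget ?_
    rw [jetTarget, Set.mem_ofPred_eq, prolong_zero]
    exact hy
  have key := current_transform (V := V) hUo (f := e.expr φ) (h := e.baseChange e')
    (g := e'.baseChange e) (F := e.fibreChange e') (Λ := e.localLagrangian η L)
    (Λ' := e'.localLagrangian η L) (fun y hy => (hU y hy).1)
    (fun y hy => smoothNear_baseChange (hbase y hy).1 (hbase y hy).2)
    (fun y hy => smoothNear_baseChange (mem_base_target (hov y hy).1).1
      (symm_mem_of_overlap (hov y hy)))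
    hgh (fun y hy => smoothNear_fibreChange (hU y hy).2)
    (fun y hy => hLs e _ y (hU y hy).2.1)
    (fun y hy => hLs e' _ _ (by rw [hgh y hy]; exact (hov y hy).1)) ?_ hxU hV a
  · rw [hbb] at key
    rw [key]
    have he := expr_eventuallyEq hφ hx hx'
    refine Finset.sum_congr rfl fun i _ => ?_
    congr 1
    have h2 : ∀ i j, legendreTwo (e'.localLagrangian η L) (fun y => e.fibreChange e'
        (e'.baseChange e y, e.expr φ (e'.baseChange e y))) i j =ᶠ[𝓝 (e'.base x)]
        legendreTwo (e'.localLagrangian η L) (e'.expr φ) i j := by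
      intro i j
      filter_upwards [he.eventually_nhds] with y hy
      unfold legendreTwo
      rw [prolong_congr hy]
    have h1 : legendreOne (e'.localLagrangian η L) (fun y => e.fibreChange e'
        (e'.baseChange e y, e.expr φ (e'.baseChange e y))) i (e'.base x) =
        legendreOne (e'.localLagrangian η L) (e'.expr φ) i (e'.base x) := by
      unfold legendreOne
      rw [prolong_congr he]
      simp only [(h2 i _).fderiv_eq]
    simp only [current, h1, (h2 i _).self_of_nhds]
  · intro y hy W hW
    have hc : ContinuousAt (fun t : ℝ => (y, e.expr φ y + t • W y)) 0 := by fun_prop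
    filter_upwards [hc.eventually ((e.isOpen_overlap e').mem_nhds (by simpa using (hU y hy).2))]
      with t ht
    exact localLagrangian_change η L ((hU y hy).1.add ((SmoothNear.of_contDiff hW).const_smul t)) ht

end AdaptedChart

end Lagrangian

/-! ### Changes of natural coordinates of first-order jets -/

section Transition

variable {m n : ℕ} {M E : Type*}
  [TopologicalSpace M] [ChartedSpace (Fin m → ℝ) M]
  [TopologicalSpace E] [ChartedSpace ((Fin m → ℝ) × (Fin n → ℝ)) E]
  {π : E → M}

theorem multiIndex_one_cases (I : MultiIndex m 1) :
    I = MultiIndex.zero m 1 ∨ ∃ i, I = MultiIndex.single 0 i := by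
  obtain ⟨I, hI⟩ := I
  rcases Nat.le_one_iff_eq_zero_or_eq_one.1 hI with h | h
  · exact .inl (Subtype.ext (Multiset.card_eq_zero.1 h))
  · obtain ⟨i, rfl⟩ := Multiset.card_eq_one.1 h
    exact .inr ⟨i, rfl⟩

theorem inclU_single_zero (k : Fin m) (b : Fin n → ℝ) :
    (inclU (MultiIndex.single 0 k) b).2 (MultiIndex.zero m 1) = 0 := by
  have h : MultiIndex.zero m 1 ≠ MultiIndex.single 0 k := fun h =>
    Multiset.singleton_ne_zero k (congrArg Subtype.val h).symm
  simp [inclU, h]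

theorem inclU_single_of_ne {k l : Fin m} (hl : k ≠ l) (b : Fin n → ℝ) :
    (inclU (MultiIndex.single 0 k) b).2 (MultiIndex.single 0 l) = 0 := by
  have h : MultiIndex.single 0 l ≠ MultiIndex.single 0 k := fun h =>
    hl (Multiset.singleton_inj.1 (congrArg Subtype.val h)).symm
  simp [inclU, h]

theorem inclU_self {k : ℕ} (I : MultiIndex m k) (b : Fin n → ℝ) : (inclU I b).2 I = b := by
  simp [inclU]

theorem jetCoord_one_ext {c c' : JetCoord m n 1} (h : c.1 = c'.1)
    (h₀ : c.2 (MultiIndex.zero m 1) = c'.2 (MultiIndex.zero m 1))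
    (h₁ : ∀ i, c.2 (MultiIndex.single 0 i) = c'.2 (MultiIndex.single 0 i)) : c = c' := by
  refine Prod.ext h (funext fun I => ?_)
  rcases multiIndex_one_cases I with rfl | ⟨i, rfl⟩
  · exact h₀
  · exact h₁ i

namespace AdaptedChart

variable {e e' e'' : AdaptedChart (m := m) (n := n) π}

section

variable {f : (Fin m → ℝ) → (Fin n → ℝ)} {x : Fin m → ℝ}

theorem tendsto_baseChange {p : (Fin m → ℝ) × (Fin n → ℝ)} (hp : p ∈ e.overlap e') :
    Filter.Tendsto (e'.baseChange e) (𝓝 (e.baseChange e' p.1)) (𝓝 p.1) := by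
  have hov := overlap_symm hp
  have hg := (smoothNear_baseChange (mem_base_target hov.1).1
    (symm_mem_of_overlap hov)).self.continuousAt
  rwa [ContinuousAt, baseChange_baseChange (mem_base_target hp.1).1 (symm_mem_of_overlap hp)] at hg

theorem smoothNear_baseChange_symm {p : (Fin m → ℝ) × (Fin n → ℝ)} (hp : p ∈ e.overlap e') :
    SmoothNear (e'.baseChange e) (e.baseChange e' p.1) :=
  smoothNear_baseChange (mem_base_target (overlap_symm hp).1).1
    (symm_mem_of_overlap (overlap_symm hp))

theorem baseChange_baseChange_of_overlap {p : (Fin m → ℝ) × (Fin n → ℝ)} (hp : p ∈ e.overlap e') :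
    e'.baseChange e (e.baseChange e' p.1) = p.1 :=
  baseChange_baseChange (mem_base_target hp.1).1 (symm_mem_of_overlap hp)

theorem expr_mkSection_change (hf : SmoothNear f x) (hx : (x, f x) ∈ e.overlap e') :
    e'.expr (e.mkSection f) =ᶠ[𝓝 (e.baseChange e' x)]
      fun y => e.fibreChange e' (e'.baseChange e y, f (e'.baseChange e y)) := by
  obtain ⟨h, h1, h2, -⟩ := exists_jet_of_expr (e := e) hf hx.1 0
  refine (expr_eventuallyEq (e := e) (e' := e') h h1 ?_).trans ?_
  · rw [h2]; exact hx.2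
  · filter_upwards [(tendsto_baseChange hx).eventually (expr_mkSection hf hx.1)] with y hy
    rw [hy]

/-- The change of coordinates maps the prolongation of a section to its prolongation in the other
chart. -/
theorem transition_prolong (hf : SmoothNear f x) (hx : (x, f x) ∈ e.overlap e') :
    e.transition e' (prolong 1 f x) = prolong 1
      (fun y => e.fibreChange e' (e'.baseChange e y, f (e'.baseChange e y)))
      (e.baseChange e' x) := by
  set c := prolong 1 f x with hc
  -- `transition` is computed with the affine representative of a jet, which has the same 1-jet as `f`
  set aff : (Fin m → ℝ) → (Fin n → ℝ) := fun y =>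
    c.2 (MultiIndex.zero m 1) + ∑ i, (y i - c.1 i) • c.2 (MultiIndex.single 0 i) with haff
  have haffd : ContDiff ℝ ∞ aff := contDiff_const.add (ContDiff.sum fun i _ =>
    ((contDiff_apply ℝ ℝ i).sub contDiff_const).smul contDiff_const)
  have hs : SmoothNear aff x := .of_contDiff haffd
  have haffx : aff x = f x := by
    have h1 : c.2 (MultiIndex.zero m 1) = f x := prolong_zero 1
    have h2 : c.1 = x := rfl
    simp [haff, h1, h2]
  have haffc : prolong 1 aff x = prolong 1 f x := by
    refine jetCoord_one_ext rfl ?_ fun i => ?_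
    · rw [prolong_zero, prolong_zero, haffx]
    · rw [prolong_single 0, prolong_single 0]
      have hd : HasFDerivAt aff (∑ i, (ContinuousLinearMap.proj (R := ℝ)
          (φ := fun _ : Fin m => ℝ) i).smulRight (c.2 (MultiIndex.single 0 i))) x :=
        (HasFDerivAt.fun_sum fun i _ =>
          ((hasFDerivAt_apply (𝕜 := ℝ) i x).sub_const _).smul_const _).const_add _
      rw [hd.fderiv]
      simp only [_root_.sum_apply, ContinuousLinearMap.smulRight_apply,
        ContinuousLinearMap.proj_apply, Pi.single_apply, ite_smul, one_smul, zero_smul,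
        Finset.sum_ite_eq', Finset.mem_univ, if_true]
      rw [hc, prolong_single 0]
  have hxa : (x, aff x) ∈ e.overlap e' := by rw [haffx]; exact hx
  have h1 : e.transition e' c = prolong 1 (e'.expr (e.mkSection aff)) (e.baseChange e' x) := rfl
  rw [h1, prolong_congr (expr_mkSection_change hs hxa)]
  have hg := smoothNear_baseChange_symm hx
  have hgx := baseChange_baseChange_of_overlap hx
  simp only at hg hgx
  have hF := smoothNear_fibreChange hx
  have hF' := smoothNear_fibreChange hxa
  refine (prolong_eq_iff_sameJet ?_ ?_ 1).2 (SameJet.comp ?_ ?_ hg ?_ ?_)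
  · exact SmoothNear.comp (k := e.fibreChange e') (f := fun y => (e'.baseChange e y, aff _))
      (by rw [hgx]; exact hF') (hg.prodMk (SmoothNear.comp (by rw [hgx]; exact hs) hg))
  · exact SmoothNear.comp (k := e.fibreChange e') (f := fun y => (e'.baseChange e y, f _))
      (by rw [hgx]; exact hF) (hg.prodMk (SmoothNear.comp (by rw [hgx]; exact hf) hg))
  · rw [hgx]; exact hs
  · rw [hgx]; exact hf
  · rw [hgx]; exact hF'
  · rw [hgx]; exact (prolong_eq_iff_sameJet hs hf 1).1 haffc

end

theorem toE_eq {k : ℕ} {z : JetBundle m n π k} (hz : z ∈ e.jetSource k) :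
    z.toE = e.total.symm ((e.jetCoord k z).1, (e.jetCoord k z).2 (MultiIndex.zero m k)) := by
  obtain ⟨φ, hφ, -, hx, hE, hc⟩ := exists_rep_of_mem hz
  rw [hc, prolong_zero]
  change _ = e.total.symm (e.base z.1, e.expr φ (e.base z.1))
  rw [← (total_section hφ hx).2, e.total.left_inv hx, hE]

theorem jetCoord_mem_overlap {k : ℕ} {z : JetBundle m n π k} (hz : z ∈ e.jetSource k)
    (hz' : z ∈ e'.jetSource k) :
    ((e.jetCoord k z).1, (e.jetCoord k z).2 (MultiIndex.zero m k)) ∈ e.overlap e' :=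
  ⟨jetCoord_mem_target hz, by
    rw [Set.mem_preimage, ← toE_eq hz]
    exact hz'⟩

theorem transition_jetCoord {u : JetBundle m n π 1} (hu : u ∈ e.jetSource 1)
    (hu' : u ∈ e'.jetSource 1) : e.transition e' (e.jetCoord 1 u) = e'.jetCoord 1 u := by
  obtain ⟨φ, hφ, hj, hx, hE, hc⟩ := exists_rep_of_mem hu
  have hx' : φ u.1 ∈ e'.total.source := by rw [← hE]; exact hu'
  have hc' : e'.jetCoord 1 u = prolong 1 (e'.expr φ) (e'.base u.1) := by
    conv_lhs => rw [hj]
    exact jetCoord_jet hφ hx'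
  rw [hc, hc', transition_prolong (smoothNear_expr hφ hx) (mem_overlap_section hφ hx hx'),
    prolong_congr (expr_eventuallyEq hφ hx hx')]
  simp [baseChange, e.base.left_inv (total_section hφ hx).1]

theorem eventually_overlap {k : ℕ} {c : JetCoord m n k}
    (hc : (c.1, c.2 (MultiIndex.zero m k)) ∈ e.overlap e') :
    ∀ᶠ c' : JetCoord m n k in 𝓝 c, (c'.1, c'.2 (MultiIndex.zero m k)) ∈ e.overlap e' := by
  have h : Continuous fun c : JetCoord m n k => (c.1, c.2 (MultiIndex.zero m k)) := by fun_prop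
  exact h.continuousAt.eventually ((e.isOpen_overlap e').mem_nhds hc)

section

variable {c : JetCoord m n 1}

theorem transition_zero (hc : (c.1, c.2 (MultiIndex.zero m 1)) ∈ e.overlap e') :
    (e.transition e' c).2 (MultiIndex.zero m 1) =
      e.fibreChange e' (c.1, c.2 (MultiIndex.zero m 1)) := by
  obtain ⟨f, hf, hfc⟩ := exists_prolong_eq c
  have h0 : f c.1 = c.2 (MultiIndex.zero m 1) := by rw [← prolong_zero (f := f) 1, hfc]
  have key := transition_prolong (f := f) (x := c.1) (e := e) (e' := e') (.of_contDiff hf)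
    (by rw [h0]; exact hc)
  have hgx := baseChange_baseChange_of_overlap hc
  simp only at hgx
  rw [hfc] at key
  rw [key, prolong_zero, hgx, h0]

theorem transition_single (hc : (c.1, c.2 (MultiIndex.zero m 1)) ∈ e.overlap e') (i : Fin m) :
    (e.transition e' c).2 (MultiIndex.single 0 i) =
      fderiv ℝ (e.fibreChange e') (c.1, c.2 (MultiIndex.zero m 1))
        (fderiv ℝ (e'.baseChange e) (e.baseChange e' c.1) (Pi.single i 1),
          ∑ k, jacobian (e'.baseChange e) (e.baseChange e' c.1) k i •
            c.2 (MultiIndex.single 0 k)) := by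
  obtain ⟨f, hf, hfc⟩ := exists_prolong_eq c
  have h0 : f c.1 = c.2 (MultiIndex.zero m 1) := by rw [← prolong_zero (f := f) 1, hfc]
  have h1 : ∀ k, fderiv ℝ f c.1 (Pi.single k 1) = c.2 (MultiIndex.single 0 k) := fun k => by
    rw [← prolong_single (f := f) 0, hfc]
  have hs : SmoothNear f c.1 := .of_contDiff hf
  have key := transition_prolong (f := f) (x := c.1) (e := e) (e' := e') hs
    (by rw [h0]; exact hc)
  have hgx := baseChange_baseChange_of_overlap hc
  simp only at hgx
  rw [hfc] at key
  rw [key, prolong_single 0]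
  have hg := (smoothNear_baseChange_symm hc).differentiableAt.hasFDerivAt
  have hF := (smoothNear_fibreChange hc).differentiableAt.hasFDerivAt
  simp only at hg
  have hfd : HasFDerivAt f (fderiv ℝ f c.1) (e'.baseChange e (e.baseChange e' c.1)) := by
    rw [hgx]; exact hs.differentiableAt.hasFDerivAt
  have hin := hg.prodMk (HasFDerivAt.comp (g := f) (f := e'.baseChange e) _ hfd hg)
  have hF2 : HasFDerivAt (e.fibreChange e')
      (fderiv ℝ (e.fibreChange e') (c.1, c.2 (MultiIndex.zero m 1)))
      (e'.baseChange e (e.baseChange e' c.1), f (e'.baseChange e (e.baseChange e' c.1))) := by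
    rw [hgx, h0]; exact hF
  have hd := HasFDerivAt.comp (g := e.fibreChange e')
    (f := fun y => (e'.baseChange e y, f (e'.baseChange e y))) _ hF2 hin
  have hd' : fderiv ℝ (fun y => e.fibreChange e' (e'.baseChange e y, f (e'.baseChange e y)))
    (e.baseChange e' c.1) = _ := hd.fderiv
  rw [hd']
  simp only [ContinuousLinearMap.comp_apply, ContinuousLinearMap.prod_apply]
  rw [fderiv_eq_sum_jacobian (fderiv ℝ f c.1)]
  simp only [h1]

theorem smoothNear_transition (hc : (c.1, c.2 (MultiIndex.zero m 1)) ∈ e.overlap e') :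
    SmoothNear (e.transition e') c := by
  have hfst : SmoothNear (fun c : JetCoord m n 1 => c.1) c := .of_contDiff contDiff_fst
  have hev : ∀ I : MultiIndex m 1, SmoothNear (fun c : JetCoord m n 1 => c.2 I) c := fun I =>
    .of_contDiff ((contDiff_apply ℝ (Fin n → ℝ) I).comp contDiff_snd)
  have hb : SmoothNear (e.baseChange e') c.1 :=
    smoothNear_baseChange (mem_base_target hc.1).1 (symm_mem_of_overlap hc)
  have hb1 : SmoothNear (fun c : JetCoord m n 1 => e.baseChange e' c.1) c :=
    SmoothNear.comp (k := e.baseChange e') hb hfst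
  have hp := hfst.prodMk (hev (MultiIndex.zero m 1))
  refine SmoothNear.prodMk (f := fun c => (e.transition e' c).1)
    (k := fun c => (e.transition e' c).2) hb1 (.pi fun I => ?_)
  rcases multiIndex_one_cases I with rfl | ⟨i, rfl⟩
  · refine SmoothNear.congr (SmoothNear.comp (k := e.fibreChange e') (smoothNear_fibreChange hc) hp)
      ?_
    filter_upwards [eventually_overlap hc] with c' hc' using transition_zero hc'
  · have hg := smoothNear_baseChange_symm hc
    have hd : SmoothNear (fun c : JetCoord m n 1 =>
        fderiv ℝ (e'.baseChange e) (e.baseChange e' c.1) (Pi.single i 1)) c :=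
      SmoothNear.comp (k := fun y => fderiv ℝ (e'.baseChange e) y (Pi.single i 1))
        (f := fun c : JetCoord m n 1 => e.baseChange e' c.1) (hg.fderiv_apply _) hb1
    refine SmoothNear.congr (((SmoothNear.comp (k := fderiv ℝ (e.fibreChange e'))
      (f := fun c : JetCoord m n 1 => (c.1, c.2 (MultiIndex.zero m 1)))
      (smoothNear_fibreChange hc).fderiv hp)).clm_apply (hd.prodMk (.sum fun k =>
        SmoothNear.smul (hd.apply k) (hev (MultiIndex.single 0 k))))) ?_
    filter_upwards [eventually_overlap hc] with c' hc' using transition_single hc' i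

theorem fderiv_transition_fst (hc : (c.1, c.2 (MultiIndex.zero m 1)) ∈ e.overlap e')
    (v : JetCoord m n 1) :
    (fderiv ℝ (e.transition e') c v).1 = fderiv ℝ (e.baseChange e') c.1 v.1 := by
  have h := (smoothNear_transition hc).differentiableAt.hasFDerivAt.fst
  have hb : HasFDerivAt (e.baseChange e') (fderiv ℝ (e.baseChange e') c.1) c.1 :=
    (smoothNear_baseChange (mem_base_target hc.1).1
      (symm_mem_of_overlap hc)).differentiableAt.hasFDerivAt
  have h' := HasFDerivAt.comp (g := e.baseChange e') (f := fun c : JetCoord m n 1 => c.1) c hb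
    hasFDerivAt_fst
  exact congrArg (fun A => A v) (h.unique h')

end

section

variable {f V : (Fin m → ℝ) → (Fin n → ℝ)} {x : Fin m → ℝ}

/-- The tangent map of the change of coordinates maps the prolongation of a vertical variation
field to the prolongation of the variation field in the other chart. -/
theorem fderiv_transition_prolong (hf : SmoothNear f x) (hx : (x, f x) ∈ e.overlap e')
    (hV : SmoothNear V x) :
    fderiv ℝ (e.transition e') (prolong 1 f x) (0, (prolong 1 V x).2) =
      (0, (prolong 1 (pushVariation (e.fibreChange e') (e'.baseChange e) f V)
        (e.baseChange e' x)).2) := by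
  have hgx := baseChange_baseChange_of_overlap hx
  simp only at hgx
  have hc : ((prolong 1 f x).1, (prolong 1 f x).2 (MultiIndex.zero m 1)) ∈ e.overlap e' := by
    rw [prolong_zero]; exact hx
  have h1 := hasDerivAt_prolong_transform (F := e.fibreChange e') (f := f) (V := V)
    (smoothNear_baseChange_symm hx) (by rw [hgx]; exact hf)
    (by rw [hgx]; exact smoothNear_fibreChange hx) (by rw [hgx]; exact hV) 1
  have hline : HasDerivAt (fun t : ℝ => prolong 1 f x + t • ((0 : Fin m → ℝ), (prolong 1 V x).2))
      (0, (prolong 1 V x).2) 0 := by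
    simpa using ((hasDerivAt_id (0 : ℝ)).smul_const
      ((0 : Fin m → ℝ), (prolong 1 V x).2)).const_add (prolong 1 f x)
  have hT : HasFDerivAt (e.transition e') (fderiv ℝ (e.transition e') (prolong 1 f x))
      (prolong 1 f x + (0 : ℝ) • ((0 : Fin m → ℝ), (prolong 1 V x).2)) := by
    rw [zero_smul, add_zero]
    exact (smoothNear_transition hc).differentiableAt.hasFDerivAt
  have h2 := hT.comp_hasDerivAt (0 : ℝ) hline
  refine h2.unique (h1.congr_of_eventuallyEq ?_)
  have hcont : ContinuousAt (fun t : ℝ => (x, f x + t • V x)) 0 := by fun_prop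
  filter_upwards [hcont.eventually ((e.isOpen_overlap e').mem_nhds
    (by simpa using hx))] with t ht
  rw [Function.comp_apply, ← prolong_add_smul hf hV]
  exact transition_prolong (f := fun y => f y + t • V y) (hf.add (hV.const_smul t)) ht

/-- The tangent map of the change of coordinates on vectors vertical over `E`. -/
theorem fderiv_transition_inclU {c : JetCoord m n 1}
    (hc : (c.1, c.2 (MultiIndex.zero m 1)) ∈ e.overlap e') (i : Fin m) (b : Fin n → ℝ) :
    fderiv ℝ (e.transition e') c (inclU (MultiIndex.single 0 i) b) =
      ∑ k, jacobian (e'.baseChange e) (e.baseChange e' c.1) i k • inclU (MultiIndex.single 0 k)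
        (fderiv ℝ (e.fibreChange e') (c.1, c.2 (MultiIndex.zero m 1)) (0, b)) := by
  obtain ⟨f, hf', hfc⟩ := exists_prolong_eq c
  have hf : SmoothNear f c.1 := .of_contDiff hf'
  have h0 : f c.1 = c.2 (MultiIndex.zero m 1) := by rw [← prolong_zero (f := f) 1, hfc]
  have hx : (c.1, f c.1) ∈ e.overlap e' := by rw [h0]; exact hc
  have hgx := baseChange_baseChange_of_overlap hc
  simp only at hgx
  set V : (Fin m → ℝ) → (Fin n → ℝ) := fun y => (y i - c.1 i) • b with hV
  have hVs : SmoothNear V c.1 := .of_contDiff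
    (((contDiff_apply ℝ ℝ i).sub contDiff_const).smul contDiff_const)
  have hVd : HasFDerivAt V ((ContinuousLinearMap.proj (R := ℝ)
      (φ := fun _ : Fin m => ℝ) i).smulRight b) c.1 :=
    ((hasFDerivAt_apply (𝕜 := ℝ) i c.1).sub_const _).smul_const _
  have hVc : inclU (MultiIndex.single 0 i) b = ((0 : Fin m → ℝ), (prolong 1 V c.1).2) := by
    refine jetCoord_one_ext rfl ?_ fun k => ?_
    · rw [prolong_zero, inclU_single_zero]
      simp [hV]
    · rw [prolong_single 0, hVd.fderiv]
      by_cases hk : k = i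
      · subst hk; simp [inclU_self]
      · rw [inclU_single_of_ne (Ne.symm hk)]
        simp [Ne.symm hk]
  have key := fderiv_transition_prolong hf hx hVs
  rw [hfc] at key
  rw [hVc, key]
  have hdV : ∀ k, fderiv ℝ (pushVariation (e.fibreChange e') (e'.baseChange e) f V)
      (e.baseChange e' c.1) (Pi.single k 1) =
        jacobian (e'.baseChange e) (e.baseChange e' c.1) i k •
          fderiv ℝ (e.fibreChange e') (c.1, c.2 (MultiIndex.zero m 1)) (0, b) := by
    intro k
    have hg := smoothNear_baseChange_symm hc
    simp only at hg
    have hfg : SmoothNear (fun y => f (e'.baseChange e y)) (e.baseChange e' c.1) :=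
      SmoothNear.comp (k := f) (f := e'.baseChange e) (by rw [hgx]; exact hf) hg
    have hA : SmoothNear (fun y => fderiv ℝ (e.fibreChange e')
        (e'.baseChange e y, f (e'.baseChange e y)) (0, b)) (e.baseChange e' c.1) :=
      SmoothNear.comp (k := fun p => fderiv ℝ (e.fibreChange e') p (0, b))
        (f := fun y => (e'.baseChange e y, f (e'.baseChange e y)))
        (by rw [hgx]; exact (smoothNear_fibreChange hx).fderiv_apply _) (hg.prodMk hfg)
    have heq : pushVariation (e.fibreChange e') (e'.baseChange e) f V = fun y =>
        (e'.baseChange e y i - c.1 i) • fderiv ℝ (e.fibreChange e')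
          (e'.baseChange e y, f (e'.baseChange e y)) (0, b) := by
      funext y
      have hv : ((0 : Fin m → ℝ), V (e'.baseChange e y)) =
          (e'.baseChange e y i - c.1 i) • ((0 : Fin m → ℝ), b) := by simp [hV]
      rw [pushVariation, hv, map_smul]
    have hgi : HasFDerivAt (fun y => e'.baseChange e y i - c.1 i)
        ((ContinuousLinearMap.proj i).comp
          (fderiv ℝ (e'.baseChange e) (e.baseChange e' c.1))) (e.baseChange e' c.1) :=
      (hasFDerivAt_pi'.1 hg.differentiableAt.hasFDerivAt i).sub_const (c.1 i)
    have hd := HasFDerivAt.fun_smul hgi hA.differentiableAt.hasFDerivAt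
    rw [heq, hd.fderiv]
    simp [hgx, h0, jacobian]
  refine jetCoord_one_ext ?_ ?_ fun k => ?_
  · simp [Prod.fst_sum, inclU]
  · rw [prolong_zero]
    simp [Prod.snd_sum, inclU_single_zero, pushVariation, hgx, hV, ← Prod.zero_eq_mk]
  · rw [prolong_single 0, hdV k, Prod.snd_sum, Finset.sum_apply,
      Finset.sum_eq_single_of_mem k (Finset.mem_univ _)]
    · simp [inclU_self]
    · intro l _ hl
      simp [inclU_single_of_ne hl]

end

section

variable {u : JetBundle m n π 1}

theorem fderiv_transition_comp (hu : u ∈ e.jetSource 1) (hu' : u ∈ e'.jetSource 1)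
    (hu'' : u ∈ e''.jetSource 1) :
    fderiv ℝ (e.transition e'') (e.jetCoord 1 u) =
      (fderiv ℝ (e'.transition e'') (e'.jetCoord 1 u)).comp
        (fderiv ℝ (e.transition e') (e.jetCoord 1 u)) := by
  have h1 := (smoothNear_transition (jetCoord_mem_overlap hu hu')).differentiableAt.hasFDerivAt
  have h2 := (smoothNear_transition (jetCoord_mem_overlap hu' hu'')).differentiableAt.hasFDerivAt
  rw [← transition_jetCoord hu hu'] at h2
  have h3 := HasFDerivAt.comp (g := e'.transition e'') (f := e.transition e') _ h2 h1
  rw [← transition_jetCoord hu hu', ← h3.fderiv]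
  refine Filter.EventuallyEq.fderiv_eq ?_
  filter_upwards [eventually_overlap (jetCoord_mem_overlap hu hu'),
    eventually_overlap (jetCoord_mem_overlap hu hu'')] with c hc hc'
  obtain ⟨z, hz, rfl⟩ := exists_jetCoord_eq (e := e) (k := 1) hc.1
  have hz' : z ∈ e'.jetSource 1 := by
    have := hc.2
    rwa [Set.mem_preimage, ← toE_eq hz] at this
  have hz'' : z ∈ e''.jetSource 1 := by
    have := hc'.2
    rwa [Set.mem_preimage, ← toE_eq hz] at this
  rw [Function.comp_apply, transition_jetCoord hz hz', transition_jetCoord hz' hz'',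
    transition_jetCoord hz hz'']

end

end AdaptedChart

end Transition

/-! ### Fibres of the multimomentum bundles -/

section Fibres

variable {m n : ℕ}

/-- The momenta `b ↦ ζ(∂_1, …, b^α ∂/∂u_I^α, …, ∂_m)`, with `b^α ∂/∂u_I^α` in place of `∂_a`, of an
`m`-form. -/
def formMomentum (ζ : (JetCoord m n 1) [⋀^Fin m]→L[ℝ] ℝ) (a : Fin m) (I : MultiIndex m 1) :
    (Fin n → ℝ) →L[ℝ] ℝ :=
  (ζ.toContinuousMultilinearMap.toContinuousLinearMap (ddx n 1) a).comp (inclU I)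

theorem formMomentum_apply (ζ : (JetCoord m n 1) [⋀^Fin m]→L[ℝ] ℝ) (a : Fin m)
    (I : MultiIndex m 1) (b : Fin n → ℝ) :
    formMomentum ζ a I b = ζ (Function.update (ddx n 1) a (inclU I b)) := rfl

theorem clm_ext_single {A B : (Fin n → ℝ) →L[ℝ] ℝ}
    (h : ∀ α, A (Pi.single α 1) = B (Pi.single α 1)) : A = B := by
  ext b
  rw [← Finset.univ_sum_single b, map_sum, map_sum]
  refine Finset.sum_congr rfl fun α _ => ?_
  have hb : (Pi.single α (b α) : Fin n → ℝ) = b α • Pi.single α 1 := by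
    rw [← Pi.single_smul]; simp
  rw [hb, map_smul, map_smul, h]

theorem apply_update_ddx (ζ : (JetCoord m n 1) [⋀^Fin m]→L[ℝ] ℝ) (a : Fin m)
    {w : JetCoord m n 1} (hw : w.1 = 0) :
    ζ (Function.update (ddx n 1) a w) =
      formMomentum ζ a (MultiIndex.zero m 1) (w.2 (MultiIndex.zero m 1)) +
        ∑ j, formMomentum ζ a (MultiIndex.single 0 j) (w.2 (MultiIndex.single 0 j)) := by
  have hdec : w = inclU (MultiIndex.zero m 1) (w.2 (MultiIndex.zero m 1)) +
      ∑ j, inclU (MultiIndex.single 0 j) (w.2 (MultiIndex.single 0 j)) := by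
    refine jetCoord_one_ext ?_ ?_ fun i => ?_
    · simp [hw, inclU, Prod.fst_sum]
    · simp [inclU_self, Prod.snd_sum, inclU_single_zero]
    · have h0 : MultiIndex.single 0 i ≠ MultiIndex.zero m 1 := fun h =>
        Multiset.singleton_ne_zero i (congrArg Subtype.val h)
      rw [Prod.snd_add, Pi.add_apply, Prod.snd_sum, Finset.sum_apply,
        Finset.sum_eq_single_of_mem i (Finset.mem_univ _)
          fun l _ hl => inclU_single_of_ne hl _, inclU_self]
      simp [inclU, h0]
  change ζ.toContinuousMultilinearMap.toContinuousLinearMap (ddx n 1) a w = _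
  conv_lhs => rw [hdec]
  rw [map_add, map_sum]
  rfl

/-- On the prolongation of a variation field, an `m`-form is given by the current of its momenta. -/
theorem apply_update_prolong (ζ : (JetCoord m n 1) [⋀^Fin m]→L[ℝ] ℝ) (a : Fin m)
    (V : (Fin m → ℝ) → (Fin n → ℝ)) (x : Fin m → ℝ) :
    ζ (Function.update (ddx n 1) a (0, (prolong 1 V x).2)) =
      current (fun a _ => formMomentum ζ a (MultiIndex.zero m 1))
        (fun a j _ => formMomentum ζ a (MultiIndex.single 0 j)) V x a := by
  rw [apply_update_ddx ζ a rfl]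
  simp only [prolong_zero, prolong_single 0]
  rfl

theorem formMomentum_momentumForm_zero (p : ℝ) (p₁ : Fin m → Fin n → ℝ)
    (p₂ : Sym (Fin m) 2 → Fin n → ℝ) (a : Fin m) (α : Fin n) :
    formMomentum (momentumForm p p₁ p₂) a (MultiIndex.zero m 1) (Pi.single α 1) = p₁ a α := by
  have h0 : ∀ j, MultiIndex.single 0 j ≠ MultiIndex.zero m 1 := fun j h =>
    Multiset.singleton_ne_zero j (congrArg Subtype.val h)
  rw [formMomentum_apply, momentumForm_update_ddx _ _ _ _ _ rfl]
  simp [inclU, h0, Pi.single_apply]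

theorem formMomentum_momentumForm_single (p : ℝ) (p₁ : Fin m → Fin n → ℝ)
    (p₂ : Sym (Fin m) 2 → Fin n → ℝ) (a i : Fin m) (α : Fin n) :
    formMomentum (momentumForm p p₁ p₂) a (MultiIndex.single 0 i) (Pi.single α 1) =
      1 / nfac i a * p₂ (pairIndex i a) α := by
  rw [formMomentum_apply, momentumForm_update_ddx _ _ _ _ _ rfl,
    Finset.sum_eq_single_of_mem i (Finset.mem_univ _)]
  · simp [inclU_self, inclU_single_zero, Pi.single_apply]
  · intro l _ hl
    simp [inclU_single_of_ne hl.symm]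

variable {M E : Type*}
  [TopologicalSpace M] [ChartedSpace (Fin m → ℝ) M]
  [TopologicalSpace E] [ChartedSpace ((Fin m → ℝ) × (Fin n → ℝ)) E]
  {π : E → M}

namespace AdaptedChart

variable {e e' : AdaptedChart (m := m) (n := n) π} {u : JetBundle m n π 1}

/-- The behaviour of momenta under a change of coordinates: the base index is transformed by the
adjugate of the Jacobian, as the base index of a current is. -/
theorem comp_fderiv_transition_update {ζ : (JetCoord m n 1) [⋀^Fin m]→L[ℝ] ℝ}
    (h₂ : ∀ v : Fin m → JetCoord m n 1, (∃ a b, a ≠ b ∧ (v a).1 = 0 ∧ (v b).1 = 0) → ζ v = 0)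
    (hu : u ∈ e.jetSource 1) (hu' : u ∈ e'.jetSource 1) (a : Fin m)
    {w : JetCoord m n 1} (hw : w.1 = 0) :
    ζ.compContinuousLinearMap (fderiv ℝ (e.transition e') (e.jetCoord 1 u))
        (Function.update (ddx n 1) a w) =
      ∑ i, (jacobian (e.baseChange e') (e.jetCoord 1 u).1).adjugate a i *
        ζ (Function.update (ddx n 1) i
          (fderiv ℝ (e.transition e') (e.jetCoord 1 u) w)) := by
  have hov := jetCoord_mem_overlap hu hu'
  set T := fderiv ℝ (e.transition e') (e.jetCoord 1 u) with hT
  have hv : (fun c => T (Function.update (ddx n 1) a w c)) =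
      Function.update (fun c => T (ddx n 1 c)) a (T w) := by
    funext c
    by_cases hc : c = a
    · subst hc; simp
    · simp [hc]
  have hTw : (T w).1 = 0 := by rw [hT, fderiv_transition_fst hov, hw, map_zero]
  have hJ : baseMatrix (fun c => T (ddx n 1 c)) =
      jacobian (e.baseChange e') (e.jetCoord 1 u).1 := by
    ext r c
    simp only [baseMatrix, jacobian, Matrix.of_apply, hT, fderiv_transition_fst hov]
    rfl
  change ζ (fun c => T (Function.update (ddx n 1) a w c)) = _
  rw [hv, apply_of_vertical ζ h₂ _ a (by simpa using hTw)]
  simp only [adjugate_baseMatrix_update, hJ, Function.update_self]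

theorem adjugate_jacobian_baseChange {p : (Fin m → ℝ) × (Fin n → ℝ)} (hp : p ∈ e.overlap e')
    (a i : Fin m) : (jacobian (e.baseChange e') p.1).adjugate a i =
      (jacobian (e.baseChange e') p.1).det *
        jacobian (e'.baseChange e) (e.baseChange e' p.1) a i := by
  have hb := (mem_base_target hp.1).1
  have hs := symm_mem_of_overlap hp
  refine adjugate_jacobian_of_leftInverse (smoothNear_baseChange_symm hp).differentiableAt
    (smoothNear_baseChange hb hs).differentiableAt ?_ a i
  filter_upwards [(e.base.isOpen_inter_preimage_symm e'.base.open_source).mem_nhds ⟨hb, hs⟩]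
    with y hy using baseChange_baseChange hy.1 hy.2

theorem formMomentum_transition {ζ : (JetCoord m n 1) [⋀^Fin m]→L[ℝ] ℝ}
    (h₂ : ∀ v : Fin m → JetCoord m n 1, (∃ a b, a ≠ b ∧ (v a).1 = 0 ∧ (v b).1 = 0) → ζ v = 0)
    (hu : u ∈ e.jetSource 1) (hu' : u ∈ e'.jetSource 1) (i j : Fin m) (b : Fin n → ℝ) :
    formMomentum (ζ.compContinuousLinearMap (fderiv ℝ (e.transition e') (e.jetCoord 1 u))) j
        (MultiIndex.single 0 i) b =
      ∑ l, (jacobian (e.baseChange e') (e.jetCoord 1 u).1).adjugate j l * ∑ k,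
        jacobian (e'.baseChange e) (e.baseChange e' (e.jetCoord 1 u).1) i k *
          formMomentum ζ l (MultiIndex.single 0 k)
            (fderiv ℝ (e.fibreChange e') ((e.jetCoord 1 u).1,
              (e.jetCoord 1 u).2 (MultiIndex.zero m 1)) (0, b)) := by
  rw [formMomentum_apply, comp_fderiv_transition_update h₂ hu hu' j rfl]
  refine Finset.sum_congr rfl fun l _ => ?_
  rw [fderiv_transition_inclU (jetCoord_mem_overlap hu hu')]
  change _ * ζ.toContinuousMultilinearMap.toContinuousLinearMap (ddx n 1) l _ = _
  rw [map_sum]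
  simp only [map_smul, smul_eq_mul]
  rfl

open Classical in
/-- The form on `T_uJ^1π` with expression `ζ` in the chart `e`. -/
def extendForm (e : AdaptedChart (m := m) (n := n) π) (u : JetBundle m n π 1)
    (ζ : (JetCoord m n 1) [⋀^Fin m]→L[ℝ] ℝ) : FormFamily m n π :=
  fun e' => if u ∈ e'.jetSource 1 then
    ζ.compContinuousLinearMap (fderiv ℝ (e'.transition e) (e'.jetCoord 1 u)) else 0

/-- The symmetry of the momenta `p^{ij}` does not depend on the adapted chart. -/
theorem extendForm_mem (hu : u ∈ e.jetSource 1) {ζ : (JetCoord m n 1) [⋀^Fin m]→L[ℝ] ℝ}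
    (h₂ : ∀ v : Fin m → JetCoord m n 1, (∃ a b, a ≠ b ∧ (v a).1 = 0 ∧ (v b).1 = 0) → ζ v = 0)
    (hs : ∀ i j, formMomentum ζ j (MultiIndex.single 0 i) =
      formMomentum ζ i (MultiIndex.single 0 j)) :
    e.extendForm u ζ ∈ ExtendedFibre u := by
  refine ⟨fun e' he' => by rw [extendForm, if_neg he'], fun e' e'' he' he'' => ?_,
    fun e' v hv => ?_, fun e' i j α => ?_⟩
  · simp only [extendForm, if_pos he', if_pos he'', fderiv_transition_comp he' he'' hu]
    rfl
  · by_cases he' : u ∈ e'.jetSource 1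
    · rw [extendForm, if_pos he']
      obtain ⟨a, b, hab, ha, hb⟩ := hv
      have hov := jetCoord_mem_overlap he' hu
      exact h₂ _ ⟨a, b, hab, (fderiv_transition_fst hov _).trans (by rw [ha, map_zero]),
        (fderiv_transition_fst hov _).trans (by rw [hb, map_zero])⟩
    · rw [extendForm, if_neg he']; rfl
  · by_cases he' : u ∈ e'.jetSource 1
    · have hov := jetCoord_mem_overlap he' hu
      have key : ∀ i j, e.extendForm u ζ e'
          (Function.update (ddx n 1) j (ddu (MultiIndex.single 0 i) α)) =
          (jacobian (e'.baseChange e) (e'.jetCoord 1 u).1).det * ∑ l, ∑ k,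
            jacobian (e.baseChange e') (e'.baseChange e (e'.jetCoord 1 u).1) j l *
            jacobian (e.baseChange e') (e'.baseChange e (e'.jetCoord 1 u).1) i k *
            formMomentum ζ l (MultiIndex.single 0 k)
              (fderiv ℝ (e'.fibreChange e) ((e'.jetCoord 1 u).1,
                (e'.jetCoord 1 u).2 (MultiIndex.zero m 1)) (0, Pi.single α 1)) := by
        intro i j
        rw [← inclU_single, ← formMomentum_apply, extendForm, if_pos he',
          formMomentum_transition h₂ he' hu, Finset.mul_sum]
        refine Finset.sum_congr rfl fun l _ => ?_
        rw [adjugate_jacobian_baseChange hov, mul_assoc, Finset.mul_sum]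
        simp only [mul_assoc]
      rw [key, key, Finset.sum_comm]
      congr 1
      refine Finset.sum_congr rfl fun k _ => Finset.sum_congr rfl fun l _ => ?_
      rw [hs]
      ring
    · rw [extendForm, if_neg he']; rfl

theorem momentum_mk (ξ : ExtendedFibre u) (j : Fin m) (I : MultiIndex m 1) (α : Fin n) :
    e.momentum u j I α (Submodule.Quotient.mk ξ) = formMomentum (ξ.1 e) j I (Pi.single α 1) :=
  rfl

theorem momentum_symm (q : RestrictedFibre u) (i j : Fin m) (α : Fin n) :
    e.momentum u j (MultiIndex.single 0 i) α q = e.momentum u i (MultiIndex.single 0 j) α q := by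
  obtain ⟨ξ, rfl⟩ := Submodule.Quotient.mk_surjective _ q
  exact ξ.2.2.2.2 e i j α

theorem momentumTwo_pairIndex (q : RestrictedFibre u) (i j : Fin m) (α : Fin n) :
    e.momentumTwo ⟨u, q⟩ (pairIndex i j) α =
      nfac i j * e.momentum u j (MultiIndex.single 0 i) α q := by
  set φ : Sym (Fin m) 2 → ℝ := fun I => if I = pairIndex i j then
    nfac i j * e.momentum u j (MultiIndex.single 0 i) α q else 0 with hφ
  have h : ∀ i' j', (if pairIndex i' j' = pairIndex i j then
      e.momentum u j' (MultiIndex.single 0 i') α q else 0) =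
      (1 / nfac i' j') • φ (pairIndex i' j') := by
    intro i' j'
    simp only [hφ]
    split_ifs with h
    · rcases (pairIndex_eq_iff _ _ _ _).1 h with ⟨rfl, rfl⟩ | ⟨rfl, rfl⟩
      · rw [smul_eq_mul, ← mul_assoc, one_div_mul_cancel (nfac_ne_zero _ _), one_mul]
      · rw [smul_eq_mul, ← mul_assoc, nfac_comm, one_div_mul_cancel (nfac_ne_zero _ _), one_mul,
          momentum_symm]
    · rw [smul_zero]
  refine (Finset.sum_congr rfl fun i' _ => Finset.sum_congr rfl fun j' _ => h i' j').trans ?_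
  rw [sum_pairIndex, hφ]
  simp

/-- A point of `J^2π^‡` is determined by its base point and its momenta in one adapted chart. -/
theorem restrictedFibre_ext (hu : u ∈ e.jetSource 1) {q q' : RestrictedFibre u}
    (h₁ : ∀ i α, e.momentumOne ⟨u, q⟩ i α = e.momentumOne ⟨u, q'⟩ i α)
    (h₂ : ∀ I α, e.momentumTwo ⟨u, q⟩ I α = e.momentumTwo ⟨u, q'⟩ I α) : q = q' := by
  have h₂' : ∀ i j α, e.momentum u j (MultiIndex.single 0 i) α q =
      e.momentum u j (MultiIndex.single 0 i) α q' := by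
    intro i j α
    have h := (momentumTwo_pairIndex q i j α).symm.trans
      ((h₂ (pairIndex i j) α).trans (momentumTwo_pairIndex q' i j α))
    exact mul_left_cancel₀ (nfac_ne_zero i j) h
  obtain ⟨ξ, rfl⟩ := Submodule.Quotient.mk_surjective _ q
  obtain ⟨ξ', rfl⟩ := Submodule.Quotient.mk_surjective _ q'
  refine (Submodule.Quotient.eq _).2 ?_
  have hδ := (ξ - ξ').2
  set δ := (ξ - ξ').1 with hδd
  have hδ₀ : ∀ (v : Fin m → JetCoord m n 1) (a : Fin m), (v a).1 = 0 → δ e v = 0 := by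
    refine eq_zero_of_vertical (δ e) (hδ.2.2.1 e) fun i w hw => ?_
    have hz : ∀ I, formMomentum (δ e) i I =
        formMomentum (ξ.1 e) i I - formMomentum (ξ'.1 e) i I := fun I => rfl
    have hz' : ∀ I, formMomentum (δ e) i I = 0 := by
      intro I
      rw [hz, sub_eq_zero]
      refine clm_ext_single fun α => ?_
      rcases multiIndex_one_cases I with rfl | ⟨k, rfl⟩
      · exact h₁ i α
      · exact h₂' k i α
    rw [apply_update_ddx (δ e) i hw]
    simp [hz']
  rintro e' v ⟨a, ha⟩
  change δ e' v = 0
  by_cases hu' : u ∈ e'.jetSource 1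
  · rw [hδ.2.1 e' e hu' hu]
    exact hδ₀ _ a ((fderiv_transition_fst (jetCoord_mem_overlap hu' hu) _).trans
      (by rw [ha, map_zero]))
  · rw [hδ.1 e' hu']; rfl

end AdaptedChart

end Fibres

/-! ### The restricted Legendre map -/

section Legendre

variable {m n : ℕ}

/-- The coordinate expression of the momenta `p^i` of the restricted Legendre map. -/
def legendreCoordOne (Λ : JetCoord m n 2 → ℝ) (c : JetCoord m n 3) (i : Fin m) (α : Fin n) : ℝ :=
  partialU (MultiIndex.single 1 i) α Λ (coordProj (by omega : 2 ≤ 3) c) -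
    ∑ j, (1 / nfac i j) * totalDeriv j (partialU (MultiIndex.ofTwo 0 (pairIndex i j)) α Λ) c

/-- The coordinate expression of the momenta `p^I` of the restricted Legendre map. -/
def legendreCoordTwo (Λ : JetCoord m n 2 → ℝ) (c : JetCoord m n 3) (I : Sym (Fin m) 2)
    (α : Fin n) : ℝ :=
  partialU (MultiIndex.ofTwo 0 I) α Λ (coordProj (by omega : 2 ≤ 3) c)

variable {Λ : JetCoord m n 2 → ℝ} {f : (Fin m → ℝ) → (Fin n → ℝ)} {x : Fin m → ℝ}

theorem legendreCoordTwo_prolong (i j : Fin m) (α : Fin n) :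
    1 / nfac i j * legendreCoordTwo Λ (prolong 3 f x) (pairIndex i j) α =
      legendreTwo Λ f i j x (Pi.single α 1) := rfl

theorem legendreCoordOne_prolong (hf : SmoothNear f x) (hΛ : SmoothNear Λ (prolong 2 f x))
    (i : Fin m) (α : Fin n) :
    legendreCoordOne Λ (prolong 3 f x) i α = legendreOne Λ f i x (Pi.single α 1) := by
  have h : ∀ j, 1 / nfac i j *
      totalDeriv j (partialU (MultiIndex.ofTwo 0 (pairIndex i j)) α Λ) (prolong 3 f x) =
      fderiv ℝ (legendreTwo Λ f i j) x (Pi.single j 1) (Pi.single α 1) := by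
    intro j
    have hG : SmoothNear (partialU (MultiIndex.ofTwo 0 (pairIndex i j)) α Λ) (prolong 2 f x) :=
      hΛ.fderiv_apply _
    have hd : DifferentiableAt ℝ
        (fun y => partialU (MultiIndex.ofTwo 0 (pairIndex i j)) α Λ (prolong 2 f y)) x :=
      (SmoothNear.comp hG (hf.prolong 2)).differentiableAt
    have hl := (smoothNear_legendreTwo hf hΛ i j).differentiableAt.hasFDerivAt
    have h1 := (hl.clm_apply (hasFDerivAt_const (Pi.single α (1 : ℝ) : Fin n → ℝ) x)).fderiv
    have h2 := (hd.hasFDerivAt.const_mul (1 / nfac i j)).fderiv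
    rw [totalDeriv_prolong hf hG.differentiableAt]
    have h3 := congrArg (fun A => A (Pi.single j 1)) (h2.symm.trans h1)
    simpa using h3
  simp only [legendreCoordOne, h, legendreOne, _root_.sub_apply, _root_.sum_apply]
  rfl

theorem smoothNear_legendreCoordTwo {c : JetCoord m n 3}
    (hΛ : SmoothNear Λ (coordProj (by omega : 2 ≤ 3) c)) : SmoothNear (legendreCoordTwo Λ) c :=
  .pi fun I => .pi fun α => SmoothNear.comp (k := partialU (MultiIndex.ofTwo 0 I) α Λ)
    (f := fun c : JetCoord m n 3 => coordProj (by omega : 2 ≤ 3) c)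
    (hΛ.fderiv_apply _) (.of_contDiff (coordProj (by omega : 2 ≤ 3)).contDiff)

theorem smoothNear_legendreCoordOne {c : JetCoord m n 3}
    (hΛ : SmoothNear Λ (coordProj (by omega : 2 ≤ 3) c)) : SmoothNear (legendreCoordOne Λ) c := by
  have hp : SmoothNear (fun c : JetCoord m n 3 => coordProj (by omega : 2 ≤ 3) c) c :=
    .of_contDiff (coordProj _).contDiff
  refine .pi fun i => .pi fun α => .sub (SmoothNear.comp
    (k := partialU (MultiIndex.single 1 i) α Λ)
    (f := fun c : JetCoord m n 3 => coordProj (by omega : 2 ≤ 3) c) (hΛ.fderiv_apply _) hp)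
    (.sum fun j => .mul (.const _) ?_)
  have hh : SmoothNear (fun c : JetCoord m n 3 => (holonomicLift c j : JetCoord m n 2)) c :=
    (SmoothNear.const _).prodMk (.pi fun I => .of_contDiff
      ((contDiff_apply ℝ (Fin n → ℝ) (I.cons j)).comp contDiff_snd))
  exact (SmoothNear.comp
    (k := fderiv ℝ (partialU (MultiIndex.ofTwo 0 (pairIndex i j)) α Λ))
    (f := fun c : JetCoord m n 3 => coordProj (by omega : 2 ≤ 3) c)
    (SmoothNear.fderiv (hΛ.fderiv_apply _)) hp).clm_apply hh

/-- The currents of all variation fields at a point determine the momenta. -/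
theorem current_ext {q₀ q₀' : Fin m → (Fin m → ℝ) → (Fin n → ℝ) →L[ℝ] ℝ}
    {q₁ q₁' : Fin m → Fin m → (Fin m → ℝ) → (Fin n → ℝ) →L[ℝ] ℝ} {a : Fin m}
    (h : ∀ V, SmoothNear V x → current q₀ q₁ V x a = current q₀' q₁' V x a) :
    q₀ a x = q₀' a x ∧ ∀ j, q₁ a j x = q₁' a j x := by
  -- constant variation fields give `q^a`, and `y ↦ (y^j - x^j) b` gives `q^{aj}`
  refine ⟨?_, fun j => ?_⟩
  · ext b
    simpa [current] using h (fun _ => b) (.const b)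
  · ext b
    have hVd : ∀ k, fderiv ℝ (fun y : Fin m → ℝ => (y j - x j) • b) x (Pi.single k 1) =
        if k = j then b else 0 := by
      intro k
      have hd : HasFDerivAt (fun y : Fin m → ℝ => (y j - x j) • b)
          ((ContinuousLinearMap.proj (R := ℝ) (φ := fun _ : Fin m => ℝ) j).smulRight b) x :=
        ((hasFDerivAt_apply (𝕜 := ℝ) j x).sub_const _).smul_const _
      rw [hd.fderiv]
      split_ifs with hk
      · subst hk; simp
      · simp [Ne.symm hk]
    have hV := h (fun y => (y j - x j) • b) (.of_contDiff
      (((contDiff_apply ℝ ℝ j).sub contDiff_const).smul contDiff_const))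
    simp only [current, hVd] at hV
    have hs : ∀ q : Fin m → Fin m → (Fin m → ℝ) → (Fin n → ℝ) →L[ℝ] ℝ,
        ∑ k, q a k x (if k = j then b else 0) = q a j x b := by
      intro q
      rw [Finset.sum_eq_single_of_mem j (Finset.mem_univ _)]
      · simp
      · intro k _ hk; simp [hk]
    simpa [hs] using hV

variable {M E : Type*}
  [TopologicalSpace M] [ChartedSpace (Fin m → ℝ) M]
  [TopologicalSpace E] [ChartedSpace ((Fin m → ℝ) × (Fin n → ℝ)) E]
  {π : E → M}

namespace AdaptedChart

variable {e e₀ : AdaptedChart (m := m) (n := n) π}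
  {η : (x : M) → (TangentSpace 𝓘(ℝ, Fin m → ℝ) x) [⋀^Fin m]→L[ℝ] ℝ}
  {L : JetBundle m n π 2 → ℝ}

theorem smoothNear_localLagrangian (hη : IsVolumeForm η) (hL : IsSmoothOnJets L)
    {c : JetCoord m n 2} (hc : c ∈ e.jetTarget 2) : SmoothNear (e.localLagrangian η L) c :=
  .of_contDiffOn (contDiffOn_localLagrangian hη hL e) isOpen_jetTarget hc

theorem coordProj_mem_target {r k : ℕ} (h : r ≤ k) {c : JetCoord m n k} (hc : c ∈ e.jetTarget k) :
    coordProj h c ∈ e.jetTarget r := hc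

/-- The momenta given by the formulas of the restricted Legendre map in one adapted chart satisfy
these formulas in every adapted chart: they are the momenta of the Legendre current. -/
theorem exists_legendre (hη : IsVolumeForm η) (hL : IsSmoothOnJets L) {z : JetBundle m n π 3}
    (hz₀ : z ∈ e₀.jetSource 3) :
    ∃ q : RestrictedFibre (z.proj 1 (by omega)),
      ∀ e : AdaptedChart (m := m) (n := n) π, z ∈ e.jetSource 3 →
        e.momentumOne ⟨_, q⟩ = legendreCoordOne (e.localLagrangian η L) (e.jetCoord 3 z) ∧
        e.momentumTwo ⟨_, q⟩ = legendreCoordTwo (e.localLagrangian η L) (e.jetCoord 3 z) := by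
  obtain ⟨φ, hφ, hj, hx₀, hE, hc₀⟩ := exists_rep_of_mem hz₀
  set u := z.proj 1 (by omega) with hu
  have hsrc : ∀ e : AdaptedChart (m := m) (n := n) π, z ∈ e.jetSource 3 → u ∈ e.jetSource 1 := by
    intro e he
    rwa [jetSource, Set.mem_ofPred_eq, hu, JetBundle.toE_proj]
  set Λ₀ := e₀.localLagrangian η L with hΛ₀
  have hs₀ := smoothNear_expr hφ hx₀
  have hΛs : ∀ e : AdaptedChart (m := m) (n := n) π, φ z.1 ∈ e.total.source →
      SmoothNear (e.localLagrangian η L) (prolong 2 (e.expr φ) (e.base z.1)) := by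
    intro e hx
    refine smoothNear_localLagrangian hη hL ?_
    rw [jetTarget, Set.mem_ofPred_eq, prolong_zero]
    exact mem_target_section hφ hx
  -- the coefficient `p` is irrelevant in the quotient by semibasic forms
  set ζ := momentumForm 0 (legendreCoordOne Λ₀ (e₀.jetCoord 3 z))
    (legendreCoordTwo Λ₀ (e₀.jetCoord 3 z)) with hζ
  have hζ₂ : ∀ v : Fin m → JetCoord m n 1,
      (∃ a b, a ≠ b ∧ (v a).1 = 0 ∧ (v b).1 = 0) → ζ v = 0 :=
    fun v hv => momentumForm_vertical_two _ _ _ v hv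
  have hζ0 : ∀ a, formMomentum ζ a (MultiIndex.zero m 1) =
      legendreOne Λ₀ (e₀.expr φ) a (e₀.base z.1) := fun a => clm_ext_single fun α => by
    rw [hζ, formMomentum_momentumForm_zero, hc₀, legendreCoordOne_prolong hs₀ (hΛs e₀ hx₀)]
  have hζ1 : ∀ a j, formMomentum ζ a (MultiIndex.single 0 j) =
      legendreTwo Λ₀ (e₀.expr φ) a j (e₀.base z.1) := fun a j => clm_ext_single fun α => by
    rw [hζ, formMomentum_momentumForm_single, hc₀, legendreCoordTwo_prolong, legendreTwo_symm]
  have hmem : e₀.extendForm u ζ ∈ ExtendedFibre u :=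
    extendForm_mem (hsrc e₀ hz₀) hζ₂ fun i j => by rw [hζ1, hζ1, legendreTwo_symm]
  set ξ : ExtendedFibre u := ⟨e₀.extendForm u ζ, hmem⟩ with hξ
  refine ⟨Submodule.Quotient.mk ξ, fun e he => ?_⟩
  have hx : φ z.1 ∈ e.total.source := by rw [← hE]; exact he
  have hce : e.jetCoord 3 z = prolong 3 (e.expr φ) (e.base z.1) := by
    conv_lhs => rw [hj]
    exact jetCoord_jet hφ hx
  have hcu : e.jetCoord 1 u = prolong 1 (e.expr φ) (e.base z.1) := by
    rw [hu, jetCoord_proj _ z he, hce, coordProj_prolong]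
  have hov := mem_overlap_section hφ hx hx₀
  have hs := smoothNear_expr hφ hx
  have hbase : e.baseChange e₀ (e.base z.1) = e₀.base z.1 := by
    simp [baseChange, e.base.left_inv (total_section hφ hx).1]
  -- in `e`, the form `ξ` evaluates on prolongations of variation fields as the Legendre current
  have hcur : ∀ a V, SmoothNear V (e.base z.1) →
      current (fun a _ => formMomentum (ξ.1 e) a (MultiIndex.zero m 1))
        (fun a j _ => formMomentum (ξ.1 e) a (MultiIndex.single 0 j)) V (e.base z.1) a =
      current (legendreOne (e.localLagrangian η L) (e.expr φ))
        (legendreTwo (e.localLagrangian η L) (e.expr φ)) V (e.base z.1) a := by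
    intro a V hV
    rw [← apply_update_prolong, hξ]
    simp only [extendForm, if_pos (hsrc e he)]
    rw [comp_fderiv_transition_update hζ₂ (hsrc e he) (hsrc e₀ hz₀) a rfl, hcu,
      fderiv_transition_prolong hs hov hV, hbase,
      legendre_current_change hη hL hφ hx hx₀ hV]
    refine Finset.sum_congr rfl fun i _ => ?_
    rw [apply_update_prolong]
    simp only [current, hζ0, hζ1]
    rfl
  refine ⟨funext fun i => funext fun α => ?_, funext fun I => funext fun α => ?_⟩
  · have h := (current_ext (hcur i)).1
    rw [hce, legendreCoordOne_prolong hs (hΛs e hx), ← h]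
    rfl
  · obtain ⟨i, j, rfl⟩ := exists_pairIndex I
    have h := (current_ext (hcur j)).2 i
    refine (momentumTwo_pairIndex _ i j α).trans ?_
    rw [hce, momentum_mk]
    beta_reduce at h
    rw [h, legendreTwo_symm, ← legendreCoordTwo_prolong, ← mul_assoc,
      mul_one_div_cancel (nfac_ne_zero _ _), one_mul]

/-- A map that is given by the formulas of the restricted Legendre map is a smooth bundle map. -/
theorem isBundleMap_of_formulas (hη : IsVolumeForm η) (hL : IsSmoothOnJets L)
    {FL : JetBundle m n π 3 → RestrictedMomentumBundle m n π}
    (hFL : ∀ z, (FL z).1 = z.proj 1 (by omega))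
    (h₁ : ∀ e : AdaptedChart (m := m) (n := n) π, ∀ z ∈ e.jetSource 3,
      e.momentumOne (FL z) = legendreCoordOne (e.localLagrangian η L) (e.jetCoord 3 z))
    (h₂ : ∀ e : AdaptedChart (m := m) (n := n) π, ∀ z ∈ e.jetSource 3,
      e.momentumTwo (FL z) = legendreCoordTwo (e.localLagrangian η L) (e.jetCoord 3 z)) :
    IsBundleMap FL := by
  refine ⟨hFL, fun e => ?_⟩
  have hs : ContDiffOn ℝ ∞ (fun c => (legendreCoordOne (e.localLagrangian η L) c,
      legendreCoordTwo (e.localLagrangian η L) c)) (e.jetTarget 3) := fun c hc => by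
    have hΛ := smoothNear_localLagrangian hη hL
      (coordProj_mem_target (e := e) (by omega : 2 ≤ 3) hc)
    exact ((smoothNear_legendreCoordOne hΛ).prodMk
      (smoothNear_legendreCoordTwo hΛ)).self.contDiffWithinAt
  refine hs.congr fun c hc => ?_
  obtain ⟨z, hz, rfl⟩ := exists_jetCoord_eq hc
  rw [coordExpr_jetCoord _ hz, h₁ e z hz, h₂ e z hz]

end AdaptedChart

end Legendre

/-! ### The contraction of `Ω_r` with a vector -/

section Contraction

variable {m n : ℕ}

theorem momentumForm_add (p p' : ℝ) (p₁ p₁' : Fin m → Fin n → ℝ)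
    (p₂ p₂' : Sym (Fin m) 2 → Fin n → ℝ) :
    momentumForm (p + p') (p₁ + p₁') (p₂ + p₂') =
      momentumForm p p₁ p₂ + momentumForm p' p₁' p₂' := by
  simp only [momentumForm, Pi.add_apply, mul_add, add_smul, Finset.sum_add_distrib]
  abel

theorem momentumForm_smul (t p : ℝ) (p₁ : Fin m → Fin n → ℝ) (p₂ : Sym (Fin m) 2 → Fin n → ℝ) :
    momentumForm (t * p) (t • p₁) (t • p₂) = t • momentumForm p p₁ p₂ := by
  simp only [momentumForm, Pi.smul_apply, smul_eq_mul, smul_add, Finset.smul_sum, smul_smul,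
    mul_left_comm]

/-- In the natural coordinates of `W` the form `Θ` is linear in the point, so that it is its own
derivative. -/
theorem fderiv_Theta (w v : WCoord m n) : fderiv ℝ (Theta m n) w v = Theta m n v := by
  let Φ : WCoord m n →ₗ[ℝ] (WCoord m n) [⋀^Fin m]→L[ℝ] ℝ :=
    { toFun := Theta m n
      map_add' := fun a b => by
        simp only [Theta, Prod.fst_add, Prod.snd_add, momentumForm_add]
        rfl
      map_smul' := fun t a => by
        simp only [Theta, Prod.smul_fst, Prod.smul_snd, smul_eq_mul, momentumForm_smul]
        rfl }
  exact congrArg (fun A => A v) (Φ.toContinuousLinearMap.hasFDerivAt (x := w)).fderiv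

theorem apply_removeNth_cons {V : Type*} [NormedAddCommGroup V] [NormedSpace ℝ V]
    (ζ : V [⋀^Fin m]→L[ℝ] ℝ) (X : V) (v : Fin m → V) (b : Fin m) :
    (-1) ^ (b : ℕ) * ζ (Fin.removeNth b.succ (Fin.cons X v : Fin (m + 1) → V)) =
      ζ (Function.update v b X) := by
  obtain _ | k := m
  · exact b.elim0
  have h1 : Fin.removeNth b.succ (Fin.cons X v : Fin (k + 2) → V) =
      Matrix.vecCons X (b.removeNth v) := by
    funext i
    refine Fin.cases ?_ (fun j => ?_) i
    · simp [Fin.removeNth_apply]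
    · simp [Fin.removeNth_apply, Fin.succ_succAbove_succ]
  rw [h1, ← ζ.neg_one_pow_smul_map_insertNth b, zsmul_eq_mul, Int.cast_pow, Int.cast_neg,
    Int.cast_one, ← mul_assoc, ← mul_pow, neg_one_mul, neg_neg, one_pow, one_mul,
    Fin.insertNth_removeNth]

/-- As `Θ` is linear in the point, `dΘ` alternates `(X; v₁, …, v_m) ↦ Θ_X(v₁, …, v_m)`. -/
theorem Omega_apply_cons (w X : WCoord m n) (v : Fin m → WCoord m n) :
    Omega m n w (Fin.cons X v) =
      ∑ b, Theta m n (v b) (Function.update v b X) - Theta m n X v := by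
  have h : Omega m n w (Fin.cons X v) = -(∑ i : Fin (m + 1), (-1) ^ (i : ℕ) •
      fderiv ℝ (Theta m n) w ((Fin.cons X v : Fin (m + 1) → WCoord m n) i)
        (i.removeNth (Fin.cons X v : Fin (m + 1) → WCoord m n))) := by
    rw [← ContinuousAlternatingMap.alternatizeUncurryFin_apply]
    rfl
  rw [h, Fin.sum_univ_succ]
  have h2 : ∀ b : Fin m, (-1 : ℤ) ^ ((b.succ : Fin (m + 1)) : ℕ) •
      fderiv ℝ (Theta m n) w ((Fin.cons X v : Fin (m + 1) → WCoord m n) b.succ)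
        (b.succ.removeNth (Fin.cons X v : Fin (m + 1) → WCoord m n)) =
      -Theta m n (v b) (Function.update v b X) := by
    intro b
    rw [fderiv_Theta, ← apply_removeNth_cons, Fin.cons_succ, Fin.val_succ, pow_succ]
    simp
  simp only [h2, Finset.sum_neg_distrib]
  rw [fderiv_Theta, Fin.cons_zero, Fin.removeNth_zero, Fin.tail_cons]
  simp [sub_eq_add_neg]

theorem Theta_apply (w : WCoord m n) (v : Fin m → WCoord m n) :
    Theta m n w v = momentumForm w.2.1 w.2.2.1 w.2.2.2
      (fun c => coordProj (by omega : 1 ≤ 3) (v c).1) := rfl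

variable {M E : Type*}
  [TopologicalSpace M] [ChartedSpace (Fin m → ℝ) M]
  [TopologicalSpace E] [ChartedSpace ((Fin m → ℝ) × (Fin n → ℝ)) E]
  {π : E → M}

namespace AdaptedChart

variable {e : AdaptedChart (m := m) (n := n) π}
  {η : (x : M) → (TangentSpace 𝓘(ℝ, Fin m → ℝ) x) [⋀^Fin m]→L[ℝ] ℝ}
  {L : JetBundle m n π 2 → ℝ}

theorem hasFDerivAt_hamiltonian {w : WrCoord m n}
    (hΛ : DifferentiableAt ℝ (e.localLagrangian η L) (coordProj (by omega : 2 ≤ 3) w.1)) :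
    ∃ A : WrCoord m n →L[ℝ] ℝ, HasFDerivAt (e.hamiltonian η L) A w ∧ ∀ v, A v =
      ∑ i, ∑ α, (v.2.1 i α * w.1.2 (MultiIndex.single 2 i) α +
        w.2.1 i α * v.1.2 (MultiIndex.single 2 i) α) +
      ∑ I, ∑ α, (v.2.2 I α * w.1.2 (MultiIndex.ofTwo 1 I) α +
        w.2.2 I α * v.1.2 (MultiIndex.ofTwo 1 I) α) -
      fderiv ℝ (e.localLagrangian η L) (coordProj (by omega : 2 ≤ 3) w.1) (coordProj (by omega : 2 ≤ 3) v.1) := by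
  have hu : ∀ (I : MultiIndex m 3) α, HasFDerivAt (fun w : WrCoord m n => w.1.2 I α)
      ((du I α).comp (ContinuousLinearMap.fst ℝ _ _)) w := fun I α =>
    ContinuousLinearMap.hasFDerivAt ((du I α).comp (ContinuousLinearMap.fst ℝ (JetCoord m n 3)
      ((Fin m → Fin n → ℝ) × (Sym (Fin m) 2 → Fin n → ℝ))))
  have hp₁ : ∀ i α, HasFDerivAt (fun w : WrCoord m n => w.2.1 i α)
      ((ContinuousLinearMap.proj (R := ℝ) (φ := fun _ : Fin n => ℝ) α).comp
        ((ContinuousLinearMap.proj (R := ℝ) (φ := fun _ : Fin m => Fin n → ℝ) i).comp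
          ((ContinuousLinearMap.fst ℝ _ _).comp (ContinuousLinearMap.snd ℝ _ _)))) w := fun i α =>
    hasFDerivAt_pi'.1 (hasFDerivAt_pi'.1 hasFDerivAt_snd.fst i) α
  have hp₂ : ∀ I α, HasFDerivAt (fun w : WrCoord m n => w.2.2 I α)
      ((ContinuousLinearMap.proj (R := ℝ) (φ := fun _ : Fin n => ℝ) α).comp
        ((ContinuousLinearMap.proj (R := ℝ) (φ := fun _ : Sym (Fin m) 2 => Fin n → ℝ) I).comp
          ((ContinuousLinearMap.snd ℝ _ _).comp (ContinuousLinearMap.snd ℝ _ _)))) w := fun I α =>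
    hasFDerivAt_pi'.1 (hasFDerivAt_pi'.1 hasFDerivAt_snd.snd I) α
  have hP : HasFDerivAt (fun w : WrCoord m n => (coordProj (by omega : 2 ≤ 3) w.1))
      ((coordProj (by omega : 2 ≤ 3)).comp (ContinuousLinearMap.fst ℝ (JetCoord m n 3) _)) w :=
    HasFDerivAt.comp (g := coordProj (by omega : 2 ≤ 3)) w
      (ContinuousLinearMap.hasFDerivAt (coordProj (by omega : 2 ≤ 3))) hasFDerivAt_fst
  refine ⟨_, ((HasFDerivAt.fun_sum fun i _ => HasFDerivAt.fun_sum fun α _ =>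
      (hp₁ i α).fun_mul (hu (MultiIndex.single 2 i) α)).fun_add
    (HasFDerivAt.fun_sum fun I _ => HasFDerivAt.fun_sum fun α _ =>
      (hp₂ I α).fun_mul (hu (MultiIndex.ofTwo 1 I) α))).fun_sub
    (HasFDerivAt.comp (g := e.localLagrangian η L) w hΛ.hasFDerivAt hP), fun v => ?_⟩
  simp only [_root_.sub_apply, _root_.add_apply, _root_.sum_apply, _root_.smul_apply,
    ContinuousLinearMap.comp_apply, smul_eq_mul]
  congr 2
  · refine Finset.sum_congr rfl fun i _ => Finset.sum_congr rfl fun α _ => ?_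
    rw [add_comm, mul_comm (w.1.2 _ _)]
    rfl
  · refine Finset.sum_congr rfl fun i _ => Finset.sum_congr rfl fun α _ => ?_
    rw [add_comm, mul_comm (w.1.2 _ _)]
    rfl

theorem fderiv_hamiltonianSection {w : WrCoord m n}
    (hH : DifferentiableAt ℝ (e.hamiltonian η L) w) (v : WrCoord m n) :
    fderiv ℝ (e.hamiltonianSection η L) w v =
      (v.1, -fderiv ℝ (e.hamiltonian η L) w v, v.2) := by
  have hd : HasFDerivAt (e.hamiltonianSection η L)
      ((ContinuousLinearMap.fst ℝ (JetCoord m n 3) _).prod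
        ((-fderiv ℝ (e.hamiltonian η L) w).prod (ContinuousLinearMap.snd ℝ _ _))) w :=
    hasFDerivAt_fst.prodMk (hH.hasFDerivAt.neg.prodMk hasFDerivAt_snd)
  rw [hd.fderiv]
  rfl

theorem contractOmegaR_apply {w : WrCoord m n}
    (hH : DifferentiableAt ℝ (e.hamiltonian η L) w) (X : WrCoord m n → WrCoord m n)
    (v : Fin m → WrCoord m n) :
    e.contractOmegaR η L X w v =
      ∑ b, momentumForm (-fderiv ℝ (e.hamiltonian η L) w (v b)) (v b).2.1 (v b).2.2
        (Function.update (fun c => coordProj (by omega : 1 ≤ 3) (v c).1) b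
          (coordProj (by omega : 1 ≤ 3) (X w).1)) -
      momentumForm (-fderiv ℝ (e.hamiltonian η L) w (X w)) (X w).2.1 (X w).2.2
        (fun c => coordProj (by omega : 1 ≤ 3) (v c).1) := by
  have hcons : (fun i => fderiv ℝ (e.hamiltonianSection η L) w
      ((Fin.cons (X w) v : Fin (m + 1) → WrCoord m n) i)) =
      Fin.cons (fderiv ℝ (e.hamiltonianSection η L) w (X w))
        (fun c => fderiv ℝ (e.hamiltonianSection η L) w (v c)) := by
    funext i
    exact Fin.cases rfl (fun j => rfl) i
  have h1 : e.contractOmegaR η L X w v =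
      Omega m n (e.hamiltonianSection η L w) (fun i => fderiv ℝ (e.hamiltonianSection η L) w
        ((Fin.cons (X w) v : Fin (m + 1) → WrCoord m n) i)) := rfl
  rw [h1, hcons, Omega_apply_cons]
  simp only [Theta_apply, fderiv_hamiltonianSection hH]
  congr 1
  refine Finset.sum_congr rfl fun b _ => congrArg _ (funext fun c => ?_)
  by_cases hc : c = b
  · subst hc; simp
  · simp [hc]

end AdaptedChart

end Contraction

/-! ### The first constraint submanifold -/

section Constraint

variable {m n : ℕ}

theorem momentumForm_zero (p : ℝ) (v : Fin m → JetCoord m n 1) :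
    momentumForm p (0 : Fin m → Fin n → ℝ) 0 v = p * (baseMatrix v).det := by
  rw [← wedge_dx]
  simp [momentumForm]

variable {M E : Type*}
  [TopologicalSpace M] [ChartedSpace (Fin m → ℝ) M]
  [TopologicalSpace E] [ChartedSpace ((Fin m → ℝ) × (Fin n → ℝ)) E]
  {π : E → M}

namespace AdaptedChart

variable {e e' : AdaptedChart (m := m) (n := n) π}
  {η : (x : M) → (TangentSpace 𝓘(ℝ, Fin m → ℝ) x) [⋀^Fin m]→L[ℝ] ℝ}
  {L : JetBundle m n π 2 → ℝ}

theorem differentiableAt_hamiltonian {c : WrCoord m n}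
    (hΛ : DifferentiableAt ℝ (e.localLagrangian η L) (coordProj (by omega : 2 ≤ 3) c.1)) :
    DifferentiableAt ℝ (e.hamiltonian η L) c := by
  obtain ⟨A, hA, -⟩ := hasFDerivAt_hamiltonian hΛ
  exact hA.differentiableAt

theorem fderiv_hamiltonian_of_vertical {c : WrCoord m n}
    (hΛ : DifferentiableAt ℝ (e.localLagrangian η L) (coordProj (by omega : 2 ≤ 3) c.1))
    {v : WrCoord m n} (hv : v.1.1 = 0) (hv₀ : v.1.2 (MultiIndex.zero m 3) = 0) (hv₂ : v.2 = 0) :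
    fderiv ℝ (e.hamiltonian η L) c v =
      ∑ i, ∑ α, (c.2.1 i α - partialU (MultiIndex.single 1 i) α (e.localLagrangian η L)
        (coordProj (by omega : 2 ≤ 3) c.1)) * v.1.2 (MultiIndex.single 2 i) α +
      ∑ I, ∑ α, (c.2.2 I α - legendreCoordTwo (e.localLagrangian η L) c.1 I α) *
        v.1.2 (MultiIndex.ofTwo 1 I) α := by
  obtain ⟨A, hA, hAv⟩ := hasFDerivAt_hamiltonian hΛ
  rw [hA.fderiv, hAv]
  set D := fderiv ℝ (e.localLagrangian η L) (coordProj (by omega : 2 ≤ 3) c.1) with hD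
  have hproj : coordProj (by omega : 2 ≤ 3) v.1 =
      ((0 : Fin m → ℝ), (coordProj (by omega : 2 ≤ 3) v.1).2) := Prod.ext hv rfl
  have hI : ∀ (I : MultiIndex m 2) (b : Fin n → ℝ),
      D (inclU I b) = ∑ α, D (ddu I α) * b α := by
    intro I b
    conv_lhs => rw [← Finset.univ_sum_single b, map_sum, map_sum]
    refine Finset.sum_congr rfl fun α _ => ?_
    have hb : (Pi.single α (b α) : Fin n → ℝ) = b α • Pi.single α 1 := by
      rw [← Pi.single_smul]; simp
    rw [hb, map_smul, map_smul, smul_eq_mul, mul_comm, inclU_single]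
  rw [hproj, apply_eq_sum_inclU, sum_multiIndex_two]
  have h0 : (coordProj (by omega : 2 ≤ 3) v.1).2 (MultiIndex.zero m 2) = 0 := hv₀
  have h1 : ∀ i, (coordProj (by omega : 2 ≤ 3) v.1).2 (MultiIndex.single 1 i) =
      v.1.2 (MultiIndex.single 2 i) := fun i => rfl
  have h2 : ∀ I, (coordProj (by omega : 2 ≤ 3) v.1).2 (MultiIndex.ofTwo 0 I) =
      v.1.2 (MultiIndex.ofTwo 1 I) := fun I => rfl
  simp only [h0, h1, h2, hI, map_zero, zero_add, hv₂, Prod.fst_zero, Prod.snd_zero, Pi.zero_apply,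
    zero_mul, sub_mul, Finset.sum_sub_distrib]
  simp only [legendreCoordTwo, partialU, hD]
  ring

/-- The contraction of `Ω_r` with a vector that is vertical over `J^2π^‡`. -/
theorem contractOmegaR_of_vertical {c : WrCoord m n}
    (hΛ : DifferentiableAt ℝ (e.localLagrangian η L) (coordProj (by omega : 2 ≤ 3) c.1))
    {X : WrCoord m n → WrCoord m n} (hX₁ : coordProj (by omega : 1 ≤ 3) (X c).1 = 0)
    (hX₂ : (X c).2 = 0) (v : Fin m → WrCoord m n) :
    e.contractOmegaR η L X c v =
      (∑ I, ∑ α, (c.2.2 I α - legendreCoordTwo (e.localLagrangian η L) c.1 I α) *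
        (X c).1.2 (MultiIndex.ofTwo 1 I) α) *
        (baseMatrix fun a => coordProj (by omega : 1 ≤ 3) (v a).1).det := by
  have hz : ∀ i, (X c).1.2 (MultiIndex.single 2 i) = 0 := fun i =>
    congrFun (congrArg Prod.snd hX₁) (MultiIndex.single 0 i)
  have hH := fderiv_hamiltonian_of_vertical hΛ (v := X c) (congrArg Prod.fst hX₁)
    (congrFun (congrArg Prod.snd hX₁) (MultiIndex.zero m 1)) hX₂
  simp only [hz, Pi.zero_apply, mul_zero, Finset.sum_const_zero, zero_add] at hH
  rw [contractOmegaR_apply (differentiableAt_hamiltonian hΛ), hX₁, hX₂, ← hH]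
  have h0 : ∀ b, momentumForm (-fderiv ℝ (e.hamiltonian η L) c (v b)) (v b).2.1 (v b).2.2
      (Function.update (fun c => coordProj (by omega : 1 ≤ 3) (v c).1) b 0) = 0 := fun b =>
    ContinuousAlternatingMap.map_coord_zero _ b (Function.update_self _ _ _)
  simp only [h0, Finset.sum_const_zero, zero_sub]
  rw [Prod.fst_zero, Prod.snd_zero, momentumForm_zero, neg_mul, neg_neg]

theorem coordProj_inclU_ofTwo (I : Sym (Fin m) 2) (b : Fin n → ℝ) :
    coordProj (by omega : 1 ≤ 3) (inclU (MultiIndex.ofTwo 1 I) b : JetCoord m n 3) = 0 := by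
  refine Prod.ext rfl (funext fun J => ?_)
  have hJ : J.castLE (by omega : 1 ≤ 3) ≠ MultiIndex.ofTwo 1 I := fun h => by
    have h1 : J.1 = I.1 := congrArg (fun K : MultiIndex m 3 => K.1) h
    have h2 := J.2
    rw [h1] at h2
    exact absurd (I.2.symm.trans_le h2) (by norm_num)
  change (Pi.single (MultiIndex.ofTwo 1 I) b : MultiIndex m 3 → Fin n → ℝ)
    (J.castLE (by omega : 1 ≤ 3)) = 0
  rw [Pi.single_eq_of_ne hJ]

/-- The contraction of `Ω_r` with `∂/∂u_I^α`, `|I| = 2`, evaluated on vectors that project to the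
coordinate basis of the base. -/
theorem contractOmegaR_inclU_ofTwo {c : WrCoord m n}
    (hΛ : DifferentiableAt ℝ (e.localLagrangian η L) (coordProj (by omega : 2 ≤ 3) c.1))
    (I : Sym (Fin m) 2) (α : Fin n) {v : Fin m → WrCoord m n}
    (hv : ∀ a, (v a).1.1 = Pi.single a 1) :
    e.contractOmegaR η L (fun _ => (inclU (MultiIndex.ofTwo 1 I) (Pi.single α 1), 0)) c v =
      c.2.2 I α - legendreCoordTwo (e.localLagrangian η L) c.1 I α := by
  have hdet : (baseMatrix fun a => coordProj (by omega : 1 ≤ 3) (v a).1) =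
      (1 : Matrix (Fin m) (Fin m) ℝ) := by
    rw [← baseMatrix_ddx (n := n) (k := 1)]
    ext i j
    exact congrFun (hv j) i
  have hinj : ∀ J, J ≠ I → MultiIndex.ofTwo 1 J ≠ MultiIndex.ofTwo 1 I := fun J hJ h =>
    hJ (Subtype.ext (congrArg (fun K : MultiIndex m 3 => K.1) h))
  rw [contractOmegaR_of_vertical hΛ (coordProj_inclU_ofTwo I _) rfl, hdet, Matrix.det_one, mul_one,
    Finset.sum_eq_single_of_mem I (Finset.mem_univ _)]
  · rw [inclU_self]
    simp [Pi.single_apply]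
  · intro J _ hJ
    simp [inclU, hinj J hJ]

/-- The equations of `W_c` in one adapted chart. The coordinates `u_I` with `|I| = 3` do not occur in
`Ω_r`, and those with `|I| = 2` only through the Hamiltonian. -/
theorem forall_contractOmegaR_eq_zero_iff {c : WrCoord m n} (hc : c ∈ e.wrTarget)
    (hΛ : DifferentiableAt ℝ (e.localLagrangian η L) (coordProj (by omega : 2 ≤ 3) c.1)) :
    (∀ X : WrCoord m n → WrCoord m n, ContDiffOn ℝ ∞ X e.wrTarget →
      (∀ c ∈ e.wrTarget, coordProj (by omega : 1 ≤ 3) (X c).1 = 0 ∧ (X c).2 = 0) →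
      ∀ v, e.contractOmegaR η L X c v = 0) ↔
    c.2.2 = legendreCoordTwo (e.localLagrangian η L) c.1 := by
  refine ⟨fun h => funext fun I => funext fun α => sub_eq_zero.1 ?_, fun h X _ hX v => ?_⟩
  · rw [← contractOmegaR_inclU_ofTwo hΛ I α (v := fun a => (ddx n 3 a, 0)) fun a => rfl]
    exact h _ contDiffOn_const (fun _ _ => ⟨coordProj_inclU_ofTwo I _, rfl⟩) _
  · rw [contractOmegaR_of_vertical hΛ (hX c hc).1 (hX c hc).2]
    simp [h]

theorem coordProj_inclU_single (i : Fin m) (b : Fin n → ℝ) :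
    coordProj (by omega : 1 ≤ 3) (inclU (MultiIndex.single 2 i) b : JetCoord m n 3) =
      inclU (MultiIndex.single 0 i) b := by
  refine Prod.ext rfl (funext fun J => ?_)
  change (Pi.single (MultiIndex.single 2 i) b : MultiIndex m 3 → Fin n → ℝ)
    (J.castLE (by omega : 1 ≤ 3)) = (Pi.single (MultiIndex.single 0 i) b :
      MultiIndex m 1 → Fin n → ℝ) J
  by_cases hJ : J = MultiIndex.single 0 i
  · subst hJ
    rw [Pi.single_eq_same]
    exact Pi.single_eq_same (M := fun _ => Fin n → ℝ) (MultiIndex.single 2 i) b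
  · have hJ' : J.castLE (by omega : 1 ≤ 3) ≠ MultiIndex.single 2 i := fun h =>
      hJ (Subtype.ext (congrArg (fun K : MultiIndex m 3 => K.1) h))
    rw [Pi.single_eq_of_ne hJ, Pi.single_eq_of_ne hJ']

/-- The contraction of `Ω_r` with `∂/∂u_i^α`, evaluated on vectors that project to the coordinate
basis of the base. -/
theorem contractOmegaR_inclU_single {c : WrCoord m n}
    (hΛ : DifferentiableAt ℝ (e.localLagrangian η L) (coordProj (by omega : 2 ≤ 3) c.1))
    (i : Fin m) (α : Fin n) {v : Fin m → WrCoord m n} (hv : ∀ a, (v a).1.1 = Pi.single a 1) :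
    e.contractOmegaR η L (fun _ => (inclU (MultiIndex.single 2 i) (Pi.single α 1), 0)) c v =
      ∑ b, 1 / nfac i b * (v b).2.2 (pairIndex i b) α + (c.2.1 i α -
        partialU (MultiIndex.single 1 i) α (e.localLagrangian η L) (coordProj (by omega : 2 ≤ 3) c.1)) := by
  have hbase : (baseMatrix fun a => coordProj (by omega : 1 ≤ 3) (v a).1) =
      (1 : Matrix (Fin m) (Fin m) ℝ) := by
    rw [← baseMatrix_ddx (n := n) (k := 1)]
    ext i j
    exact congrFun (hv j) i
  have hu0 : (inclU (MultiIndex.single 2 i) (Pi.single α 1) : JetCoord m n 3).2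
      (MultiIndex.zero m 3) = 0 := by
    have h := congrFun (congrArg Prod.snd (coordProj_inclU_single i (Pi.single α (1 : ℝ))))
      (MultiIndex.zero m 1)
    exact h.trans (inclU_single_zero _ _)
  have hu1 : ∀ j, (inclU (MultiIndex.single 2 i) (Pi.single α 1) : JetCoord m n 3).2
      (MultiIndex.single 2 j) = if j = i then Pi.single α 1 else 0 := by
    intro j
    have h := congrFun (congrArg Prod.snd (coordProj_inclU_single i (Pi.single α (1 : ℝ))))
      (MultiIndex.single 0 j)
    refine h.trans ?_
    split_ifs with hj
    · rw [hj, inclU_self]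
    · rw [inclU_single_of_ne (Ne.symm hj)]
  have hu2 : ∀ I, (inclU (MultiIndex.single 2 i) (Pi.single α 1) : JetCoord m n 3).2
      (MultiIndex.ofTwo 1 I) = 0 := by
    intro I
    have hI : MultiIndex.ofTwo 1 I ≠ MultiIndex.single 2 i := fun h => by
      have h1 : I.1 = {i} := congrArg (fun K : MultiIndex m 3 => K.1) h
      have h2 : I.1.card = 2 := I.2
      rw [h1] at h2
      exact absurd h2 (by simp)
    simp [inclU, hI]
  have hD : fderiv ℝ (e.hamiltonian η L) c (inclU (MultiIndex.single 2 i) (Pi.single α 1), 0) =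
      c.2.1 i α - partialU (MultiIndex.single 1 i) α (e.localLagrangian η L)
        (coordProj (by omega : 2 ≤ 3) c.1) := by
    rw [fderiv_hamiltonian_of_vertical hΛ rfl hu0 rfl,
      Finset.sum_eq_single_of_mem i (Finset.mem_univ _)]
    · simp [hu1, hu2, Pi.single_apply]
    · intro j _ hj
      simp [hu1, hj]
  have hterm : ∀ b, momentumForm (-fderiv ℝ (e.hamiltonian η L) c (v b)) (v b).2.1 (v b).2.2
      (Function.update (fun c => coordProj (by omega : 1 ≤ 3) (v c).1) b
        (inclU (MultiIndex.single 0 i) (Pi.single α 1))) =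
      1 / nfac i b * (v b).2.2 (pairIndex i b) α := by
    intro b
    rw [momentumForm_apply_of_vertical _ _ _ _ b (by rw [Function.update_self]; rfl)]
    simp only [Function.update_self, adjugate_baseMatrix_update, hbase, Matrix.adjugate_one,
      Matrix.one_apply, inclU_single_zero, Pi.zero_apply, mul_zero, Finset.sum_const_zero, zero_add,
      mul_ite, mul_one]
    rw [Finset.sum_ite_eq, if_pos (Finset.mem_univ _),
      Finset.sum_eq_single_of_mem i (Finset.mem_univ _)]
    · simp [inclU_self, Pi.single_apply]
    · intro j _ hj
      simp [inclU_single_of_ne hj.symm]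
  rw [contractOmegaR_apply (differentiableAt_hamiltonian hΛ), coordProj_inclU_single, hD]
  simp only [hterm]
  rw [Prod.fst_zero, Prod.snd_zero, momentumForm_zero, hbase, Matrix.det_one]
  ring

/-- The momenta `p^I`, `|I| = 2`, of points of `J^2π^‡` can be compared in any adapted chart,
because their change of coordinates does not involve the `p^i`. -/
theorem momentumTwo_congr {u : JetBundle m n π 1} (hu : u ∈ e.jetSource 1)
    (hu' : u ∈ e'.jetSource 1) {q q' : RestrictedFibre u}
    (h : e.momentumTwo ⟨u, q⟩ = e.momentumTwo ⟨u, q'⟩) :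
    e'.momentumTwo ⟨u, q⟩ = e'.momentumTwo ⟨u, q'⟩ := by
  have h₂ : ∀ i j α, e.momentum u j (MultiIndex.single 0 i) α q =
      e.momentum u j (MultiIndex.single 0 i) α q' := fun i j α =>
    mul_left_cancel₀ (nfac_ne_zero i j) ((momentumTwo_pairIndex q i j α).symm.trans
      ((congrFun (congrFun h (pairIndex i j)) α).trans (momentumTwo_pairIndex q' i j α)))
  obtain ⟨ξ, rfl⟩ := Submodule.Quotient.mk_surjective _ q
  obtain ⟨ξ', rfl⟩ := Submodule.Quotient.mk_surjective _ q'
  have hm : ∀ l k, formMomentum (ξ.1 e) l (MultiIndex.single 0 k) =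
      formMomentum (ξ'.1 e) l (MultiIndex.single 0 k) := fun l k =>
    clm_ext_single fun α => h₂ k l α
  funext I α
  obtain ⟨i, j, rfl⟩ := exists_pairIndex I
  refine (momentumTwo_pairIndex _ i j α).trans (Eq.trans ?_ (momentumTwo_pairIndex _ i j α).symm)
  rw [momentum_mk, momentum_mk, ξ.2.2.1 e' e hu' hu, ξ'.2.2.1 e' e hu' hu,
    formMomentum_transition (ξ.2.2.2.1 e) hu' hu, formMomentum_transition (ξ'.2.2.2.1 e) hu' hu]
  simp only [hm]

end AdaptedChart

end Constraint

/-! ### Solutions of the field equation -/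

section Solutions

variable {m n : ℕ} {M E : Type*}
  [TopologicalSpace M] [ChartedSpace (Fin m → ℝ) M]
  [TopologicalSpace E] [ChartedSpace ((Fin m → ℝ) × (Fin n → ℝ)) E]
  {π : E → M}

namespace AdaptedChart

variable {e : AdaptedChart (m := m) (n := n) π}
  {η : (x : M) → (TangentSpace 𝓘(ℝ, Fin m → ℝ) x) [⋀^Fin m]→L[ℝ] ℝ}
  {L : JetBundle m n π 2 → ℝ} {U : Set M} {ψ : M → Wr m n π}

theorem isOpen_exprDomain (hU : IsOpen U) (hψ : IsSmoothSection U ψ) :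
    IsOpen (e.exprDomain U ψ) :=
  e.base.isOpen_inter_preimage_symm
    (hψ.2.1.continuousOn.isOpen_inter_preimage hU e.total.open_source)

theorem wrCoord_mem_target {w : Wr m n π} (hw : w ∈ e.wrSource) : e.wrCoord w ∈ e.wrTarget :=
  jetCoord_mem_target (z := w.1) hw

theorem wrExpr_fst (hψ : IsHolonomic U ψ) {y : Fin m → ℝ} (hy : y ∈ e.exprDomain U ψ) :
    SmoothNear (e.expr fun x => (ψ x).toE) y ∧
      (e.wrExpr ψ y).1 = prolong 3 (e.expr fun x => (ψ x).toE) y := by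
  obtain ⟨h, hj⟩ := hψ _ hy.2.1
  have hs := smoothNear_expr h hy.2.2
  have hc := jetCoord_jet (k := 3) h hy.2.2
  rw [e.base.right_inv hy.1] at hs hc
  refine ⟨hs, ?_⟩
  rw [← hc, ← hj]
  rfl

/-- The field equation for `X = ∂/∂u_I^α`, `|I| = 2`, gives the momenta `p^I` on a neighbourhood of
each point, and then for `X = ∂/∂u_i^α` it gives the momenta `p^i`. -/
theorem wrExpr_eq_of_isSolution (hη : IsVolumeForm η) (hL : IsSmoothOnJets L) (hU : IsOpen U)
    (hψ : IsSolution η L U ψ) {y : Fin m → ℝ} (hy : y ∈ e.exprDomain U ψ) :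
    (e.wrExpr ψ y).2 = (legendreCoordOne (e.localLagrangian η L) (e.wrExpr ψ y).1,
      legendreCoordTwo (e.localLagrangian η L) (e.wrExpr ψ y).1) := by
  obtain ⟨hsm, hhol, heq⟩ := hψ
  have hopen := isOpen_exprDomain (e := e) hU hsm
  set f := e.expr fun x => (ψ x).toE with hf
  set Λ := e.localLagrangian η L with hΛ
  have hΛs : ∀ y ∈ e.exprDomain U ψ, SmoothNear Λ (prolong 2 f y) := by
    intro y hy
    have h := smoothNear_localLagrangian hη hL (coordProj_mem_target (e := e) (by omega : 2 ≤ 3)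
      (wrCoord_mem_target hy.2.2))
    change SmoothNear Λ (coordProj (by omega : 2 ≤ 3) (e.wrExpr ψ y).1) at h
    rwa [(wrExpr_fst hhol hy).2, coordProj_prolong] at h
  have hΛd : ∀ y ∈ e.exprDomain U ψ,
      DifferentiableAt ℝ Λ (coordProj (by omega : 2 ≤ 3) (e.wrExpr ψ y).1) := fun y hy => by
    rw [(wrExpr_fst hhol hy).2]
    exact (hΛs y hy).differentiableAt
  have hdiff : ∀ y ∈ e.exprDomain U ψ, DifferentiableAt ℝ (e.wrExpr ψ) y := fun y hy =>
    ((hsm.2.2 e).contDiffAt (hopen.mem_nhds hy)).differentiableAt (by simp)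
  have hbase : ∀ y ∈ e.exprDomain U ψ, ∀ a : Fin m,
      (fderiv ℝ (e.wrExpr ψ) y (Pi.single a 1)).1.1 = Pi.single a 1 := by
    intro y hy a
    have h1 := congrArg (fun A => A (Pi.single a 1)) (hdiff y hy).hasFDerivAt.fst.fderiv
    have h2 : (fun y => (e.wrExpr ψ y).1) =ᶠ[𝓝 y] prolong 3 f := by
      filter_upwards [hopen.mem_nhds hy] with y' hy' using (wrExpr_fst hhol hy').2
    rw [h2.fderiv_eq, fderiv_prolong (wrExpr_fst hhol hy).1] at h1
    exact (congrArg Prod.fst h1).symm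
  have htwo : ∀ y ∈ e.exprDomain U ψ,
      (e.wrExpr ψ y).2.2 = legendreCoordTwo Λ (e.wrExpr ψ y).1 := by
    intro y hy
    funext I α
    rw [← sub_eq_zero, ← contractOmegaR_inclU_ofTwo (hΛd y hy) I α (hbase y hy)]
    exact heq e _ contDiffOn_const y hy fun a => Pi.single a 1
  have hone : (e.wrExpr ψ y).2.1 = legendreCoordOne Λ (e.wrExpr ψ y).1 := by
    funext i α
    have h := heq e (fun _ => (inclU (MultiIndex.single 2 i) (Pi.single α 1), 0)) contDiffOn_const
      y hy fun a => Pi.single a 1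
    rw [contractOmegaR_inclU_single (hΛd y hy) i α (hbase y hy)] at h
    have hp : ∀ b, (fderiv ℝ (e.wrExpr ψ) y (Pi.single b 1)).2.2 (pairIndex i b) α =
        totalDeriv b (partialU (MultiIndex.ofTwo 0 (pairIndex i b)) α Λ) (prolong 3 f y) := by
      intro b
      have hG : SmoothNear (partialU (MultiIndex.ofTwo 0 (pairIndex i b)) α Λ) (prolong 2 f y) :=
        (hΛs y hy).fderiv_apply _
      rw [totalDeriv_prolong (wrExpr_fst hhol hy).1 hG.differentiableAt]
      have h1 := congrArg (fun A => A (Pi.single b 1)) (hasFDerivAt_pi'.1 (hasFDerivAt_pi'.1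
        (hdiff y hy).hasFDerivAt.snd.snd (pairIndex i b)) α).fderiv
      refine Eq.trans h1.symm ?_
      congr 1
      refine Filter.EventuallyEq.fderiv_eq ?_
      filter_upwards [hopen.mem_nhds hy] with y' hy'
      rw [htwo y' hy', (wrExpr_fst hhol hy').2]
      rfl
    simp only [hp] at h
    rw [legendreCoordOne, (wrExpr_fst hhol hy).2]
    rw [(wrExpr_fst hhol hy).2] at h
    linarith
  exact Prod.ext hone (htwo y hy)

end AdaptedChart

end Solutions

/-! ### Submanifolds given as graphs -/

section Submanifolds

variable {m n : ℕ} {M E : Type*}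
  [TopologicalSpace M] [ChartedSpace (Fin m → ℝ) M]
  [TopologicalSpace E] [ChartedSpace ((Fin m → ℝ) × (Fin n → ℝ)) E]
  {π : E → M}

theorem card_sym_two (m : ℕ) : Fintype.card (Sym (Fin m) 2) = m * (m + 1) / 2 := by
  rw [Sym.card_sym_eq_multichoose, Fintype.card_fin, Nat.multichoose_eq,
    show m + 2 - 1 = m + 1 from rfl, Nat.choose_two_right, Nat.add_sub_cancel, mul_comm]

/-- A subset of `W_r` on which a linear surjective function of the momenta is prescribed as a smooth
function of the jet coordinates is a submanifold. -/
theorem isSubmanifoldOfCodim_of_momenta {κ : Type*} [Fintype κ]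
    (A : ((Fin m → Fin n → ℝ) × (Sym (Fin m) 2 → Fin n → ℝ)) →ₗ[ℝ] (κ → ℝ))
    (hA : Function.Surjective A) {S : Set (Wr m n π)}
    (G : AdaptedChart (m := m) (n := n) π → JetCoord m n 3 → κ → ℝ)
    (hG : ∀ e, ContDiffOn ℝ ∞ (G e) (e.jetTarget 3))
    (hS : ∀ e : AdaptedChart (m := m) (n := n) π, ∀ w ∈ e.wrSource,
      w ∈ S ↔ A (e.wrCoord w).2 = G e (e.wrCoord w).1) :
    IsSubmanifoldOfCodim S (Fintype.card κ) := by
  intro w _ e hwe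
  set B : (κ → ℝ) ≃ₗ[ℝ] (Fin (Fintype.card κ) → ℝ) :=
    LinearEquiv.funCongrLeft ℝ ℝ (Fintype.equivFin κ).symm with hB
  set BA := (B.toLinearMap.comp A).toContinuousLinearMap with hBA
  set B' := B.toLinearMap.toContinuousLinearMap with hB'
  have hopen : IsOpen (e.wrTarget) :=
    (AdaptedChart.isOpen_jetTarget (e := e) (k := 3)).preimage continuous_fst
  have hGs : ContDiffOn ℝ ∞ (fun c : WrCoord m n => B' (G e c.1)) e.wrTarget :=
    B'.contDiff.comp_contDiffOn ((hG e).comp contDiff_fst.contDiffOn fun c hc => hc)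
  refine ⟨e.wrTarget, fun c => BA c.2 - B' (G e c.1), hopen, AdaptedChart.wrCoord_mem_target hwe,
    subset_rfl, (BA.contDiff.comp contDiff_snd).contDiffOn.sub hGs, fun c hc y => ?_,
    fun w' hw' _ => ?_⟩
  · obtain ⟨p, hp⟩ := hA (B.symm y)
    have hGd : DifferentiableAt ℝ (fun c => B' (G e c)) c.1 :=
      (B'.contDiff.comp_contDiffOn (hG e)).contDiffAt
        (AdaptedChart.isOpen_jetTarget.mem_nhds hc) |>.differentiableAt (by simp)
    have hd := (HasFDerivAt.comp (g := BA) c BA.hasFDerivAt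
      (hasFDerivAt_snd (p := c))).fun_sub (HasFDerivAt.comp (g := fun c => B' (G e c)) c
        hGd.hasFDerivAt (hasFDerivAt_fst (p := c)))
    refine ⟨(0, p), ?_⟩
    have hd' : fderiv ℝ (fun c : WrCoord m n => BA c.2 - B' (G e c.1)) c = _ := hd.fderiv
    rw [hd']
    have hBAp : BA p = y := by
      change B (A p) = y
      rw [hp, LinearEquiv.apply_symm_apply]
    simp [hBAp]
  · rw [hS e w' hw', sub_eq_zero]
    exact (B.injective.eq_iff).symm

end Submanifolds

end SecondOrderField

end

theorem mainTheorem2 {m n : ℕ} {M E : Type*}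
    [TopologicalSpace M] [T2Space M] [SecondCountableTopology M]
    [ChartedSpace (Fin m → ℝ) M] [IsManifold 𝓘(ℝ, Fin m → ℝ) ∞ M]
    [TopologicalSpace E] [T2Space E] [SecondCountableTopology E]
    [ChartedSpace ((Fin m → ℝ) × (Fin n → ℝ)) E]
    [IsManifold 𝓘(ℝ, (Fin m → ℝ) × (Fin n → ℝ)) ∞ E]
    (π : E → M) (hsurj : Function.Surjective π)
    (hsubm : Manifold.IsSubmersionOfComplement (Fin n → ℝ)
      𝓘(ℝ, (Fin m → ℝ) × (Fin n → ℝ)) 𝓘(ℝ, Fin m → ℝ) ∞ π)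
    (η : (x : M) → (TangentSpace 𝓘(ℝ, Fin m → ℝ) x) [⋀^Fin m]→L[ℝ] ℝ)
    (hη : SecondOrderField.IsVolumeForm η)
    (L : SecondOrderField.JetBundle m n π 2 → ℝ)
    (hL : SecondOrderField.IsSmoothOnJets L) :
    ∃ (WL : Set (SecondOrderField.Wr m n π))
      (FL : SecondOrderField.JetBundle m n π 3 →
        SecondOrderField.RestrictedMomentumBundle m n π),
      SecondOrderField.IsBundleMap FL ∧
      (∀ e : SecondOrderField.AdaptedChart (m := m) (n := n) π, ∀ z ∈ e.jetSource 3,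
        (∀ (i : Fin m) (α : Fin n),
          e.momentumOne (FL z) i α =
            SecondOrderField.partialU (SecondOrderField.MultiIndex.single 1 i) α
                (e.localLagrangian η L)
                (SecondOrderField.coordProj (by omega) (e.jetCoord 3 z))
              - ∑ j, (1 / SecondOrderField.nfac i j) *
                  SecondOrderField.totalDeriv j
                    (SecondOrderField.partialU
                      (SecondOrderField.MultiIndex.ofTwo 0 (SecondOrderField.pairIndex i j)) α
                      (e.localLagrangian η L))
                    (e.jetCoord 3 z)) ∧
        (∀ (I : Sym (Fin m) 2) (α : Fin n),
          e.momentumTwo (FL z) I α =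
            SecondOrderField.partialU (SecondOrderField.MultiIndex.ofTwo 0 I) α
              (e.localLagrangian η L)
              (SecondOrderField.coordProj (by omega) (e.jetCoord 3 z)))) ∧
      WL = SecondOrderField.graphOf FL ∧
      WL ⊆ SecondOrderField.Wc η L ∧
      SecondOrderField.IsSubmanifoldOfCodim (SecondOrderField.Wc η L)
        (n * (m * (m + 1) / 2)) ∧
      SecondOrderField.IsSubmanifoldOfCodim WL (n * (m * (m + 1) / 2) + n * m) ∧
      ∀ (U : Set M) (ψ : M → SecondOrderField.Wr m n π), IsOpen U →
        SecondOrderField.IsSolution η L U ψ → ∀ x ∈ U, ψ x ∈ WL := by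
  have hch : ∀ z : SecondOrderField.JetBundle m n π 3,
      ∃ e : SecondOrderField.AdaptedChart (m := m) (n := n) π, z ∈ e.jetSource 3 := fun z =>
    SecondOrderField.exists_adaptedChart hsubm z.toE
  have hex := fun z => SecondOrderField.AdaptedChart.exists_legendre hη hL (hch z).choose_spec
  choose q hq using hex
  set FL : SecondOrderField.JetBundle m n π 3 → SecondOrderField.RestrictedMomentumBundle m n π :=
    fun z => ⟨z.proj 1 (by omega), q z⟩ with hFL
  have h₁ : ∀ e : SecondOrderField.AdaptedChart (m := m) (n := n) π, ∀ z ∈ e.jetSource 3,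
      e.momentumOne (FL z) =
        SecondOrderField.legendreCoordOne (e.localLagrangian η L) (e.jetCoord 3 z) :=
    fun e z hz => (hq z e hz).1
  have h₂ : ∀ e : SecondOrderField.AdaptedChart (m := m) (n := n) π, ∀ z ∈ e.jetSource 3,
      e.momentumTwo (FL z) =
        SecondOrderField.legendreCoordTwo (e.localLagrangian η L) (e.jetCoord 3 z) :=
    fun e z hz => (hq z e hz).2
  have hΛ : ∀ e : SecondOrderField.AdaptedChart (m := m) (n := n) π, ∀ c ∈ e.jetTarget 3,
      SecondOrderField.SmoothNear (e.localLagrangian η L)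
        (SecondOrderField.coordProj (by omega : 2 ≤ 3) c) := fun e c hc =>
    SecondOrderField.AdaptedChart.smoothNear_localLagrangian hη hL
      (SecondOrderField.AdaptedChart.coordProj_mem_target _ hc)
  have hsrc : ∀ (e : SecondOrderField.AdaptedChart (m := m) (n := n) π)
      (z : SecondOrderField.JetBundle m n π 3), z ∈ e.jetSource 3 →
      z.proj 1 (by omega) ∈ e.jetSource 1 := by
    intro e z hz
    rwa [SecondOrderField.AdaptedChart.jetSource, Set.mem_ofPred_eq,
      SecondOrderField.JetBundle.toE_proj]
  -- in every chart, the graph is given by prescribing all momenta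
  have hgraph : ∀ e : SecondOrderField.AdaptedChart (m := m) (n := n) π, ∀ w ∈ e.wrSource,
      w ∈ SecondOrderField.graphOf FL ↔ (e.wrCoord w).2 =
        (SecondOrderField.legendreCoordOne (e.localLagrangian η L) (e.wrCoord w).1,
          SecondOrderField.legendreCoordTwo (e.localLagrangian η L) (e.wrCoord w).1) := by
    intro e w hw
    constructor
    · intro h
      have h' : FL w.toJet = w.toMomentum := h
      refine Prod.ext ?_ ?_
      · exact (congrArg e.momentumOne h').symm.trans (h₁ e w.1 hw)
      · exact (congrArg e.momentumTwo h').symm.trans (h₂ e w.1 hw)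
    · intro h
      have hqw : q w.1 = w.2 := by
        refine SecondOrderField.AdaptedChart.restrictedFibre_ext (e := e) (hsrc e w.1 hw)
          (fun i α => ?_) (fun I α => ?_)
        · exact congrFun (congrFun ((h₁ e w.1 hw).trans (congrArg Prod.fst h).symm) i) α
        · exact congrFun (congrFun ((h₂ e w.1 hw).trans (congrArg Prod.snd h).symm) I) α
      change (⟨w.1.proj 1 (by omega), q w.1⟩ :
        SecondOrderField.RestrictedMomentumBundle m n π) = ⟨w.1.proj 1 (by omega), w.2⟩
      rw [hqw]
  -- in every chart, `W_c` is given by prescribing the momenta `p^I`, `|I| = 2`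
  have hWc : ∀ e : SecondOrderField.AdaptedChart (m := m) (n := n) π, ∀ w ∈ e.wrSource,
      w ∈ SecondOrderField.Wc η L ↔ (e.wrCoord w).2.2 =
        SecondOrderField.legendreCoordTwo (e.localLagrangian η L) (e.wrCoord w).1 := by
    intro e w hw
    have hiff : ∀ e' : SecondOrderField.AdaptedChart (m := m) (n := n) π, w ∈ e'.wrSource →
        _ := fun e' hw' =>
      SecondOrderField.AdaptedChart.forall_contractOmegaR_eq_zero_iff (η := η) (L := L)
        (SecondOrderField.AdaptedChart.wrCoord_mem_target hw')
        (hΛ e' _ (SecondOrderField.AdaptedChart.wrCoord_mem_target hw')).differentiableAt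
    refine ⟨fun h => (hiff e hw).1 (h e hw), fun h e' hw' => (hiff e' hw').2 ?_⟩
    -- the momenta `p^I` agree with those of the restricted Legendre map in `e`, hence in `e'`
    exact (SecondOrderField.AdaptedChart.momentumTwo_congr (e := e) (e' := e')
      (hsrc e w.1 hw) (hsrc e' w.1 hw') (h.trans (h₂ e w.1 hw).symm)).trans (h₂ e' w.1 hw')
  have hs₁ : ∀ e : SecondOrderField.AdaptedChart (m := m) (n := n) π, ContDiffOn ℝ ∞
      (SecondOrderField.legendreCoordOne (e.localLagrangian η L)) (e.jetTarget 3) := fun e c hc =>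
    (SecondOrderField.smoothNear_legendreCoordOne (hΛ e c hc)).self.contDiffWithinAt
  have hs₂ : ∀ e : SecondOrderField.AdaptedChart (m := m) (n := n) π, ContDiffOn ℝ ∞
      (SecondOrderField.legendreCoordTwo (e.localLagrangian η L)) (e.jetTarget 3) := fun e c hc =>
    (SecondOrderField.smoothNear_legendreCoordTwo (hΛ e c hc)).self.contDiffWithinAt
  refine ⟨SecondOrderField.graphOf FL, FL,
    SecondOrderField.AdaptedChart.isBundleMap_of_formulas hη hL (fun _ => rfl) h₁ h₂,
    fun e z hz => ⟨fun i α => congrFun (congrFun (h₁ e z hz) i) α,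
      fun I α => congrFun (congrFun (h₂ e z hz) I) α⟩, rfl, fun w hw => ?_, ?_, ?_, ?_⟩
  · obtain ⟨e, he⟩ := hch w.1
    exact (hWc e w he).2 (congrArg Prod.snd ((hgraph e w he).1 hw))
  · have h := SecondOrderField.isSubmanifoldOfCodim_of_momenta (κ := Sym (Fin m) 2 × Fin n)
      { toFun := fun p k => p.2 k.1 k.2
        map_add' := fun _ _ => rfl
        map_smul' := fun _ _ => rfl }
      (fun y => ⟨(0, fun I α => y (I, α)), rfl⟩) (S := SecondOrderField.Wc η L)
      (fun e c k => SecondOrderField.legendreCoordTwo (e.localLagrangian η L) c k.1 k.2)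
      (fun e => contDiffOn_pi.2 fun k => contDiffOn_pi.1 (contDiffOn_pi.1 (hs₂ e) k.1) k.2)
      (fun e w hw => (hWc e w hw).trans ⟨fun h => funext fun k => by rw [← h]; rfl,
        fun h => funext fun I => funext fun α => congrFun h (I, α)⟩)
    rwa [Fintype.card_prod, SecondOrderField.card_sym_two, Fintype.card_fin, mul_comm] at h
  · have h := SecondOrderField.isSubmanifoldOfCodim_of_momenta
      (κ := (Sym (Fin m) 2 × Fin n) ⊕ (Fin m × Fin n))
      { toFun := fun p => Sum.elim (fun k => p.2 k.1 k.2) fun k => p.1 k.1 k.2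
        map_add' := fun _ _ => funext fun k => by rcases k with k | k <;> rfl
        map_smul' := fun _ _ => funext fun k => by rcases k with k | k <;> rfl }
      (fun y => ⟨(fun i α => y (.inr (i, α)), fun I α => y (.inl (I, α))),
        funext fun k => by rcases k with k | k <;> rfl⟩) (S := SecondOrderField.graphOf FL)
      (fun e c => Sum.elim
        (fun k => SecondOrderField.legendreCoordTwo (e.localLagrangian η L) c k.1 k.2)
        fun k => SecondOrderField.legendreCoordOne (e.localLagrangian η L) c k.1 k.2)
      (fun e => contDiffOn_pi.2 fun k => by
        rcases k with k | k
        · exact contDiffOn_pi.1 (contDiffOn_pi.1 (hs₂ e) k.1) k.2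
        · exact contDiffOn_pi.1 (contDiffOn_pi.1 (hs₁ e) k.1) k.2)
      (fun e w hw => (hgraph e w hw).trans ⟨fun h => funext fun k => by
        rcases k with k | k
        · exact congrFun (congrFun (congrArg Prod.snd h) k.1) k.2
        · exact congrFun (congrFun (congrArg Prod.fst h) k.1) k.2,
        fun h => Prod.ext (funext fun i => funext fun α => congrFun h (.inr (i, α)))
          (funext fun I => funext fun α => congrFun h (.inl (I, α)))⟩)
    rwa [Fintype.card_sum, Fintype.card_prod, Fintype.card_prod, SecondOrderField.card_sym_two,
      Fintype.card_fin, Fintype.card_fin, mul_comm _ n, mul_comm m n] at h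
  · intro U ψ hU hψ x hx
    obtain ⟨h, -⟩ := hψ.2.1 x hx
    obtain ⟨e, he⟩ := SecondOrderField.exists_adaptedChart (n := n) hsubm (ψ x).toE
    have hb := (SecondOrderField.AdaptedChart.total_section h he).1
    have hy : e.base x ∈ e.exprDomain U ψ := by
      refine ⟨e.base.map_source hb, ?_⟩
      rw [e.base.left_inv hb]
      exact ⟨hx, he⟩
    have key := SecondOrderField.AdaptedChart.wrExpr_eq_of_isSolution hη hL hU hψ hy
    rw [SecondOrderField.AdaptedChart.wrExpr, e.base.left_inv hb] at key
    exact (hgraph e (ψ x) he).2 key
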